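/- Let $A(T),B(T)\in\mathbb{Z}[T]$ and consider the family $E_t:\ y^2=x^3+A(t)x+B(t)$, $t\in\mathbb{Z}$. Let $\Delta(T)=-16(4A(T)^3+27B(T)^2)$, and assume that only the primes $2$ and $3$ may divide all coefficients of $\Delta(T)$ (in particular $\Delta\neq0$). Let $D(T)$ be the product of the distinct non-constant primitive irreducible factors of $\Delta(T)$ in $\mathbb{Z}[T]$, let $3\le k\le\infty$, and for an integer $n$ let $\nu_D(n)$ be the number of solutions of $D(t)\equiv 0 \bmod n$. ("$k$-th power free" is no condition if $k=\infty$.) Assume: 1. for every $t\in\mathbb{Z}$ no prime divides the values at $t$ of two different irreducible factors of $D$; 2. for every $t$ with $\Delta(t)\ne0$ the curve $E_t$ has additive reduction at $2$ and at $3$; 3. for every $t$ with $\Delta(t)\neq0$ and $D(t)$ $k$-th power free, the equation of $E_t$ is minimal at every prime $p\ge5$; 4. if $k<\infty$: whenever $p\ge5$ is prime and $p^k\mid D(t)$, the equation of $E_t$ has a cusp modulo $p$ (that is, $p\mid A(t)$ and $p\mid B(t)$); every irreducible factor of $D$ has degree less than $k$; and $\nu_D(p^k)<p^k$ for every prime $p$.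 For $N\ge1$ let $\mathcal F=\mathcal F_N$ be the set of integers $t\in[N,2N]$ with $D(t)$ $k$-th power free, let $N_t$ be the conductor of $E_t$, and let $\log R=|\mathcal F|^{-1}\sum_{t\in\mathcal F}\log N_t$. Let $a_{E_t}(p)$ be the $p$-th coefficient of the $L$-function of $E_t$ and $\lambda_t(p)=a_{E_t}(p)/\sqrt p$; let $\alpha_t(p),\beta_t(p)$ be the roots of $X^2-\lambda_t(p)X+1$ if $p\nmid N_t$, and $\alpha_t(p)=\lambda_t(p)$, $\beta_t(p)=0$ if $p\mid N_t$. For an even Schwartz function $\phi$ with $\widehat\phi$ of compact support put $$S(\mathcal F)=-2\sum_p\sum_{m=1}^\infty\frac1{|\mathcal F|}\sum_{t\in\mathcal F}\frac{\alpha_t(p)^m+\beta_t(p)^m}{p^{m/2}}\,\frac{\log p}{\log R}\,\widehat\phi\Big(m\frac{\log p}{\log R}\Big).$$ For a prime $p$ and $t$ modulo $p$ let $a_t(p)=p+1-N_t(p)$, where $N_t(p)$ is the number of points (including the one at infinity) of $y^2=x^3+A(t)x+B(t)$ over $\mathbb{F}_p$, and set $$\mathcal A_r(p)=\sum_{\substack{t\bmod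 p\\ p\nmid\Delta(t)}}a_t(p)^r,\quad \mathcal A'_r(p)=\sum_{\substack{t\bmod p\\ p\mid\Delta(t)}}a_t(p)^r,\quad \widetilde{\mathcal A}(p)=\sum_{\substack{t\bmod p\\ p\nmid\Delta(t)}}\frac{a_t(p)^3}{p^{3/2}(p+1-a_t(p))},$$ $$H(p)=1+\frac{\nu_D(p^k)}{p^k}\Big(1-\frac{\nu_D(p^k)}{p^k}\Big)^{-1}\quad(H(p)=1\text{ if }k=\infty).$$ Then there is $\sigma>0$, depending only on $A,B,k$, such that for every even Schwartz function $\phi$ with $\operatorname{supp}\widehat\phi\subset(-\sigma,\sigma)$, as $N\to\infty$, $$S(\mathcal F)=S_{\mathcal A'}+S_0+S_1+S_2+S_{\widetilde{\mathcal A}}+O\Big(\frac1{\log^3R}\Big),$$ with an implied constant depending on $A,B,k,\phi$, where $$S_{\mathcal A'}=-2\widehat\phi(0)\sum_p\sum_{m=1}^\infty\frac{\mathcal A'_m(p)H(p)\log p}{p^{m+1}\log R},$$ $$S_0=-2\widehat\phi(0)\sum_p\frac{2\mathcal A_0(p)H(p)\log p}{p^2(p+1)\log R}+2\sum_p\frac{2\mathcal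 A_0(p)H(p)\log p}{p^2\log R}\,\widehat\phi\Big(2\frac{\log p}{\log R}\Big),$$ $$S_1=-2\sum_p\frac{\mathcal A_1(p)H(p)}{p^2}\frac{\log p}{\log R}\,\widehat\phi\Big(\frac{\log p}{\log R}\Big)+2\widehat\phi(0)\sum_p\frac{\mathcal A_1(p)H(p)(3p+1)}{p^2(p+1)^2}\frac{\log p}{\log R},$$ $$S_2=-2\sum_p\frac{\mathcal A_2(p)H(p)\log p}{p^3\log R}\,\widehat\phi\Big(2\frac{\log p}{\log R}\Big)+2\widehat\phi(0)\sum_p\frac{\mathcal A_2(p)H(p)(4p^2+3p+1)\log p}{p^3(p+1)^3\log R},$$ $$S_{\widetilde{\mathcal A}}=-2\widehat\phi(0)\sum_p\frac{\widetilde{\mathcal A}(p)H(p)\,p^{3/2}(p-1)\log p}{p(p+1)^3\log R},$$ and all these series converge absolutely. Moreover, if no $E_t$ with $D(t)$ $k$-th power free and $\Delta(t)\ne0$ has multiplicative reduction at any prime, then $S_{\mathcal A'}=0$. -/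

import Mathlib

open Polynomial SchwartzMap FourierTransform

namespace ECFamily

noncomputable section

/-! ### Local invariants of a Weierstrass equation with integer coefficients -/

/-- The curve over `ℚ_p` given by the integral Weierstrass equation `E`. -/
def atPrime (E : WeierstrassCurve ℤ) (p : ℕ) [Fact p.Prime] : WeierstrassCurve ℚ_[p] :=
  E.map (Int.castRingHom ℚ_[p])

/-- The given equation `E` is itself a minimal Weierstrass equation at `p`. -/
def MinimalAt (E : WeierstrassCurve ℤ) (p : ℕ) [Fact p.Prime] : Prop :=
  (atPrime E p).IsMinimal ℤ_[p]

/-- A minimal Weierstrass equation at `p` of the curve given by `E`. -/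
def minimalModel (E : WeierstrassCurve ℤ) (p : ℕ) [Fact p.Prime] : WeierstrassCurve ℚ_[p] :=
  (atPrime E p).minimal ℤ_[p]

/-- The curve given by `E` has good reduction at `p`. -/
def GoodAt (E : WeierstrassCurve ℤ) (p : ℕ) [Fact p.Prime] : Prop :=
  (minimalModel E p).HasGoodReduction ℤ_[p]

/-- The curve given by `E` has multiplicative reduction at `p`. -/
def MultiplicativeAt (E : WeierstrassCurve ℤ) (p : ℕ) [Fact p.Prime] : Prop :=
  (minimalModel E p).HasMultiplicativeReduction ℤ_[p]

/-- The curve given by `E` has additive reduction at `p`. -/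
def AdditiveAt (E : WeierstrassCurve ℤ) (p : ℕ) [Fact p.Prime] : Prop :=
  (minimalModel E p).HasAdditiveReduction ℤ_[p]

/-- `W` is in a normal form of Tate's algorithm for a Kodaira type of additive reduction whose
special fibre (of the minimal regular model, over the algebraic closure of the residue field) has
`m` irreducible components. The cases are the types `II`, `III`, `IV`, `I₀*`, `Iₙ*` for odd
`n = 2j - 3`, `Iₙ*` for even `n = 2j - 2 > 0`, `IV*`, `III*`, `II*`. -/
def TateNormalForm (p : ℕ) [Fact p.Prime] (W : WeierstrassCurve ℤ_[p]) (m : ℕ) : Prop :=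
  let π : ℤ_[p] := p
  let sing : Prop := π ∣ W.a₃ ∧ π ∣ W.a₄ ∧ π ∣ W.a₆ ∧ π ∣ W.b₂
  (sing ∧ ¬ π ^ 2 ∣ W.a₆ ∧ m = 1) ∨
  (sing ∧ π ^ 2 ∣ W.a₆ ∧ ¬ π ^ 3 ∣ W.b₈ ∧ m = 2) ∨
  (sing ∧ π ^ 2 ∣ W.a₆ ∧ π ^ 3 ∣ W.b₈ ∧ ¬ π ^ 3 ∣ W.b₆ ∧ m = 3) ∨
  (π ∣ W.a₁ ∧ π ^ 2 ∣ W.a₃ ∧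
    (∃ c₂ c₄ c₆ : ℤ_[p], W.a₂ = π * c₂ ∧ W.a₄ = π ^ 2 * c₄ ∧ W.a₆ = π ^ 3 * c₆ ∧
      ¬ π ∣ (Cubic.mk 1 c₂ c₄ c₆).discr) ∧ m = 5) ∨
  (π ∣ W.a₁ ∧ π ∣ W.a₂ ∧ ¬ π ^ 2 ∣ W.a₂ ∧
    ∃ j : ℕ, 2 ≤ j ∧ π ^ j ∣ W.a₃ ∧ π ^ (j + 1) ∣ W.a₄ ∧ π ^ (2 * j) ∣ W.a₆ ∧
      ¬ π ^ (2 * j + 1) ∣ W.a₃ ^ 2 + 4 * W.a₆ ∧ m = 2 * j + 2) ∨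
  (π ∣ W.a₁ ∧ π ∣ W.a₂ ∧ ¬ π ^ 2 ∣ W.a₂ ∧
    ∃ j : ℕ, 2 ≤ j ∧ π ^ (j + 1) ∣ W.a₃ ∧ π ^ (j + 1) ∣ W.a₄ ∧ π ^ (2 * j + 1) ∣ W.a₆ ∧
      ¬ π ^ (2 * j + 3) ∣ W.a₄ ^ 2 - 4 * W.a₂ * W.a₆ ∧ m = 2 * j + 3) ∨
  (π ∣ W.a₁ ∧ π ^ 2 ∣ W.a₂ ∧ π ^ 2 ∣ W.a₃ ∧ π ^ 3 ∣ W.a₄ ∧ π ^ 4 ∣ W.a₆ ∧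
    ¬ π ^ 5 ∣ W.a₃ ^ 2 + 4 * W.a₆ ∧ m = 7) ∨
  (π ∣ W.a₁ ∧ π ^ 2 ∣ W.a₂ ∧ π ^ 3 ∣ W.a₃ ∧ π ^ 3 ∣ W.a₄ ∧ π ^ 5 ∣ W.a₆ ∧
    ¬ π ^ 4 ∣ W.a₄ ∧ m = 8) ∨
  (π ∣ W.a₁ ∧ π ^ 2 ∣ W.a₂ ∧ π ^ 3 ∣ W.a₃ ∧ π ^ 4 ∣ W.a₄ ∧ π ^ 5 ∣ W.a₆ ∧
    ¬ π ^ 6 ∣ W.a₆ ∧ m = 9)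

/-- The number of geometric components of the special fibre at a prime of additive reduction. -/
def numComponents (E : WeierstrassCurve ℤ) (p : ℕ) [Fact p.Prime] : ℕ :=
  sInf {m | ∃ W : WeierstrassCurve ℤ_[p],
    (∃ C : WeierstrassCurve.VariableChange ℚ_[p], W.baseChange ℚ_[p] = C • atPrime E p) ∧
      TateNormalForm p W m}

/-- The valuation at `p` of the minimal discriminant. -/
def minDiscValuation (E : WeierstrassCurve ℤ) (p : ℕ) [Fact p.Prime] : ℤ :=
  (minimalModel E p).Δ.valuation

open Classical in
/-- The exponent of the conductor at `p`: `0` for good, `1` for multiplicative and `2 + δ` for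
additive reduction, with the wild part `δ = v(Δ_min) - m - 1 ≥ 0` given by the Ogg–Saito
formula. -/
def conductorExponent (E : WeierstrassCurve ℤ) (p : ℕ) [Fact p.Prime] : ℕ :=
  if GoodAt E p then 0
  else if MultiplicativeAt E p then 1
  else 2 + (minDiscValuation E p - numComponents E p - 1).toNat

/-- The conductor of the elliptic curve given by `E`. -/
def conductor (E : WeierstrassCurve ℤ) : ℕ :=
  ∏ᶠ p : Nat.Primes, (p : ℕ) ^ (haveI : Fact (p : ℕ).Prime := ⟨p.2⟩; conductorExponent E p)

/-- The coefficient `a_E(p)` of the `L`-function of the elliptic curve given by `E`: the local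
Euler factor is `1 - a_E(p) T + p T²` at good primes and `1 - a_E(p) T` at bad primes. -/
def traceAt (E : WeierstrassCurve ℤ) (p : ℕ) [Fact p.Prime] : ℤ :=
  -((atPrime E p).localPolynomial ℤ_[p]).coeff 1

/-- `λ_E(p) = a_E(p) / √p`. -/
def lam (E : WeierstrassCurve ℤ) (p : ℕ) [Fact p.Prime] : ℝ :=
  traceAt E p / √(p : ℝ)

open Classical in
/-- The Satake parameter `α_E(p)`: one of the two roots of `X² - λ_E(p) X + 1` if `p` does not
divide the conductor, and `λ_E(p)` otherwise. -/
def satakeAlpha (E : WeierstrassCurve ℤ) (p : ℕ) [Fact p.Prime] : ℂ :=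
  if p ∣ conductor E then (lam E p : ℂ)
  else ((lam E p : ℂ) + ((lam E p : ℂ) ^ 2 - 4) ^ (1 / 2 : ℂ)) / 2

open Classical in
/-- The Satake parameter `β_E(p)`: the other root of `X² - λ_E(p) X + 1` if `p` does not
divide the conductor, and `0` otherwise. -/
def satakeBeta (E : WeierstrassCurve ℤ) (p : ℕ) [Fact p.Prime] : ℂ :=
  if p ∣ conductor E then 0
  else ((lam E p : ℂ) - ((lam E p : ℂ) ^ 2 - 4) ^ (1 / 2 : ℂ)) / 2

/-! ### The family -/

/-- The specialization `E_t : y² = x³ + A(t) x + B(t)`. -/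
def curve (A B : ℤ[X]) (t : ℤ) : WeierstrassCurve ℤ := ⟨0, 0, 0, A.eval t, B.eval t⟩

/-- The discriminant `Δ(T) = -16 (4 A(T)³ + 27 B(T)²)`. -/
def discPoly (A B : ℤ[X]) : ℤ[X] := -16 * (4 * A ^ 3 + 27 * B ^ 2)

open Classical in
/-- The distinct irreducible (primitive, non-constant) polynomial factors of `Δ(T)` in `ℤ[T]`,
normalized to have positive leading coefficient. -/
def discFactors (A B : ℤ[X]) : Finset ℤ[X] :=
  (UniqueFactorizationMonoid.normalizedFactors (discPoly A B)).toFinset.filter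
    fun f => 0 < f.natDegree

/-- `D(T)`, the product of the irreducible polynomial factors of `Δ(T)`. -/
def sievePoly (A B : ℤ[X]) : ℤ[X] := ∏ f ∈ discFactors A B, f

/-- `n` is `k`-th power free; there is no condition for `k = ∞`. -/
def PowerFree (k : ℕ∞) (n : ℤ) : Prop :=
  ∀ j : ℕ, k = j → ∀ p : ℕ, p.Prime → ¬ (p : ℤ) ^ j ∣ n

open Classical in
/-- The `t ∈ [N, 2N]` of weight one: those for which `D(t)` is `k`-th power free. -/
def family (A B : ℤ[X]) (k : ℕ∞) (N : ℕ) : Finset ℤ :=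
  (Finset.Icc (N : ℤ) (2 * N)).filter fun t => PowerFree k ((sievePoly A B).eval t)

/-- `log R`, the average log-conductor of the family. -/
def logR (A B : ℤ[X]) (k : ℕ∞) (N : ℕ) : ℝ :=
  (∑ t ∈ family A B k N, Real.log (conductor (curve A B t))) / (family A B k N).card

/-- `S(F)` for the test function whose Fourier transform is `g` (compactly supported, so that only
finitely many terms are nonzero when `log R > 0`); the summation index `m` stands for the
exponent `m + 1`. -/
def S (A B : ℤ[X]) (k : ℕ∞) (g : ℝ → ℂ) (N : ℕ) : ℂ :=
  -2 * ∑' p : Nat.Primes, ∑' m : ℕ,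
    haveI : Fact (p : ℕ).Prime := ⟨p.2⟩
    (1 / ((family A B k N).card : ℂ)) *
      (∑ t ∈ family A B k N,
        (satakeAlpha (curve A B t) p ^ (m + 1) + satakeBeta (curve A B t) p ^ (m + 1)) /
          ((√(p : ℝ) ^ (m + 1) : ℝ) : ℂ)) *
      ((Real.log p / logR A B k N : ℝ) : ℂ) *
      g ((m + 1) * (Real.log p / logR A B k N))

/-! ### Complete sums -/

/-- `a_t(p) = p + 1 - N_t(p)` for `t` modulo `p`, where `N_t(p)` is the number of points, including
the point at infinity, of the reduced equation `y² = x³ + A(t) x + B(t)` modulo `p`. -/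
def aMod (A B : ℤ[X]) (p : ℕ) [Fact p.Prime] (t : ZMod p) : ℤ :=
  p + 1 - (1 + Nat.card {P : ZMod p × ZMod p //
    P.2 ^ 2 = P.1 ^ 3 + aeval t A * P.1 + aeval t B})

open Classical in
/-- `𝒜_r(p)`: the sum of `a_t(p)^r` over `t` modulo `p` with `p ∤ Δ(t)`. -/
def calA (A B : ℤ[X]) (r p : ℕ) [Fact p.Prime] : ℝ :=
  ∑ t : ZMod p with aeval t (discPoly A B) ≠ 0, (aMod A B p t : ℝ) ^ r

open Classical in
/-- `𝒜'_r(p)`: the sum of `a_t(p)^r` over `t` modulo `p` with `p ∣ Δ(t)`. -/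
def calA' (A B : ℤ[X]) (r p : ℕ) [Fact p.Prime] : ℝ :=
  ∑ t : ZMod p with aeval t (discPoly A B) = 0, (aMod A B p t : ℝ) ^ r

open Classical in
/-- `𝒜̃(p)`: the sum of `a_t(p)³ / (p^{3/2} (p + 1 - a_t(p)))` over `t` modulo `p` with
`p ∤ Δ(t)`. -/
def calATilde (A B : ℤ[X]) (p : ℕ) [Fact p.Prime] : ℝ :=
  ∑ t : ZMod p with aeval t (discPoly A B) ≠ 0,
    (aMod A B p t : ℝ) ^ 3 / ((p : ℝ) ^ (3 / 2 : ℝ) * ((p : ℝ) + 1 - aMod A B p t))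

/-- `ν_D(n)`, the number of solutions of `D(t) ≡ 0` modulo `n`. -/
def nu (D : ℤ[X]) (n : ℕ) : ℕ := Nat.card {t : ZMod n // aeval t D = 0}

/-- The sieve factor `H_{D,k}(p)`; it is `1` for `k = ∞`. -/
def sieveH (D : ℤ[X]) (k : ℕ∞) (p : ℕ) : ℝ :=
  if k = ⊤ then 1
  else 1 + (nu D (p ^ k.toNat) : ℝ) / (p : ℝ) ^ k.toNat *
    (1 - (nu D (p ^ k.toNat) : ℝ) / (p : ℝ) ^ k.toNat)⁻¹

/-- `H_{D,k}(p) log p` for the family. -/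
def HLog (A B : ℤ[X]) (k : ℕ∞) (p : ℕ) : ℝ := sieveH (sievePoly A B) k p * Real.log p

/-! ### The terms of the expansion, without the factors `1 / log R` and the test function -/

/-- `𝒜'_{m+1}(p) H(p) log p / p^{(m+1)+1}`. -/
def termA' (A B : ℤ[X]) (k : ℕ∞) (p : Nat.Primes) (m : ℕ) : ℝ :=
  haveI : Fact (p : ℕ).Prime := ⟨p.2⟩
  calA' A B (m + 1) p * HLog A B k p / (p : ℝ) ^ (m + 2)

/-- `2 𝒜_0(p) H(p) log p / (p² (p+1))`. -/
def term0 (A B : ℤ[X]) (k : ℕ∞) (p : Nat.Primes) : ℝ :=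
  haveI : Fact (p : ℕ).Prime := ⟨p.2⟩
  2 * calA A B 0 p * HLog A B k p / ((p : ℝ) ^ 2 * ((p : ℝ) + 1))

/-- `2 𝒜_0(p) H(p) log p / p²`. -/
def main0 (A B : ℤ[X]) (k : ℕ∞) (p : Nat.Primes) : ℝ :=
  haveI : Fact (p : ℕ).Prime := ⟨p.2⟩
  2 * calA A B 0 p * HLog A B k p / (p : ℝ) ^ 2

/-- `𝒜_1(p) H(p) (3p+1) log p / (p² (p+1)²)`. -/
def term1 (A B : ℤ[X]) (k : ℕ∞) (p : Nat.Primes) : ℝ :=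
  haveI : Fact (p : ℕ).Prime := ⟨p.2⟩
  calA A B 1 p * HLog A B k p * (3 * p + 1) / ((p : ℝ) ^ 2 * ((p : ℝ) + 1) ^ 2)

/-- `𝒜_1(p) H(p) log p / p²`. -/
def main1 (A B : ℤ[X]) (k : ℕ∞) (p : Nat.Primes) : ℝ :=
  haveI : Fact (p : ℕ).Prime := ⟨p.2⟩
  calA A B 1 p * HLog A B k p / (p : ℝ) ^ 2

/-- `𝒜_2(p) H(p) (4p²+3p+1) log p / (p³ (p+1)³)`. -/
def term2 (A B : ℤ[X]) (k : ℕ∞) (p : Nat.Primes) : ℝ :=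
  haveI : Fact (p : ℕ).Prime := ⟨p.2⟩
  calA A B 2 p * HLog A B k p * (4 * (p : ℝ) ^ 2 + 3 * p + 1) /
    ((p : ℝ) ^ 3 * ((p : ℝ) + 1) ^ 3)

/-- `𝒜_2(p) H(p) log p / p³`. -/
def main2 (A B : ℤ[X]) (k : ℕ∞) (p : Nat.Primes) : ℝ :=
  haveI : Fact (p : ℕ).Prime := ⟨p.2⟩
  calA A B 2 p * HLog A B k p / (p : ℝ) ^ 3

/-- `𝒜̃(p) H(p) p^{3/2} (p-1) log p / (p (p+1)³)`. -/
def termTilde (A B : ℤ[X]) (k : ℕ∞) (p : Nat.Primes) : ℝ :=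
  haveI : Fact (p : ℕ).Prime := ⟨p.2⟩
  calATilde A B p * HLog A B k p * (p : ℝ) ^ (3 / 2 : ℝ) * ((p : ℝ) - 1) /
    ((p : ℝ) * ((p : ℝ) + 1) ^ 3)

/-- `S_{𝒜'}(F)`. -/
def SA' (A B : ℤ[X]) (k : ℕ∞) (g : ℝ → ℂ) (N : ℕ) : ℂ :=
  -2 * g 0 * ∑' p : Nat.Primes, ∑' m : ℕ, ((termA' A B k p m / logR A B k N : ℝ) : ℂ)

/-- `S_0(F)`. -/
def S0 (A B : ℤ[X]) (k : ℕ∞) (g : ℝ → ℂ) (N : ℕ) : ℂ :=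
  -2 * g 0 * (∑' p : Nat.Primes, ((term0 A B k p / logR A B k N : ℝ) : ℂ)) +
    2 * ∑' p : Nat.Primes, ((main0 A B k p / logR A B k N : ℝ) : ℂ) *
      g (2 * (Real.log p / logR A B k N))

/-- `S_1(F)`. -/
def S1 (A B : ℤ[X]) (k : ℕ∞) (g : ℝ → ℂ) (N : ℕ) : ℂ :=
  -2 * (∑' p : Nat.Primes, ((main1 A B k p / logR A B k N : ℝ) : ℂ) *
      g (Real.log p / logR A B k N)) +
    2 * g 0 * ∑' p : Nat.Primes, ((term1 A B k p / logR A B k N : ℝ) : ℂ)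

/-- `S_2(F)`. -/
def S2 (A B : ℤ[X]) (k : ℕ∞) (g : ℝ → ℂ) (N : ℕ) : ℂ :=
  -2 * (∑' p : Nat.Primes, ((main2 A B k p / logR A B k N : ℝ) : ℂ) *
      g (2 * (Real.log p / logR A B k N))) +
    2 * g 0 * ∑' p : Nat.Primes, ((term2 A B k p / logR A B k N : ℝ) : ℂ)

/-- `S_{𝒜̃}(F)`. -/
def STilde (A B : ℤ[X]) (k : ℕ∞) (g : ℝ → ℂ) (N : ℕ) : ℂ :=
  -2 * g 0 * ∑' p : Nat.Primes, ((termTilde A B k p / logR A B k N : ℝ) : ℂ)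

end

end ECFamily

/-! The expansion becomes a statement about residue classes. For each prime `p` and exponent `m`,
the normalized power sum of the Satake parameters of `E_t`, for `t` in the family, depends only on
`t` modulo `p` (`satake_eq_localSum`). For `p ≥ 5` the equation is minimal, so the coefficient of
the `L`-function is the point-count trace `a_t(p)`, at bad primes too (`traceAt_eq_aMod`). For `p =
2, 3` additive reduction makes every class bad and every `a_t(p)` zero, so both sides vanish
(`aMod_eq_zero_of_lt_five`).

A sieve shows that a class modulo `p` untouched by the condition at `p` contains the proportion
`H(p) / p` of the family, with error `O(N ^ (-δ))` uniform in `p`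
(`exists_family_equidistribution`). In a class that is touched, the equation has a cusp and the
local sum is zero, so the missing equidistribution does no harm. Hence the average over the family
is `H(p) / p` times the complete sum of `localSum`, up to `O(p N ^ (-δ))` (`norm_average_sub_le`).
The test function restricts to `p ^ m < R ^ σ`, and `log R = O(log N)`, so for small `σ` the
accumulated error is still a negative power of `N` (`norm_S_sub_le`).

In the main term the bad classes give `𝒜'_m(p)`. In the good classes the exponents `1` and `2` give
the sums over primes that keep the test function, while the exponents from `3` on form a
geometric-type series whose sum is a polynomial of degree two in `a_t(p)` plus a cubic remainder
(`hasSum_powerSum`). These pieces are `S₀`, `S₁`, `S₂` and the tilde term (`hasSum_goodPart`). An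
even Schwartz function satisfies `g x - g 0 = O(x ^ 2)`. With the factor `1 / log R`, replacing `g`
by `g 0` in the rapidly convergent part costs `O(1 / log ^ 3 R)` (`norm_tsum_mul_sub_le`).

The convergence needs `a_t(p) = O(√p)` with any constant, together with `|a_t(p)| ≤ p` to keep the
roots away from the unit circle at small primes. Stepanov's method supplies `30 √p`
(`abs_aMod_le_sqrt`).

The last claim uses equidistribution once more: a node in some class modulo `p ≥ 5` would be
realized by a member of the family, which would then have multiplicative reduction there
(`termA'_eq_zero`). -/

namespace ECFamily

noncomputable section

/-! ### A square-root bound for the number of points on `y² = f(x)`, `f` a cubic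

The auxiliary polynomial method of Stepanov. -/

section Stepanov

variable {K : Type*} [Field K]

/-- The operator `h ↦ f * Dh + e * Df * h`, for which `D(f ^ e * h)` is `f ^ (e - 1)` times the
image of `h`. -/
def twistDeriv (f : K[X]) (e : ℕ) : K[X] →ₗ[K] K[X] :=
  LinearMap.mulLeft K f ∘ₗ derivative + LinearMap.mulLeft K (C (e : K) * derivative f)

/-- The iterates of `twistDeriv`, starting at the exponent `e`. -/
def iterTwistDeriv (f : K[X]) (e : ℕ) : ℕ → (K[X] →ₗ[K] K[X])
  | 0 => LinearMap.id
  | i + 1 => twistDeriv f (e - i) ∘ₗ iterTwistDeriv f e i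

lemma derivative_pow_mul (f h : K[X]) {e : ℕ} (he : 1 ≤ e) :
    derivative (f ^ e * h) = f ^ (e - 1) * twistDeriv f e h := by
  obtain ⟨e, rfl⟩ := Nat.exists_eq_add_of_le' he
  simp only [twistDeriv, derivative_mul, derivative_pow, LinearMap.add_apply,
    LinearMap.comp_apply, LinearMap.mulLeft_apply, Nat.add_sub_cancel, map_natCast]
  ring

/-- In characteristic `p` the factor `X ^ (p * j)` is a constant for the derivation, so each
derivative only consumes one power of `f`. This lets the auxiliary polynomial have large degree
while the vanishing conditions involve polynomials of small degree. -/
lemma iterate_derivative_pow_mul_X_pow (p : ℕ) [CharP K p] (f h : K[X]) (e j : ℕ) :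
    ∀ i ≤ e, derivative^[i] (f ^ e * h * X ^ (p * j)) =
      f ^ (e - i) * iterTwistDeriv f e i h * X ^ (p * j)
  | 0, _ => by simp [iterTwistDeriv]
  | i + 1, hi => by
    have hX : derivative (X ^ (p * j) : K[X]) = 0 := by
      simp [derivative_X_pow]
    rw [Function.iterate_succ_apply', iterate_derivative_pow_mul_X_pow p f h e j i (by omega),
      derivative_mul, hX, derivative_pow_mul _ _ (by omega)]
    simp [iterTwistDeriv, Nat.sub_sub]

lemma natDegree_twistDeriv_le {f : K[X]} (hf : f.natDegree ≤ 3) (e : ℕ) (h : K[X]) :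
    (twistDeriv f e h).natDegree ≤ h.natDegree + 2 := by
  simp only [twistDeriv, LinearMap.add_apply, LinearMap.comp_apply, LinearMap.mulLeft_apply]
  refine natDegree_add_le_of_degree_le ?_ ?_
  · rcases Nat.eq_zero_or_pos h.natDegree with h0 | h0
    · rw [natDegree_eq_zero] at h0
      obtain ⟨c, rfl⟩ := h0
      simp
    · have := natDegree_derivative_le h
      exact natDegree_mul_le.trans (by omega)
  · have h1 := natDegree_derivative_le f
    have h2 : (C (e : K) * derivative f).natDegree ≤ 2 :=
      (natDegree_C_mul_le _ _).trans (by omega)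
    exact natDegree_mul_le.trans (by omega)

lemma natDegree_iterTwistDeriv_le {f : K[X]} (hf : f.natDegree ≤ 3) (e : ℕ) (h : K[X]) (i : ℕ) :
    (iterTwistDeriv f e i h).natDegree ≤ h.natDegree + 2 * i := by
  induction i with
  | zero => simp [iterTwistDeriv]
  | succ i ih =>
    have := natDegree_twistDeriv_le hf (e - i) (iterTwistDeriv f e i h)
    simp only [iterTwistDeriv, LinearMap.comp_apply]
    omega

/-- Frobenius applied to `f ≡ f(0)` modulo `X`; over the prime field `f(0) ^ p = f(0)`. -/
lemma X_pow_char_dvd_pow_sub (p : ℕ) [Fact p.Prime] (f : (ZMod p)[X]) :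
    (X : (ZMod p)[X]) ^ p ∣ f ^ p - C (f.eval 0) := by
  have h : (X : (ZMod p)[X]) ∣ f - C (f.eval 0) := by
    rw [X_dvd_iff]; simp [coeff_zero_eq_eval_zero]
  have := pow_dvd_pow_of_dvd h p
  rwa [sub_pow_char, ← C_pow, ZMod.pow_card] at this

/-- Parity of degrees: for `r ≠ 0` the left side has odd degree and the right side even degree. This
replaces any assumption that `f` be squarefree. -/
lemma eq_zero_of_sq_mul_eq {f r s : K[X]} (hf : Odd f.natDegree) {c : K} (hc : c ≠ 0)
    (h : r ^ 2 * f = C c * s ^ 2) : r = 0 ∧ s = 0 := by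
  have hf0 : f ≠ 0 := by rintro rfl; simp at hf
  by_cases hr : r = 0
  · subst hr
    simpa [hc] using h.symm
  · exfalso
    have hd := congrArg natDegree h
    rw [natDegree_mul (pow_ne_zero _ hr) hf0, natDegree_pow, natDegree_C_mul hc,
      natDegree_pow] at hd
    obtain ⟨m, hm⟩ := hf
    omega

/-- Independence of the monomials of the auxiliary polynomial, which guarantees that it is nonzero.
One peels off the lowest block: modulo `X ^ p` only `r 0 + s 0 * f ^ (p / 2)` survives, and for odd
`p` the exponent `p / 2` is `(p - 1) / 2`. -/
lemma sum_twisted_eq_zero (p : ℕ) [Fact p.Prime] (hp : p ≠ 2) {f : (ZMod p)[X]}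
    (hf : f.natDegree = 3) (hf0 : f.eval 0 ≠ 0) (J : ℕ) :
    ∀ r s : ℕ → (ZMod p)[X], (∀ j, 2 * (r j).natDegree + 3 < p) →
      (∀ j, 2 * (s j).natDegree + 3 < p) →
      ∑ j ∈ Finset.range J, (r j + s j * f ^ (p / 2)) * X ^ (p * j) = 0 →
      ∀ j < J, r j = 0 ∧ s j = 0 := by
  induction J with
  | zero => intro r s _ _ _ j hj; omega
  | succ J ih =>
    intro r s hr hs h
    have hp2 : p / 2 + p / 2 + 1 = p := by
      have := (Fact.out : p.Prime).eq_two_or_odd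
      omega
    have hsplit : (∑ j ∈ Finset.range J,
        (r (j + 1) + s (j + 1) * f ^ (p / 2)) * X ^ (p * j)) * X ^ p +
        (r 0 + s 0 * f ^ (p / 2)) = 0 := by
      rw [Finset.sum_range_succ'] at h
      rw [← h, Finset.sum_mul]
      simp only [mul_zero, pow_zero, mul_one, add_left_inj]
      refine Finset.sum_congr rfl fun j _ => ?_
      ring
    have hdvd : (X : (ZMod p)[X]) ^ p ∣ r 0 + s 0 * f ^ (p / 2) := by
      rw [← dvd_add_right (Dvd.intro_left _ rfl), hsplit]
      exact dvd_zero _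
    -- Multiplying by the conjugate `r 0 - s 0 * f ^ (p / 2)` and by `f` turns the high power of `f`
    -- into `f ^ p`, which is `f(0)` modulo `X ^ p`. What remains has degree below `p`, hence
    -- vanishes.
    have hdvd2 : (X : (ZMod p)[X]) ^ p ∣ r 0 ^ 2 * f - C (f.eval 0) * s 0 ^ 2 := by
      have h1 := hdvd.mul_right ((r 0 - s 0 * f ^ (p / 2)) * f)
      have h2 := (X_pow_char_dvd_pow_sub p f).mul_left (s 0 ^ 2)
      have h3 := dvd_add h1 h2
      have hfp : f ^ p = f ^ (p / 2) * f ^ (p / 2) * f := by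
        rw [← pow_add, ← pow_succ, hp2]
      rw [hfp] at h3
      convert h3 using 1
      ring
    have hzero : r 0 ^ 2 * f - C (f.eval 0) * s 0 ^ 2 = 0 := by
      by_contra hne
      have h1 := natDegree_le_of_dvd hdvd2 hne
      rw [natDegree_X_pow] at h1
      have h2 : (r 0 ^ 2 * f).natDegree < p :=
        natDegree_mul_le.trans_lt
          (by have := hr 0; have := natDegree_pow_le (p := r 0) (n := 2); omega)
      have h3 : (C (f.eval 0) * s 0 ^ 2).natDegree < p :=
        (natDegree_C_mul_le _ _).trans_lt
          (by have := hs 0; have := natDegree_pow_le (p := s 0) (n := 2); omega)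
      have := natDegree_sub_le (r 0 ^ 2 * f) (C (f.eval 0) * s 0 ^ 2)
      omega
    have h0 := eq_zero_of_sq_mul_eq (by rw [hf]; decide) hf0 (sub_eq_zero.mp hzero)
    have hrest := ih (fun j => r (j + 1)) (fun j => s (j + 1)) (fun j => hr _) (fun j => hs _) (by
      rw [h0.1, h0.2] at hsplit
      simpa using hsplit)
    intro j hj
    cases j with
    | zero => exact h0
    | succ j => exact hrest j (by omega)

/-- Vanishing of the first `ℓ` derivatives forces multiplicity `ℓ` only if `(ℓ - 1)!` is invertible,
whence the bound `ℓ ≤ p`. -/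
lemma card_mul_le_natDegree_of_derivatives {p : ℕ} [Fact p.Prime] {r : (ZMod p)[X]} (hr : r ≠ 0)
    {ℓ : ℕ} (hℓ : ℓ ≤ p) (T : Finset (ZMod p))
    (h : ∀ x ∈ T, ∀ i < ℓ, (derivative^[i] r).eval x = 0) : T.card * ℓ ≤ r.natDegree := by
  rcases Nat.eq_zero_or_pos ℓ with rfl | hpos
  · simp
  have hm : ∀ x ∈ T, ℓ ≤ r.roots.count x := by
    intro x hx
    rw [count_roots]
    have := lt_rootMultiplicity_of_isRoot_iterate_derivative_of_mem_nonZeroDivisors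
      (p := r) (t := x) (n := ℓ - 1) hr (fun m hm => h x hx m (by omega)) (by
        rw [mem_nonZeroDivisors_iff_ne_zero, Ne, ZMod.natCast_eq_zero_iff,
          (Fact.out : p.Prime).dvd_factorial]
        omega)
    omega
  calc T.card * ℓ = ∑ x ∈ T, ℓ := by simp
    _ ≤ ∑ x ∈ T, r.roots.count x := Finset.sum_le_sum hm
    _ ≤ r.roots.card := by
      classical
      calc ∑ x ∈ T, r.roots.count x ≤ ∑ x ∈ T ∪ r.roots.toFinset, r.roots.count x :=
            Finset.sum_le_sum_of_subset Finset.subset_union_left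
        _ = r.roots.card := Multiset.sum_count_eq_card (by simp +contextual)
    _ ≤ r.natDegree := card_roots' r

/-- The auxiliary polynomial of Stepanov's method gives a bound for the number of `x` at which
`f(x)` vanishes or has the quadratic character `a`. -/
lemma stepanov_card_mul_le (p : ℕ) [Fact p.Prime] {f : (ZMod p)[X]}
    (hf : f.natDegree = 3) (hf0 : f.eval 0 ≠ 0) (a : ZMod p) (M ℓ J : ℕ) (hM : 1 ≤ M)
    (hMp : 2 * M + 1 < p) (hℓ : ℓ ≤ p)
    (hdim : ℓ * (M + 2 * ℓ + J) < J * (M + M)) (T : Finset (ZMod p))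
    (hT : ∀ x ∈ T, f.eval x = 0 ∨ (f.eval x) ^ (p / 2) = a) :
    T.card * ℓ ≤ 3 * ℓ + M + 3 * (p / 2) + p * J := by
  classical
  set Q := M + 2 * ℓ + J with hQ
  let V := Fin J → (degreeLT (ZMod p) M × degreeLT (ZMod p) M)
  have : FiniteDimensional (ZMod p) (degreeLT (ZMod p) M) :=
    LinearEquiv.finiteDimensional (degreeLTEquiv (ZMod p) M).symm
  -- At a point `x` with `f(x) ^ (p / 2) = a` one may replace `X ^ (p * j)` by `x ^ j` and `f ^ (p /
  -- 2)` by `a`. After removing a power of `f(x)`, the `i`-th derivative is the value at `x` of this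
  -- polynomial of degree less than `Q`; it is required to vanish identically.
  let cond (i : Fin ℓ) : V →ₗ[ZMod p] (ZMod p)[X] :=
    ∑ j : Fin J, LinearMap.mulLeft (ZMod p) (X ^ (j : ℕ)) ∘ₗ
      (iterTwistDeriv f ℓ i ∘ₗ (degreeLT (ZMod p) M).subtype ∘ₗ LinearMap.fst _ _ _ +
        a • (iterTwistDeriv f (ℓ + p / 2) i ∘ₗ (degreeLT (ZMod p) M).subtype ∘ₗ
          LinearMap.snd _ _ _)) ∘ₗ LinearMap.proj j
  let Φ : V →ₗ[ZMod p] (Fin ℓ → Fin Q → ZMod p) :=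
    LinearMap.pi fun i => LinearMap.pi fun c => lcoeff (ZMod p) (c : ℕ) ∘ₗ cond i
  have hfr : Module.finrank (ZMod p) (degreeLT (ZMod p) M) = M := by
    rw [(degreeLTEquiv (ZMod p) M).finrank_eq]; simp
  -- There are `2 * M * J` unknown coefficients against `ℓ * Q` linear equations.
  have hker : LinearMap.ker Φ ≠ ⊥ := by
    apply LinearMap.ker_ne_bot_of_finrank_lt
    simp only [V, Module.finrank_pi_fintype, Module.finrank_prod, hfr]
    simpa using hdim
  obtain ⟨v, hv, hv0⟩ := (Submodule.ne_bot_iff _).mp hker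
  have hvdeg : ∀ w : degreeLT (ZMod p) M, (w : (ZMod p)[X]).natDegree < M := fun w => by
    have := mem_degreeLT.mp w.2
    by_cases hw : (w : (ZMod p)[X]) = 0
    · rw [hw, natDegree_zero]; exact hM
    · exact (natDegree_lt_iff_degree_lt hw).mpr this
  have hcv : ∀ i : Fin ℓ, cond i v = ∑ j : Fin J, X ^ (j : ℕ) *
      (iterTwistDeriv f ℓ i ((v j).1 : (ZMod p)[X]) +
        a • iterTwistDeriv f (ℓ + p / 2) i ((v j).2 : (ZMod p)[X])) := fun i => by
    simp only [cond, LinearMap.sum_apply]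
    rfl
  have hcond : ∀ i : Fin ℓ, cond i v = 0 := by
    intro i
    have hdeg : (cond i v).natDegree < Q := by
      have hb : (cond i v).natDegree ≤ (M - 1) + 2 * ℓ + J := by
        rw [hcv]
        refine natDegree_sum_le_of_forall_le _ _ fun j _ => ?_
        refine natDegree_mul_le.trans ?_
        rw [natDegree_X_pow]
        have h1 := natDegree_iterTwistDeriv_le hf.le ℓ ((v j).1 : (ZMod p)[X]) i
        have h2 := natDegree_iterTwistDeriv_le hf.le (ℓ + p / 2) ((v j).2 : (ZMod p)[X]) i
        have h3 := natDegree_smul_le a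
          (iterTwistDeriv f (ℓ + p / 2) i ((v j).2 : (ZMod p)[X]))
        have h4 := hvdeg (v j).1
        have h5 := hvdeg (v j).2
        have h6 := natDegree_add_le (iterTwistDeriv f ℓ i ((v j).1 : (ZMod p)[X]))
          (a • iterTwistDeriv f (ℓ + p / 2) i ((v j).2 : (ZMod p)[X]))
        have h7 := i.2
        have h8 := j.2
        omega
      omega
    ext c
    rw [coeff_zero]
    by_cases hc : c < Q
    · have := congrFun (congrFun (LinearMap.mem_ker.mp hv) i) ⟨c, hc⟩
      simpa [Φ] using this
    · exact coeff_eq_zero_of_natDegree_lt (by omega)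
  let r : ℕ → (ZMod p)[X] := fun j => if h : j < J then ((v ⟨j, h⟩).1 : (ZMod p)[X]) else 0
  let s : ℕ → (ZMod p)[X] := fun j => if h : j < J then ((v ⟨j, h⟩).2 : (ZMod p)[X]) else 0
  have hrdeg : ∀ j, (r j).natDegree < M := fun j => by
    by_cases h : j < J
    · simpa [r, h] using hvdeg _
    · simp only [r, h, dite_false, natDegree_zero]; exact hM
  have hsdeg : ∀ j, (s j).natDegree < M := fun j => by
    by_cases h : j < J
    · simpa [s, h] using hvdeg _
    · simp only [s, h, dite_false, natDegree_zero]; exact hM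
  set R : (ZMod p)[X] := ∑ j ∈ Finset.range J, (r j + s j * f ^ (p / 2)) * X ^ (p * j) with hR
  have hR0 : R ≠ 0 := by
    intro h0
    apply hv0
    have := sum_twisted_eq_zero p (by omega) hf hf0 J r s (fun j => by have := hrdeg j; omega)
      (fun j => by have := hsdeg j; omega) h0
    funext j
    have hj := this j j.2
    simp only [r, s, j.2, dif_pos] at hj
    exact Prod.ext (Subtype.ext hj.1) (Subtype.ext hj.2)
  have hfne : f ≠ 0 := by rintro rfl; simp at hf
  have hne : f ^ ℓ * R ≠ 0 := mul_ne_zero (pow_ne_zero _ hfne) hR0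
  have hexp : f ^ ℓ * R = ∑ j ∈ Finset.range J, (f ^ ℓ * r j * X ^ (p * j) +
      f ^ (ℓ + p / 2) * s j * X ^ (p * j)) := by
    rw [hR, Finset.mul_sum]
    refine Finset.sum_congr rfl fun j _ => ?_
    rw [pow_add]; ring
  have hder : ∀ x ∈ T, ∀ i < ℓ, (derivative^[i] (f ^ ℓ * R)).eval x = 0 := by
    intro x hx i hi
    have h1 : (derivative^[i] (f ^ ℓ * R)).eval x = ∑ j ∈ Finset.range J,
        ((f.eval x) ^ (ℓ - i) * (iterTwistDeriv f ℓ i (r j)).eval x * x ^ j +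
          (f.eval x) ^ (ℓ - i) * (f.eval x) ^ (p / 2) *
            (iterTwistDeriv f (ℓ + p / 2) i (s j)).eval x * x ^ j) := by
      rw [hexp, iterate_derivative_sum, eval_finsetSum]
      refine Finset.sum_congr rfl fun j _ => ?_
      rw [iterate_map_add, iterate_derivative_pow_mul_X_pow p _ _ _ _ _ hi.le,
        iterate_derivative_pow_mul_X_pow p _ _ _ _ _ (by omega)]
      have : ℓ + p / 2 - i = (ℓ - i) + p / 2 := by omega
      simp only [eval_add, eval_mul, eval_pow, eval_X, this, pow_add, pow_mul, ZMod.pow_card]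
    rw [h1]
    -- At zeros of `f` the factor `f ^ (ℓ - i)` already vanishes, so no linear condition is spent on
    -- them.
    rcases hT x hx with h0 | ha
    · refine Finset.sum_eq_zero fun j _ => ?_
      rw [h0, zero_pow (by omega)]; ring
    · have hc := congrArg (eval x) (hcond ⟨i, hi⟩)
      simp only [hcv, eval_finsetSum, eval_mul, eval_pow, eval_X, eval_add, eval_smul, eval_zero,
        smul_eq_mul] at hc
      rw [ha, ← Fin.sum_univ_eq_sum_range (fun j => (f.eval x) ^ (ℓ - i) *
        (iterTwistDeriv f ℓ i (r j)).eval x * x ^ j + (f.eval x) ^ (ℓ - i) * a *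
            (iterTwistDeriv f (ℓ + p / 2) i (s j)).eval x * x ^ j)]
      rw [← mul_zero ((f.eval x) ^ (ℓ - i)), ← hc, Finset.mul_sum]
      refine Finset.sum_congr rfl fun j _ => ?_
      simp only [r, s, j.2, dif_pos]
      ring
  refine (card_mul_le_natDegree_of_derivatives hne hℓ T hder).trans ?_
  rw [hexp]
  refine natDegree_sum_le_of_forall_le _ _ fun j hj => ?_
  have hj' := Finset.mem_range.mp hj
  have hpj : p * j ≤ p * J := Nat.mul_le_mul_left _ hj'.le
  have h1 := hrdeg j
  have h2 := hsdeg j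
  have h3 : (f ^ ℓ).natDegree = 3 * ℓ := by rw [natDegree_pow, hf]; ring
  have h4 : (f ^ (ℓ + p / 2)).natDegree = 3 * ℓ + 3 * (p / 2) := by
    rw [natDegree_pow, hf]; ring
  have hX : (X ^ (p * j) : (ZMod p)[X]).natDegree = p * j := natDegree_X_pow _
  have h5 := natDegree_mul_le (p := f ^ ℓ * r j) (q := X ^ (p * j))
  have h6 := natDegree_mul_le (p := f ^ ℓ) (q := r j)
  have h7 := natDegree_mul_le (p := f ^ (ℓ + p / 2) * s j) (q := X ^ (p * j))
  have h8 := natDegree_mul_le (p := f ^ (ℓ + p / 2)) (q := s j)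
  refine (natDegree_add_le _ _).trans ?_
  omega

/-- Parameters `ℓ = 2L`, `J = L + 1`, `M = (p - 3) / 2` with `L` about `√p / 4`; this `M` is the
largest allowed by the independence lemma. The dimension condition reduces to `10 L² + 2L < p - 3`,
which follows from `16 L² ≤ p`. Dividing the resulting bound by `L` and using `√p ≤ 8L` gives `24√p`
from `3p / L`, and the remaining `6` is absorbed to make `30√p`. -/
lemma two_mul_card_le_of_quadratic (p : ℕ) [Fact p.Prime] (hp : 16 ≤ p) {f : (ZMod p)[X]}
    (hf : f.natDegree = 3) (hf0 : f.eval 0 ≠ 0) (a : ZMod p) (T : Finset (ZMod p))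
    (hT : ∀ x ∈ T, f.eval x = 0 ∨ (f.eval x) ^ (p / 2) = a) :
    2 * (T.card : ℝ) ≤ p + 30 * √(p : ℝ) := by
  set L := Nat.sqrt p / 4 with hL
  have hsq : Nat.sqrt p * Nat.sqrt p ≤ p := Nat.sqrt_le p
  have hsq' : p < (Nat.sqrt p + 1) * (Nat.sqrt p + 1) := Nat.lt_succ_sqrt p
  have h4 : 4 ≤ Nat.sqrt p := Nat.le_sqrt.mpr (by omega)
  have hL1 : 1 ≤ L := by omega
  have hLs : 4 * L ≤ Nat.sqrt p := by omega
  have hL16 : 16 * (L * L) ≤ p := by nlinarith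
  have hodd : p % 2 = 1 := by
    have := (Fact.out : p.Prime).eq_two_or_odd
    omega
  have hLL : L ≤ L * L := Nat.le_mul_self L
  have key := stepanov_card_mul_le p hf hf0 a ((p - 3) / 2) (2 * L) (L + 1) (by omega) (by omega)
    (by omega) (by
      have : 2 * ((p - 3) / 2) = p - 3 := by omega
      have h1 : (L + 1) * ((p - 3) / 2 + (p - 3) / 2) = L * (2 * ((p - 3) / 2)) + (p - 3) := by
        rw [← two_mul, this]; ring
      have h2 : 2 * L * ((p - 3) / 2 + 2 * (2 * L) + (L + 1)) =
          L * (2 * ((p - 3) / 2)) + (10 * (L * L) + 2 * L) := by ring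
      rw [h1, h2]
      have : 10 * (L * L) + 2 * L < p - 3 := by omega
      omega) T hT
  have key2 : T.card * (2 * L) ≤ 6 * L + 3 * p + p * L := by
    have : p * (L + 1) = p * L + p := by ring
    omega
  have hs8 : √(p : ℝ) ≤ 8 * L := by
    rw [Real.sqrt_le_left (by positivity)]
    have : p ≤ (8 * L) ^ 2 := by
      have : Nat.sqrt p + 1 ≤ 8 * L := by omega
      nlinarith
    exact_mod_cast this
  have hspos : 1 ≤ √(p : ℝ) := by
    rw [Real.one_le_sqrt]; exact_mod_cast (by omega : 1 ≤ p)
  have hss : √(p : ℝ) * √(p : ℝ) = p := Real.mul_self_sqrt (by positivity)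
  have hLpos : (0 : ℝ) < L := by exact_mod_cast hL1
  have key3 : (T.card : ℝ) * (2 * L) ≤ 6 * L + 3 * p + p * L := by exact_mod_cast key2
  have h3p : 3 * (p : ℝ) ≤ 24 * √(p : ℝ) * L := by nlinarith
  have : (2 * (T.card : ℝ)) * L ≤ (p + 30 * √(p : ℝ)) * L := by nlinarith
  exact le_of_mul_le_mul_right this hLpos

/-- The set for each sign contains the zeros of `f`, so for `ε = ±1` one has pointwise `ε * χ(f(x))
≤ 2 * 1_T - 1`. Summing bounds the character sum from both sides by `2 |T| - p`. -/
lemma abs_sum_quadraticChar_le_of_eval_zero_ne (p : ℕ) [Fact p.Prime] (hp : 16 ≤ p)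
    {f : (ZMod p)[X]} (hf : f.natDegree = 3) (hf0 : f.eval 0 ≠ 0) :
    |((∑ x : ZMod p, quadraticChar (ZMod p) (f.eval x) : ℤ) : ℝ)| ≤ 30 * √(p : ℝ) := by
  classical
  have h2 : ringChar (ZMod p) ≠ 2 := by rw [ZMod.ringChar_zmod_n]; omega
  have h11 : (1 : ZMod p) ≠ -1 := by
    have : Fact (2 < p) := ⟨by omega⟩
    exact (ZMod.neg_one_ne_one).symm
  have hchar : ∀ x : ZMod p, ((quadraticChar (ZMod p) x : ℤ) : ZMod p) = x ^ (p / 2) := fun x => by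
    have := quadraticChar_eq_pow_of_char_ne_two' h2 x
    rwa [ZMod.card] at this
  let T : ZMod p → Finset (ZMod p) := fun a =>
    Finset.univ.filter fun x => f.eval x = 0 ∨ (f.eval x) ^ (p / 2) = a
  have hb : ∀ a, 2 * ((T a).card : ℝ) ≤ p + 30 * √(p : ℝ) := fun a =>
    two_mul_card_le_of_quadratic p hp hf hf0 a (T a) (by simp [T])
  have hpt : ∀ (ε : ℤ) (_ : ε = 1 ∨ ε = -1) (x : ZMod p), ε * quadraticChar (ZMod p) (f.eval x) ≤
      2 * (if x ∈ T (ε : ZMod p) then 1 else 0) - 1 := by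
    intro ε hε x
    by_cases h0 : f.eval x = 0
    · simp [T, h0]
    · have h1 := hchar (f.eval x)
      rcases quadraticChar_dichotomy h0 with h | h <;> rw [h] at h1 ⊢ <;>
        rcases hε with rfl | rfl <;> simp [T, h0, ← h1, h11, h11.symm]
  have hsum : ∀ (ε : ℤ) (_ : ε = 1 ∨ ε = -1),
      ((ε * ∑ x : ZMod p, quadraticChar (ZMod p) (f.eval x) : ℤ) : ℝ) ≤ 30 * √(p : ℝ) := by
    intro ε hε
    have h := Finset.sum_le_sum fun x (_ : x ∈ Finset.univ) => hpt ε hε x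
    rw [← Finset.mul_sum, Finset.sum_sub_distrib, ← Finset.mul_sum, Finset.sum_ite_mem] at h
    simp only [Finset.univ_inter, Finset.sum_const, Finset.card_univ, ZMod.card, nsmul_eq_mul,
      mul_one] at h
    have h' : ((ε * ∑ x : ZMod p, quadraticChar (ZMod p) (f.eval x) : ℤ) : ℝ) ≤
        2 * ((T (ε : ZMod p)).card : ℝ) - p := by exact_mod_cast h
    linarith [hb (ε : ZMod p)]
  rw [abs_le]
  have h1 := hsum 1 (Or.inl rfl)
  have h2 := hsum (-1) (Or.inr rfl)
  push_cast at h1 h2 ⊢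
  constructor <;> linarith

lemma abs_sum_quadraticChar_le_card (p : ℕ) [Fact p.Prime] (F : ZMod p → ZMod p) :
    |((∑ x : ZMod p, quadraticChar (ZMod p) (F x) : ℤ) : ℝ)| ≤ p := by
  have h1 : |∑ x : ZMod p, quadraticChar (ZMod p) (F x)| ≤ p := by
    refine (Finset.abs_sum_le_sum_abs _ _).trans ?_
    calc ∑ x : ZMod p, |quadraticChar (ZMod p) (F x)| ≤ ∑ x : ZMod p, 1 := by
          refine Finset.sum_le_sum fun x _ => ?_
          rcases quadraticChar_isQuadratic (ZMod p) (F x) with h | h | h <;> simp [h]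
      _ = p := by simp
  exact_mod_cast h1

/-- For `p < 16` the trivial bound suffices. Otherwise a cubic has a non-root `c`, and translating
by `c` gives `f(0) ≠ 0` without changing the complete sum. -/
lemma abs_sum_quadraticChar_le (p : ℕ) [Fact p.Prime] {f : (ZMod p)[X]}
    (hf : f.natDegree = 3) :
    |((∑ x : ZMod p, quadraticChar (ZMod p) (f.eval x) : ℤ) : ℝ)| ≤ 30 * √(p : ℝ) := by
  classical
  have hss : √(p : ℝ) * √(p : ℝ) = p := Real.mul_self_sqrt (by positivity)
  rcases lt_or_ge p 16 with hp | hp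
  · have h2 := abs_sum_quadraticChar_le_card p fun x => f.eval x
    have h3 : √(p : ℝ) ≤ 4 := by
      rw [Real.sqrt_le_left (by norm_num)]
      norm_num
      exact_mod_cast hp.le
    nlinarith [Real.sqrt_nonneg (p : ℝ)]
  · have hf' : f ≠ 0 := by rintro rfl; simp at hf
    obtain ⟨c, hc⟩ : ∃ c : ZMod p, f.eval c ≠ 0 := by
      by_contra! h
      have h1 := card_roots' f
      have h2 : (Finset.univ : Finset (ZMod p)).card ≤ f.roots.toFinset.card :=
        Finset.card_le_card fun x _ => by simp [hf', h x]
      have h3 := Multiset.toFinset_card_le f.roots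
      rw [Finset.card_univ, ZMod.card] at h2
      omega
    have key := abs_sum_quadraticChar_le_of_eval_zero_ne p hp (f := f.comp (X + C c))
      (by rw [natDegree_comp, hf, natDegree_X_add_C]) (by simpa using hc)
    simp only [eval_comp, eval_add, eval_X, eval_C] at key
    have e := Equiv.sum_comp (Equiv.addRight c) fun x => quadraticChar (ZMod p) (f.eval x)
    simp only [Equiv.coe_addRight] at e
    rwa [e] at key

end Stepanov

/-! ### The traces `a_t(p)` as character sums -/

lemma natCard_sq_eq (p : ℕ) [Fact p.Prime] (hp : p ≠ 2) (F : ZMod p → ZMod p) :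
    (Nat.card {P : ZMod p × ZMod p // P.2 ^ 2 = F P.1} : ℤ) =
      p + ∑ x, quadraticChar (ZMod p) (F x) := by
  classical
  have h2 : ringChar (ZMod p) ≠ 2 := by rwa [ZMod.ringChar_zmod_n]
  let e : {P : ZMod p × ZMod p // P.2 ^ 2 = F P.1} ≃ Σ x : ZMod p, {y : ZMod p // y ^ 2 = F x} :=
    ⟨fun P => ⟨P.1.1, P.1.2, P.2⟩, fun q => ⟨(q.1, q.2.1), q.2.2⟩, fun _ => rfl, fun _ => rfl⟩
  rw [Nat.card_congr e, Nat.card_sigma]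
  push_cast
  have : ∀ x, (Nat.card {y : ZMod p // y ^ 2 = F x} : ℤ) = quadraticChar (ZMod p) (F x) + 1 := by
    intro x
    rw [← quadraticChar_card_sqrts h2 (F x), Set.toFinset_card, Nat.card_eq_fintype_card]
    rfl
  rw [Finset.sum_congr rfl fun x _ => this x, Finset.sum_add_distrib]
  simp [add_comm]

lemma aMod_eq_neg_sum (A B : ℤ[X]) (p : ℕ) [Fact p.Prime] (hp : p ≠ 2) (t : ZMod p) :
    aMod A B p t =
      -∑ x : ZMod p, quadraticChar (ZMod p) (x ^ 3 + aeval t A * x + aeval t B) := by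
  rw [aMod, natCard_sq_eq p hp fun x => x ^ 3 + aeval t A * x + aeval t B]
  ring

/-- This plays the role of Hasse's bound; only the order of magnitude matters later. It also covers
singular equations, since the method uses only that the degree is odd. -/
lemma abs_aMod_le_sqrt (A B : ℤ[X]) (p : ℕ) [Fact p.Prime] (hp : p ≠ 2) (t : ZMod p) :
    |(aMod A B p t : ℝ)| ≤ 30 * √(p : ℝ) := by
  have h := abs_sum_quadraticChar_le p (f := X ^ 3 + C (aeval t A) * X + C (aeval t B)) (by
    compute_degree!)
  rw [aMod_eq_neg_sum A B p hp, Int.cast_neg, abs_neg]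
  simpa using h

/-- For small `p` the bound `30√p` does not even give `a_t(p) < p + 1`; this trivial bound keeps `p
+ 1 - a_t(p)` positive and the normalized roots inside the unit disc. -/
lemma abs_aMod_le (A B : ℤ[X]) (p : ℕ) [Fact p.Prime] (hp : p ≠ 2) (t : ZMod p) :
    |(aMod A B p t : ℝ)| ≤ p := by
  rw [aMod_eq_neg_sum A B p hp, Int.cast_neg, abs_neg]
  exact abs_sum_quadraticChar_le_card p fun x => x ^ 3 + aeval t A * x + aeval t B

/-- Squaring is bijective on `ZMod 2`, so each `x` carries exactly one `y`. -/
lemma aMod_two (A B : ℤ[X]) (t : ZMod 2) : aMod A B 2 t = 0 := by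
  have h : ∀ a b : ZMod 2,
      Fintype.card {P : ZMod 2 × ZMod 2 // P.2 ^ 2 = P.1 ^ 3 + a * P.1 + b} = 2 := by decide
  rw [aMod, Nat.card_eq_fintype_card, h]
  norm_num

/-- Cubing is bijective on `ZMod 3`, so without a linear term each `y` carries exactly one `x`. -/
lemma aMod_three (A B : ℤ[X]) (t : ZMod 3) (hA : aeval t A = 0) : aMod A B 3 t = 0 := by
  have h : ∀ b : ZMod 3,
      Fintype.card {P : ZMod 3 × ZMod 3 // P.2 ^ 2 = P.1 ^ 3 + 0 * P.1 + b} = 3 := by decide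
  rw [aMod, hA, Nat.card_eq_fintype_card, h]
  norm_num

/-! ### Valuations and minimal models over `ℚ_p` -/

section Local

variable {p : ℕ} [Fact p.Prime]

open IsDiscreteValuationRing IsDedekindDomain.HeightOneSpectrum WeierstrassCurve

/-- The valuation of `ℚ_p` attached to the maximal ideal of `ℤ_p`. -/
abbrev padicVal (p : ℕ) [Fact p.Prime] :=
  valuation ℚ_[p] (maximalIdeal ℤ_[p])

/-- Both conditions say that `x` lies in `ℤ_[p]`. The adic valuation in the definitions of reduction
types is thereby traded for the `p`-adic norm. -/
lemma padicVal_le_one_iff (x : ℚ_[p]) : padicVal p x ≤ 1 ↔ ‖x‖ ≤ 1 := by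
  constructor
  · intro h
    obtain ⟨r, rfl⟩ := exists_lift_of_le_one h
    exact PadicInt.norm_le_one r
  · intro h
    exact valuation_le_one (K := ℚ_[p]) (maximalIdeal ℤ_[p]) (⟨x, h⟩ : ℤ_[p])

lemma padicVal_le_iff (x y : ℚ_[p]) : padicVal p x ≤ padicVal p y ↔ ‖x‖ ≤ ‖y‖ := by
  by_cases hy : y = 0
  · subst hy; simp
  · have h := padicVal_le_one_iff (x / y)
    rw [map_div₀, norm_div, div_le_one (norm_pos_iff.mpr hy)] at h
    rw [← h, div_le_one₀]
    exact (Valuation.pos_iff _).mpr hy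

lemma padicVal_lt_iff (x y : ℚ_[p]) : padicVal p x < padicVal p y ↔ ‖x‖ < ‖y‖ := by
  rw [← not_le, ← not_le, padicVal_le_iff]

lemma padicVal_lt_one_iff (x : ℚ_[p]) : padicVal p x < 1 ↔ ‖x‖ < 1 := by
  simpa using padicVal_lt_iff x 1

lemma padicVal_eq_one_iff (x : ℚ_[p]) : padicVal p x = 1 ↔ ‖x‖ = 1 := by
  have h1 := padicVal_le_one_iff x
  have h2 := padicVal_lt_one_iff x
  constructor
  · intro h
    exact le_antisymm (h1.mp h.le) (not_lt.mp fun hlt => (h2.mpr hlt).ne h)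
  · intro h
    exact le_antisymm (h1.mpr h.le) (not_lt.mp fun hlt => (h2.mp hlt).ne h)

/-- The change of variables that leads to the chosen minimal model. -/
def toMinimal (W : WeierstrassCurve ℚ_[p]) : VariableChange ℚ_[p] :=
  (W.exists_isMinimal ℤ_[p]).choose

lemma toMinimal_smul (W : WeierstrassCurve ℚ_[p]) : W.minimal ℤ_[p] = toMinimal W • W := rfl

/-- Minimality is stated as maximality in an order on changes of variables; since valuations are
totally ordered, it yields an actual comparison with every integral model. -/
lemma norm_Δ_smul_le_of_isMinimal {W : WeierstrassCurve ℚ_[p]} [IsMinimal ℤ_[p] W]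
    (C : VariableChange ℚ_[p]) (h : IsIntegral ℤ_[p] (C • W)) : ‖(C • W).Δ‖ ≤ ‖W.Δ‖ := by
  have hmax := (IsMinimal.val_Δ_maximal (R := ℤ_[p]) (W := W)).2 h
  have hint : IsIntegral ℤ_[p] ((1 : VariableChange ℚ_[p]) • W) := by
    rw [one_smul]; infer_instance
  rw [← padicVal_le_iff]
  rcases le_total (valuation_Δ_aux ℤ_[p] ((1 : VariableChange ℚ_[p]) • W))
    (valuation_Δ_aux ℤ_[p] (C • W)) with h' | h'
  · have := hmax h'
    rw [← Subtype.coe_le_coe, valuation_Δ_aux_eq_of_isIntegral,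
      valuation_Δ_aux_eq_of_isIntegral, one_smul] at this
    exact this
  · rw [← Subtype.coe_le_coe, valuation_Δ_aux_eq_of_isIntegral,
      valuation_Δ_aux_eq_of_isIntegral, one_smul] at h'
    exact h'

lemma norm_Δ_le_norm_Δ_minimal (W : WeierstrassCurve ℚ_[p]) [h : IsIntegral ℤ_[p] W] :
    ‖W.Δ‖ ≤ ‖(W.minimal ℤ_[p]).Δ‖ := by
  have h' : (toMinimal W)⁻¹ • W.minimal ℤ_[p] = W := by
    rw [toMinimal_smul, inv_smul_smul]
  have := norm_Δ_smul_le_of_isMinimal (W := W.minimal ℤ_[p]) (toMinimal W)⁻¹ (by rwa [h'])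
  rwa [h'] at this

lemma norm_Δ_minimal_of_isMinimal (W : WeierstrassCurve ℚ_[p]) [IsMinimal ℤ_[p] W] :
    ‖(W.minimal ℤ_[p]).Δ‖ = ‖W.Δ‖ :=
  le_antisymm (norm_Δ_smul_le_of_isMinimal (toMinimal W)
    (by rw [← toMinimal_smul]; infer_instance)) (norm_Δ_le_norm_Δ_minimal W)

lemma norm_Δ_le_one (W : WeierstrassCurve ℚ_[p]) [IsIntegral ℤ_[p] W] : ‖W.Δ‖ ≤ 1 := by
  obtain ⟨r, hr⟩ := Δ_integral_of_isIntegral ℤ_[p] W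
  rw [← hr]
  exact PadicInt.norm_le_one r

/-- Two minimal models have discriminants of equal norm, and these differ by the factor `u ^ (-12)`.
-/
lemma norm_u_eq_one_of_isMinimal (W : WeierstrassCurve ℚ_[p]) [IsMinimal ℤ_[p] W] (h0 : W.Δ ≠ 0) :
    ‖((toMinimal W).u : ℚ_[p])‖ = 1 := by
  have h := norm_Δ_minimal_of_isMinimal W
  rw [toMinimal_smul, variableChange_Δ, norm_mul, norm_pow, Units.val_inv_eq_inv_val,
    norm_inv] at h
  have h1 : (‖((toMinimal W).u : ℚ_[p])‖⁻¹) ^ 12 = 1 :=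
    mul_right_cancel₀ (norm_ne_zero_iff.mpr h0) (by rw [h, one_mul])
  have h2 := (pow_eq_one_iff_of_nonneg (by positivity) (by norm_num)).mp h1
  exact inv_eq_one.mp h2

/-! ### The reduction of an integral Weierstrass equation -/

variable (E : WeierstrassCurve ℤ)

/-- The integral Weierstrass equation `E` over `ℤ_p`. -/
def atPrimeInt (E : WeierstrassCurve ℤ) (p : ℕ) [Fact p.Prime] : WeierstrassCurve ℤ_[p] :=
  E.map (Int.castRingHom ℤ_[p])

lemma atPrimeInt_baseChange : (atPrimeInt E p).baseChange ℚ_[p] = atPrime E p := by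
  rw [WeierstrassCurve.baseChange, atPrimeInt, WeierstrassCurve.map_map, atPrime]
  congr 1

instance : IsIntegral ℤ_[p] (atPrime E p) := ⟨atPrimeInt E p, (atPrimeInt_baseChange E).symm⟩

lemma atPrime_Δ : (atPrime E p).Δ = (E.Δ : ℚ_[p]) := by simp [atPrime]

lemma goodAt_iff : GoodAt E p ↔ ‖(minimalModel E p).Δ‖ = 1 := by
  rw [GoodAt, hasGoodReduction_iff, padicVal_eq_one_iff]
  have : IsMinimal ℤ_[p] (minimalModel E p) := by unfold minimalModel; infer_instance
  simp [this]

lemma norm_Δ_minimalModel_le_one : ‖(minimalModel E p).Δ‖ ≤ 1 := by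
  unfold minimalModel
  exact norm_Δ_le_one _

lemma goodAt_of_not_dvd (h : ¬ (p : ℤ) ∣ E.Δ) : GoodAt E p := by
  rw [goodAt_iff]
  refine le_antisymm (norm_Δ_minimalModel_le_one E) ?_
  have h1 : ‖(atPrime E p).Δ‖ = 1 := by
    rw [atPrime_Δ]
    exact le_antisymm (Padic.norm_int_le_one _)
      (not_lt.mp fun hlt => h (Padic.norm_intCast_lt_one_iff.mp hlt))
  rw [← h1]
  exact norm_Δ_le_norm_Δ_minimal (atPrime E p)

lemma goodAt_iff_not_dvd_of_minimalAt (hmin : MinimalAt E p) : GoodAt E p ↔ ¬ (p : ℤ) ∣ E.Δ := by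
  refine ⟨fun h hdvd => ?_, goodAt_of_not_dvd E⟩
  have : IsMinimal ℤ_[p] (atPrime E p) := hmin
  rw [goodAt_iff, minimalModel, norm_Δ_minimal_of_isMinimal, atPrime_Δ] at h
  exact (Padic.norm_intCast_lt_one_iff.mpr hdvd).ne h

lemma conductorExponent_eq_zero_iff : conductorExponent E p = 0 ↔ GoodAt E p := by
  unfold conductorExponent
  split_ifs with h1 h2 <;> simp [h1]

lemma minDiscValuation_le (h0 : E.Δ ≠ 0) : minDiscValuation E p ≤ padicValInt p E.Δ := by
  have h1 := norm_Δ_le_norm_Δ_minimal (atPrime E p)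
  have hp : (1 : ℝ) < p := by exact_mod_cast (Fact.out : p.Prime).one_lt
  have h2 : (atPrime E p).Δ ≠ 0 := by rw [atPrime_Δ]; exact_mod_cast h0
  have h3 : ((atPrime E p).minimal ℤ_[p]).Δ ≠ 0 := by
    intro h; rw [h, norm_zero] at h1
    exact h2 (norm_le_zero_iff.mp h1)
  rw [Padic.norm_eq_zpow_neg_valuation h2, Padic.norm_eq_zpow_neg_valuation h3,
    zpow_le_zpow_iff_right₀ hp, neg_le_neg_iff, atPrime_Δ, Padic.valuation_intCast] at h1
  exact h1

/-- At a bad prime the exponent is at most `2 + v(Δ_min)`, because the number of components is only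
subtracted, and `v(Δ) ≥ 1`. The crude factor `3` spares any analysis of the wild part. -/
lemma conductorExponent_le (h0 : E.Δ ≠ 0) : conductorExponent E p ≤ 3 * padicValInt p E.Δ := by
  by_cases hg : GoodAt E p
  · rw [(conductorExponent_eq_zero_iff E).mpr hg]; exact Nat.zero_le _
  · have hd : (p : ℤ) ∣ E.Δ := by
      by_contra h
      exact hg (goodAt_of_not_dvd E h)
    have h1 : 1 ≤ padicValInt p E.Δ := by
      rw [Nat.one_le_iff_ne_zero, padicValInt, ← Nat.pos_iff_ne_zero]
      refine Nat.pos_of_ne_zero fun h => ?_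
      rw [padicValNat.eq_zero_iff] at h
      rcases h with h | h | h
      · exact (Fact.out : p.Prime).ne_one h
      · exact h0 (Int.natAbs_eq_zero.mp h)
      · exact h (Int.natCast_dvd.mp hd)
    have h2 := minDiscValuation_le (p := p) E h0
    unfold conductorExponent
    split_ifs <;> omega

/-- The factor at `p` of the conductor. -/
def conductorFactor (E : WeierstrassCurve ℤ) (p : Nat.Primes) : ℕ :=
  (p : ℕ) ^ (haveI : Fact (p : ℕ).Prime := ⟨p.2⟩; conductorExponent E p)

lemma mulSupport_conductorFactor_subset :
    Function.mulSupport (conductorFactor E) ⊆ {p : Nat.Primes | (p : ℤ) ∣ E.Δ} := by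
  intro p hp
  by_contra h
  refine hp ?_
  have : Fact (p : ℕ).Prime := ⟨p.2⟩
  rw [conductorFactor, (conductorExponent_eq_zero_iff E).mpr (goodAt_of_not_dvd E h), pow_zero]

lemma finite_primes_dvd {n : ℤ} (h0 : n ≠ 0) : {p : Nat.Primes | (p : ℤ) ∣ n}.Finite := by
  refine Set.Finite.of_injOn (f := fun p : Nat.Primes => (p : ℕ))
    (t := (n.natAbs.primeFactors : Set ℕ)) ?_ Subtype.coe_injective.injOn (Finset.finite_toSet _)
  intro p hp
  simp only [Finset.mem_coe, Nat.mem_primeFactors]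
  exact ⟨p.2, Int.natCast_dvd.mp hp, by simpa using h0⟩

lemma conductor_eq_prod (h0 : E.Δ ≠ 0) :
    conductor E = ∏ p ∈ (finite_primes_dvd h0).toFinset, conductorFactor E p :=
  finprod_eq_prod_of_mulSupport_subset (conductorFactor E)
    (by simpa using mulSupport_conductorFactor_subset E)

lemma conductor_ne_zero (h0 : E.Δ ≠ 0) : conductor E ≠ 0 := by
  rw [conductor_eq_prod E h0, Finset.prod_ne_zero_iff]
  exact fun p _ => pow_ne_zero _ p.2.ne_zero

lemma dvd_conductor_iff (h0 : E.Δ ≠ 0) : p ∣ conductor E ↔ ¬ GoodAt E p := by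
  have hp := (Fact.out : p.Prime)
  rw [conductor_eq_prod E h0, hp.prime.dvd_finsetProd_iff]
  constructor
  · rintro ⟨q, -, hq⟩ hg
    have hpq := (Nat.prime_dvd_prime_iff_eq hp q.2).mp (hp.dvd_of_dvd_pow hq)
    obtain ⟨q, hq'⟩ := q
    subst hpq
    simp only [conductorFactor, (conductorExponent_eq_zero_iff E).mpr hg, pow_zero] at hq
    exact hp.one_lt.ne' (Nat.dvd_one.mp hq)
  · intro hg
    refine ⟨⟨p, hp⟩, ?_, dvd_pow_self _ fun h => hg ((conductorExponent_eq_zero_iff E).mp h)⟩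
    refine (Set.Finite.mem_toFinset _).mpr ?_
    by_contra h
    exact hg (goodAt_of_not_dvd E h)

/-- A polynomial bound in `t` is all that is needed, in order that `log R = O(log N)`. -/
lemma conductor_le (h0 : E.Δ ≠ 0) : conductor E ≤ E.Δ.natAbs ^ 3 := by
  have hn : E.Δ.natAbs ≠ 0 := by simpa using h0
  rw [conductor_eq_prod E h0]
  calc ∏ p ∈ (finite_primes_dvd h0).toFinset, conductorFactor E p
      ≤ ∏ p ∈ (finite_primes_dvd h0).toFinset, ((p : ℕ) ^ padicValNat p E.Δ.natAbs) ^ 3 := by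
        refine Finset.prod_le_prod' fun p _ => ?_
        have : Fact (p : ℕ).Prime := ⟨p.2⟩
        rw [← pow_mul, mul_comm]
        exact Nat.pow_le_pow_right p.2.pos (conductorExponent_le E h0)
    _ = (∏ p ∈ (finite_primes_dvd h0).toFinset, (p : ℕ) ^ padicValNat p E.Δ.natAbs) ^ 3 :=
        Finset.prod_pow _ _ _
    _ ≤ E.Δ.natAbs ^ 3 := by
        refine Nat.pow_le_pow_left (Nat.le_of_dvd (Nat.pos_of_ne_zero hn) ?_) 3
        refine Finset.prod_dvd_of_isRelPrime ?_ fun p _ => pow_padicValNat_dvd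
        intro p _ q _ hpq
        rw [Function.onFun, ← Nat.coprime_iff_isRelPrime]
        exact Nat.Coprime.pow _ _ ((Nat.coprime_primes p.2 q.2).mpr fun h => hpq (Subtype.ext h))

end Local

/-! ### Counting points on Weierstrass equations -/

section PointCount

open WeierstrassCurve

variable {F : Type*} [Field F]

lemma natCard_point_eq [Finite F] (W : WeierstrassCurve F) (hΔ : W.Δ ≠ 0) :
    Nat.card W.toAffine.Point =
      Nat.card {P : F × F // W.toAffine.Equation P.1 P.2} + 1 := by
  rw [Nat.card_congr (Affine.nonsingularPointEquiv W.toAffine)]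
  change Nat.card (Option _) = _
  rw [Finite.card_option]
  congr 1
  exact Nat.card_congr (Equiv.subtypeEquivRight fun P =>
    (Affine.equation_iff_nonsingular_of_Δ_ne_zero hΔ).symm)

/-- The substitution on the plane that belongs to a change of variables. -/
def planeEquiv (C : VariableChange F) : F × F ≃ F × F where
  toFun P := (C.u ^ 2 * P.1 + C.r, C.u ^ 3 * P.2 + C.u ^ 2 * C.s * P.1 + C.t)
  invFun P := (C.u⁻¹ ^ 2 * (P.1 - C.r), C.u⁻¹ ^ 3 * (P.2 - C.s * (P.1 - C.r) - C.t))
  left_inv P := by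
    have := C.u.ne_zero
    ext <;> simp only [Units.val_inv_eq_inv_val] <;> field_simp <;> ring
  right_inv P := by
    have := C.u.ne_zero
    ext <;> simp only [Units.val_inv_eq_inv_val] <;> field_simp <;> ring

lemma natCard_equation_smul (C : VariableChange F) (W : WeierstrassCurve F) :
    Nat.card {P : F × F // (C • W).toAffine.Equation P.1 P.2} =
      Nat.card {P : F × F // W.toAffine.Equation P.1 P.2} := by
  refine Nat.card_congr ((planeEquiv C).subtypeEquiv fun P => ?_)
  have hu := C.u.ne_zero
  rw [Affine.equation_iff', Affine.equation_iff']
  simp only [planeEquiv, Equiv.coe_fn_mk, variableChange_def, Units.val_inv_eq_inv_val]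
  rw [← mul_right_inj' (pow_ne_zero 6 hu), mul_zero]
  refine Eq.congr ?_ rfl
  field_simp
  ring

lemma natCard_equation_map {F' : Type*} [Field F'] (e : F ≃+* F') (W : WeierstrassCurve F) :
    Nat.card {P : F' × F' // (W.map (e : F →+* F')).toAffine.Equation P.1 P.2} =
      Nat.card {P : F × F // W.toAffine.Equation P.1 P.2} := by
  refine (Nat.card_congr ((e.toEquiv.prodCongr e.toEquiv).subtypeEquiv fun P => ?_)).symm
  exact (Affine.map_equation W.toAffine (f := (e : F →+* F')) e.injective P.1 P.2).symm

end PointCount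

/-! ### Integral changes of variables between minimal models -/

section Local

open WeierstrassCurve

variable {p : ℕ} [Fact p.Prime]

lemma norm_natCast_eq_one_of_lt {n : ℕ} (h0 : 0 < n) (hn : n < p) : ‖(n : ℚ_[p])‖ = 1 :=
  Padic.norm_natCast_eq_one_iff.mpr
    ((Nat.Prime.coprime_iff_not_dvd Fact.out).mpr fun h => (Nat.le_of_dvd h0 h).not_gt hn)

/-- The chosen minimal model need not be the given equation. As `u` is a unit and `2`, `3` are
invertible, the integrality of `a₁ = 2s/u`, of `a₂` and of `a₃` for the new model forces `s`, then
`r`, then `t` to be integral. The change of variables can therefore be reduced modulo `p`. -/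
lemma exists_integral_variableChange (hp : 5 ≤ p) (A B : ℤ[X]) (t : ℤ)
    (hmin : MinimalAt (curve A B t) p) (h0 : (curve A B t).Δ ≠ 0) :
    ∃ C : VariableChange ℤ_[p],
      integralModel ℤ_[p] ((atPrime (curve A B t) p).minimal ℤ_[p]) =
        C • atPrimeInt (curve A B t) p := by
  set W := atPrime (curve A B t) p with hW
  have : IsMinimal ℤ_[p] W := hmin
  have hu : ‖((toMinimal W).u : ℚ_[p])‖ = 1 := norm_u_eq_one_of_isMinimal W (by
    rw [hW, atPrime_Δ]; exact_mod_cast h0)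
  have hu' : ‖(((toMinimal W).u⁻¹ : ℚ_[p]ˣ) : ℚ_[p])‖ = 1 := by
    rw [Units.val_inv_eq_inv_val, norm_inv, hu, inv_one]
  set I := integralModel ℤ_[p] (W.minimal ℤ_[p]) with hI
  have e1 := (integralModel_a₁_eq ℤ_[p] (W.minimal ℤ_[p])).trans
    (variableChange_a₁ W (toMinimal W))
  have e2 := (integralModel_a₂_eq ℤ_[p] (W.minimal ℤ_[p])).trans
    (variableChange_a₂ W (toMinimal W))
  have e3 := (integralModel_a₃_eq ℤ_[p] (W.minimal ℤ_[p])).trans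
    (variableChange_a₃ W (toMinimal W))
  have w1 : W.a₁ = 0 := by simp [hW, atPrime, curve]
  have w2 : W.a₂ = 0 := by simp [hW, atPrime, curve]
  have w3 : W.a₃ = 0 := by simp [hW, atPrime, curve]
  have n2 : ‖(2 : ℚ_[p])‖ = 1 := by
    exact_mod_cast norm_natCast_eq_one_of_lt (p := p) (n := 2) (by norm_num) (by omega)
  have n3 : ‖(3 : ℚ_[p])‖ = 1 := by
    exact_mod_cast norm_natCast_eq_one_of_lt (p := p) (n := 3) (by norm_num) (by omega)
  have hs : ‖(toMinimal W).s‖ ≤ 1 := by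
    have := congrArg norm e1
    rw [w1, zero_add, norm_mul, norm_mul, hu', n2, one_mul, one_mul] at this
    rw [← this]; exact PadicInt.norm_le_one _
  have hr : ‖(toMinimal W).r‖ ≤ 1 := by
    have h := congrArg norm e2
    rw [w1, w2, mul_zero, sub_zero, zero_add, norm_mul, norm_pow, hu', one_pow, one_mul] at h
    have h1 : ‖3 * (toMinimal W).r - (toMinimal W).s ^ 2‖ ≤ 1 := by
      rw [← h]; exact PadicInt.norm_le_one _
    have h2 : ‖(toMinimal W).s ^ 2‖ ≤ 1 := by
      rw [norm_pow]; exact pow_le_one₀ (norm_nonneg _) hs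
    have h3 := Padic.nonarchimedean (3 * (toMinimal W).r - (toMinimal W).s ^ 2)
      ((toMinimal W).s ^ 2)
    rw [sub_add_cancel, norm_mul, n3, one_mul] at h3
    exact h3.trans (max_le h1 h2)
  have ht : ‖(toMinimal W).t‖ ≤ 1 := by
    have := congrArg norm e3
    rw [w1, w3, mul_zero, add_zero, zero_add, norm_mul, norm_mul, norm_pow, hu', n2, one_pow,
      one_mul, one_mul] at this
    rw [← this]; exact PadicInt.norm_le_one _
  let C : VariableChange ℤ_[p] :=
    ⟨⟨⟨(toMinimal W).u, hu.le⟩, ⟨((toMinimal W).u⁻¹ : ℚ_[p]ˣ), hu'.le⟩,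
      Subtype.ext (Units.mul_inv _), Subtype.ext (Units.inv_mul _)⟩,
      ⟨(toMinimal W).r, hr⟩, ⟨(toMinimal W).s, hs⟩, ⟨(toMinimal W).t, ht⟩⟩
  refine ⟨C, ?_⟩
  have hinj : Function.Injective (algebraMap ℤ_[p] ℚ_[p]) := IsFractionRing.injective _ _
  apply WeierstrassCurve.map_injective hinj
  have hC : C.map (algebraMap ℤ_[p] ℚ_[p]) = toMinimal W := by
    ext <;> rfl
  have h1 : (atPrimeInt (curve A B t) p).map (algebraMap ℤ_[p] ℚ_[p]) = W :=
    atPrimeInt_baseChange _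
  beta_reduce
  rw [← map_variableChange, hC, h1, ← toMinimal_smul]
  exact baseChange_integralModel_eq ℤ_[p] (W.minimal ℤ_[p])

lemma aeval_intCast_zmod (n : ℕ) (P : ℤ[X]) (t : ℤ) :
    aeval (t : ZMod n) P = ((P.eval t : ℤ) : ZMod n) := by
  simpa using aeval_algebraMap_apply (ZMod n) t P

lemma curve_Δ (A B : ℤ[X]) (t : ℤ) : (curve A B t).Δ = (discPoly A B).eval t := by
  simp [curve, discPoly, WeierstrassCurve.Δ, b₂, b₄, b₆, b₈]
  ring

lemma natCard_equation_curve (A B : ℤ[X]) (t : ℤ) :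
    Nat.card {P : ZMod p × ZMod p //
      ((curve A B t).map (Int.castRingHom (ZMod p))).toAffine.Equation P.1 P.2} =
    Nat.card {P : ZMod p × ZMod p //
      P.2 ^ 2 = P.1 ^ 3 + aeval (t : ZMod p) A * P.1 + aeval (t : ZMod p) B} := by
  refine Nat.card_congr (Equiv.subtypeEquivRight fun P => ?_)
  rw [Affine.equation_iff, aeval_intCast_zmod, aeval_intCast_zmod]
  simp [curve]

lemma atPrimeInt_map_toZMod (E : WeierstrassCurve ℤ) :
    (atPrimeInt E p).map PadicInt.toZMod = E.map (Int.castRingHom (ZMod p)) := by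
  rw [atPrimeInt, WeierstrassCurve.map_map]
  congr 1
  exact RingHom.ext_int _ _

/-- The integral change of variables reduces to a bijection of the affine planes over the residue
field, so the points of the reduced minimal model can be counted on the given equation. -/
lemma natCard_point_reduction (hp : 5 ≤ p) (A B : ℤ[X]) (t : ℤ)
    (hmin : MinimalAt (curve A B t) p) (hΔ : ¬ (p : ℤ) ∣ (curve A B t).Δ) :
    (Nat.card (((atPrime (curve A B t) p).minimal ℤ_[p]).reduction ℤ_[p]).toAffine.Point : ℤ) =
      p + 1 - aMod A B p t := by
  have h0 : (curve A B t).Δ ≠ 0 := by rintro h; simp [h] at hΔ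
  obtain ⟨C, hC⟩ := exists_integral_variableChange hp A B t hmin h0
  have hred : ((atPrime (curve A B t) p).minimal ℤ_[p]).reduction ℤ_[p] =
      (C.map (IsLocalRing.residue ℤ_[p])) •
        (atPrimeInt (curve A B t) p).map (IsLocalRing.residue ℤ_[p]) := by
    rw [map_variableChange, ← hC]
    rfl
  have hgood : ((atPrime (curve A B t) p).minimal ℤ_[p]).HasGoodReduction ℤ_[p] :=
    goodAt_of_not_dvd (curve A B t) hΔ
  have hell : (((atPrime (curve A B t) p).minimal ℤ_[p]).reduction ℤ_[p]).Δ ≠ 0 := by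
    have h := (hasGoodReduction_iff_isElliptic_reduction ℤ_[p]).mp hgood
    exact ((isElliptic_iff _).mp h).ne_zero
  have : Finite (IsLocalRing.ResidueField ℤ_[p]) :=
    Finite.of_equiv _ (PadicInt.residueField (p := p)).symm.toEquiv
  rw [natCard_point_eq _ hell, hred, natCard_equation_smul,
    ← natCard_equation_map (PadicInt.residueField (p := p)), WeierstrassCurve.map_map]
  have hm : (atPrimeInt (curve A B t) p).map
      (((PadicInt.residueField (p := p)) : _ →+* ZMod p).comp (IsLocalRing.residue ℤ_[p])) =
      (curve A B t).map (Int.castRingHom (ZMod p)) := by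
    rw [← atPrimeInt_map_toZMod]; rfl
  rw [hm, natCard_equation_curve, aMod]
  push_cast
  ring

/-! ### Singular equations -/

/-- A cubic with a double root `e` and vanishing quadratic coefficient is `(x - e)² (x + 2e)`; for
`a ≠ 0` the double root is `-3b / (2a)`. -/
lemma exists_node_of_disc_eq_zero {K : Type*} [Field K] (h2 : (2 : K) ≠ 0)
    {a b : K} (h : 4 * a ^ 3 + 27 * b ^ 2 = 0) (h3 : (3 : K) ≠ 0) :
    ∃ e : K, a = -3 * e ^ 2 ∧ b = 2 * e ^ 3 := by
  by_cases ha : a = 0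
  · have hb : b = 0 := by
      have h27 : (27 : K) ≠ 0 := by
        have : (27 : K) = 3 ^ 3 := by norm_num
        rw [this]; exact pow_ne_zero _ h3
      simpa [ha, h27] using h
    exact ⟨0, by simp [ha], by simp [hb]⟩
  · refine ⟨-3 * b / (2 * a), ?_, ?_⟩
    · field_simp
      linear_combination h
    · field_simp
      linear_combination b * h

lemma quadraticChar_sq_mul (x y : ZMod p) :
    quadraticChar (ZMod p) (x ^ 2 * y) = if x = 0 then 0 else quadraticChar (ZMod p) y := by
  split_ifs with h
  · simp [h]
  · rw [map_mul, quadraticChar_sq_one' h, one_mul]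

/-- The square factor `(x - e)²` removes from the full character sum, which is zero, only the value
at `x = e`. That value is `χ(3e)`, and it decides whether the tangents at the node are rational. -/
lemma aMod_of_node (hp : p ≠ 2) (A B : ℤ[X]) (t e : ZMod p) (hA : aeval t A = -3 * e ^ 2)
    (hB : aeval t B = 2 * e ^ 3) : aMod A B p t = quadraticChar (ZMod p) (3 * e) := by
  classical
  have h2 : ringChar (ZMod p) ≠ 2 := by rwa [ZMod.ringChar_zmod_n]
  rw [aMod_eq_neg_sum A B p hp, hA, hB]
  have h : ∀ x : ZMod p, quadraticChar (ZMod p) (x ^ 3 + -3 * e ^ 2 * x + 2 * e ^ 3) =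
      quadraticChar (ZMod p) (x + 2 * e) - if x = e then quadraticChar (ZMod p) (3 * e) else 0 := by
    intro x
    have : x ^ 3 + -3 * e ^ 2 * x + 2 * e ^ 3 = (x - e) ^ 2 * (x + 2 * e) := by ring
    rw [this, quadraticChar_sq_mul]
    by_cases hx : x = e
    · have : x + 2 * e = 3 * e := by rw [hx]; ring
      simp [hx, ← this]
    · simp [hx, sub_eq_zero]
  have hs := Equiv.sum_comp (Equiv.addRight (2 * e)) fun x => quadraticChar (ZMod p) x
  simp only [Equiv.coe_addRight] at hs
  rw [Finset.sum_congr rfl fun x _ => h x, Finset.sum_sub_distrib, hs,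
    quadraticChar_sum_zero h2]
  simp

lemma splits_quadratic_iff {K : Type*} [Field K] (h2 : (2 : K) ≠ 0) {a b c : K} (ha : a ≠ 0) :
    (C a * X ^ 2 + C b * X - C c).Splits ↔ IsSquare (b ^ 2 + 4 * a * c) := by
  have hd : (C a * X ^ 2 + C b * X - C c).natDegree = 2 := by
    rw [sub_eq_add_neg, ← C_neg]
    exact natDegree_quadratic ha
  have hne : NeZero (2 : K) := ⟨h2⟩
  constructor
  · intro h
    obtain ⟨x, hx⟩ := h.exists_eval_eq_zero (by
      rw [degree_eq_natDegree (by rintro h0; simp [h0] at hd), hd]; decide)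
    refine ⟨2 * a * x + b, ?_⟩
    simp only [eval_sub, eval_add, eval_mul, eval_C, eval_pow, eval_X] at hx
    linear_combination (-4 * a) * hx
  · rintro ⟨s, hs⟩
    refine Splits.of_natDegree_eq_two (x := (s - b) / (2 * a)) hd ?_
    simp only [eval_sub, eval_add, eval_mul, eval_C, eval_pow, eval_X]
    field_simp
    linear_combination -hs

lemma norm_c₄_minimal (E : WeierstrassCurve ℤ) (hmin : MinimalAt E p) (h0 : E.Δ ≠ 0) :
    ‖((atPrime E p).minimal ℤ_[p]).c₄‖ = ‖(E.c₄ : ℚ_[p])‖ := by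
  have : IsMinimal ℤ_[p] (atPrime E p) := hmin
  have hu := norm_u_eq_one_of_isMinimal (atPrime E p) (by rw [atPrime_Δ]; exact_mod_cast h0)
  rw [toMinimal_smul, variableChange_c₄, norm_mul, norm_pow, Units.val_inv_eq_inv_val, norm_inv,
    hu]
  simp [atPrime]

lemma hasMultiplicativeReduction_minimal_iff (E : WeierstrassCurve ℤ) (hmin : MinimalAt E p)
    (h0 : E.Δ ≠ 0) : ((atPrime E p).minimal ℤ_[p]).HasMultiplicativeReduction ℤ_[p] ↔
      (p : ℤ) ∣ E.Δ ∧ ¬ (p : ℤ) ∣ E.c₄ := by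
  have : IsMinimal ℤ_[p] (atPrime E p) := hmin
  rw [hasMultiplicativeReduction_iff, padicVal_lt_one_iff, padicVal_eq_one_iff,
    norm_c₄_minimal E hmin h0, norm_Δ_minimal_of_isMinimal, atPrime_Δ,
    Padic.norm_intCast_lt_one_iff]
  have h : ‖(E.c₄ : ℚ_[p])‖ = 1 ↔ ¬ (p : ℤ) ∣ E.c₄ := by
    rw [← Padic.norm_intCast_lt_one_iff (p := p), not_lt]
    exact ⟨fun h => h.ge, fun h => le_antisymm (Padic.norm_int_le_one _) h⟩
  rw [h]
  exact ⟨fun h => h.2, fun h => ⟨inferInstance, h⟩⟩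

lemma toZMod_eq_zero_iff_residue (x : ℤ_[p]) :
    IsLocalRing.residue ℤ_[p] x = 0 ↔ PadicInt.toZMod x = 0 := by
  rw [PadicInt.toZMod_eq_residueField_comp_residue]
  exact (map_eq_zero_iff (PadicInt.residueField (p := p))
    (PadicInt.residueField (p := p)).injective).symm

lemma isSquare_residue_iff (x : ℤ_[p]) :
    IsSquare (IsLocalRing.residue ℤ_[p] x) ↔ IsSquare (PadicInt.toZMod x) := by
  rw [PadicInt.toZMod_eq_residueField_comp_residue]
  constructor
  · intro h
    exact h.map (PadicInt.residueField (p := p))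
  · intro h
    have := h.map (PadicInt.residueField (p := p)).symm
    simpa using this

/-- Splitness is the factorization of the tangent quadratic, hence squareness of its discriminant.
That discriminant is `-c₄ c₆`, an invariant that can be read off from the given equation instead of
the minimal model. -/
lemma hasSplitMultiplicativeReduction_minimal_iff (hp : p ≠ 2) (E : WeierstrassCurve ℤ)
    (hmin : MinimalAt E p) (h0 : E.Δ ≠ 0) (hΔ : (p : ℤ) ∣ E.Δ) (hc : ¬ (p : ℤ) ∣ E.c₄) :
    ((atPrime E p).minimal ℤ_[p]).HasSplitMultiplicativeReduction ℤ_[p] ↔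
      IsSquare (-(E.c₄ : ZMod p) * E.c₆) := by
  have hmul := (hasMultiplicativeReduction_minimal_iff E hmin h0).mpr ⟨hΔ, hc⟩
  have : IsMinimal ℤ_[p] (atPrime E p) := hmin
  have hu := norm_u_eq_one_of_isMinimal (atPrime E p) (by rw [atPrime_Δ]; exact_mod_cast h0)
  set W := atPrime E p with hW
  set I := integralModel ℤ_[p] (W.minimal ℤ_[p]) with hI
  let w : ℤ_[p]ˣ := ⟨⟨((toMinimal W).u⁻¹ : ℚ_[p]ˣ), by simp [hu]⟩, ⟨(toMinimal W).u, hu.le⟩,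
    Subtype.ext (Units.inv_mul _), Subtype.ext (Units.mul_inv _)⟩
  have hinj : Function.Injective (algebraMap ℤ_[p] ℚ_[p]) := IsFractionRing.injective _ _
  have hw : algebraMap ℤ_[p] ℚ_[p] w = ((toMinimal W).u⁻¹ : ℚ_[p]ˣ) := rfl
  have h4 : I.c₄ = (w : ℤ_[p]) ^ 4 * (E.c₄ : ℤ_[p]) := by
    apply hinj
    rw [map_mul, map_pow, hw, map_intCast]
    have := (integralModel_c₄_eq ℤ_[p] (W.minimal ℤ_[p])).trans
      (variableChange_c₄ W (toMinimal W))
    rw [hI, this, hW]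
    simp [atPrime]
  have h6 : I.c₆ = (w : ℤ_[p]) ^ 6 * (E.c₆ : ℤ_[p]) := by
    apply hinj
    rw [map_mul, map_pow, hw, map_intCast]
    have := (integralModel_c₆_eq ℤ_[p] (W.minimal ℤ_[p])).trans
      (variableChange_c₆ W (toMinimal W))
    rw [hI, this, hW]
    simp [atPrime]
  have hwz : PadicInt.toZMod (w : ℤ_[p]) ≠ 0 :=
    (IsUnit.map PadicInt.toZMod w.isUnit).ne_zero
  -- Passing to the minimal model scales `c₄ c₆` by the tenth power of a unit, which is a square.
  have hsq : IsSquare (IsLocalRing.residue ℤ_[p] (-I.c₄ * I.c₆)) ↔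
      IsSquare (-(E.c₄ : ZMod p) * E.c₆) := by
    rw [isSquare_residue_iff, h4, h6]
    simp only [map_mul, map_neg, map_pow, map_intCast]
    set v := PadicInt.toZMod (w : ℤ_[p])
    have : -(v ^ 4 * (E.c₄ : ZMod p)) * (v ^ 6 * E.c₆) = (v ^ 5) ^ 2 * (-(E.c₄ : ZMod p) * E.c₆) := by
      ring
    rw [this]
    constructor
    · rintro ⟨s, hs⟩
      refine ⟨s / v ^ 5, ?_⟩
      field_simp
      linear_combination hs
    · rintro ⟨s, hs⟩
      exact ⟨v ^ 5 * s, by rw [hs]; ring⟩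
  have h2 : (2 : IsLocalRing.ResidueField ℤ_[p]) ≠ 0 := by
    intro h
    have h' := (toZMod_eq_zero_iff_residue (p := p) 2).mp (by rw [map_ofNat]; exact h)
    have h'' : ((2 : ℕ) : ZMod p) = 0 := by rw [map_ofNat] at h'; exact_mod_cast h'
    rw [ZMod.natCast_eq_zero_iff] at h''
    exact hp ((Nat.prime_dvd_prime_iff_eq Fact.out Nat.prime_two).mp h'')
  have hc4 : IsLocalRing.residue ℤ_[p] I.c₄ ≠ 0 := by
    rw [Ne, toZMod_eq_zero_iff_residue, h4, map_mul, map_pow, map_intCast, mul_eq_zero, not_or]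
    exact ⟨pow_ne_zero _ hwz, by rwa [ZMod.intCast_zmod_eq_zero_iff_dvd]⟩
  have hspl := splits_quadratic_iff h2 hc4 (b := IsLocalRing.residue ℤ_[p] (I.a₁ * I.c₄))
    (c := IsLocalRing.residue ℤ_[p] (54 * I.b₆ - 3 * I.b₂ * I.b₄ + I.a₂ * I.c₄))
  have hdisc : IsLocalRing.residue ℤ_[p] (I.a₁ * I.c₄) ^ 2 + 4 * IsLocalRing.residue ℤ_[p] I.c₄ *
      IsLocalRing.residue ℤ_[p] (54 * I.b₆ - 3 * I.b₂ * I.b₄ + I.a₂ * I.c₄) =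
      IsLocalRing.residue ℤ_[p] (-I.c₄ * I.c₆) := by
    have h4' : (4 : IsLocalRing.ResidueField ℤ_[p]) =
        IsLocalRing.residue ℤ_[p] 4 := (map_ofNat _ 4).symm
    rw [h4', ← map_pow, ← map_mul, ← map_mul, ← map_add]
    congr 1
    simp only [WeierstrassCurve.c₆, WeierstrassCurve.c₄, WeierstrassCurve.b₂,
      WeierstrassCurve.b₄, WeierstrassCurve.b₆]
    ring
  rw [hdisc, hsq] at hspl
  rw [hasSplitMultiplicativeReduction_iff, ← hspl]
  rw [IsLocalRing.ResidueField.algebraMap_eq]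
  simp only [Polynomial.map_sub, Polynomial.map_add, Polynomial.map_mul, Polynomial.map_pow,
    Polynomial.map_X, Polynomial.map_C]
  exact ⟨fun h => h.2, fun h => ⟨hmul, h⟩⟩

/-! ### The coefficient of the `L`-function -/

lemma traceAt_of_additiveAt (E : WeierstrassCurve ℤ) (h : AdditiveAt E p) : traceAt E p = 0 := by
  have h1 := HasAdditiveReduction.not_hasGoodReduction ℤ_[p] h
  have h2 := HasAdditiveReduction.not_hasMultiplicativeReduction ℤ_[p] h
  have h3 : ¬ (minimalModel E p).HasSplitMultiplicativeReduction ℤ_[p] := fun h' =>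
    h2 h'.toHasMultiplicativeReduction
  unfold minimalModel at h1 h2 h3
  simp [traceAt, localPolynomial, h1, h2, h3, coeff_one]

lemma two_three_ne_zero (hp : 5 ≤ p) : (2 : ZMod p) ≠ 0 ∧ (3 : ZMod p) ≠ 0 := by
  constructor
  · intro h
    have h' : ((2 : ℕ) : ZMod p) = 0 := by exact_mod_cast h
    rw [ZMod.natCast_eq_zero_iff] at h'
    have := Nat.le_of_dvd (by norm_num) h'
    omega
  · intro h
    have h' : ((3 : ℕ) : ZMod p) = 0 := by exact_mod_cast h
    rw [ZMod.natCast_eq_zero_iff] at h'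
    have := Nat.le_of_dvd (by norm_num) h'
    omega

lemma exists_node (hp : 5 ≤ p) (A B : ℤ[X]) (t : ZMod p) (h : aeval t (discPoly A B) = 0) :
    ∃ e : ZMod p, aeval t A = -3 * e ^ 2 ∧ aeval t B = 2 * e ^ 3 := by
  obtain ⟨h2, h3⟩ := two_three_ne_zero hp
  refine exists_node_of_disc_eq_zero h2 ?_ h3
  have h16 : (-16 : ZMod p) ≠ 0 := by
    have : (-16 : ZMod p) = -2 ^ 4 := by norm_num
    rw [this]; exact neg_ne_zero.mpr (pow_ne_zero _ h2)
  simp only [discPoly, map_mul, map_neg, map_ofNat, map_add, map_pow] at h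
  exact (mul_eq_zero.mp h).resolve_left h16

lemma abs_aMod_le_one (hp : 5 ≤ p) (A B : ℤ[X]) (t : ZMod p) (h : aeval t (discPoly A B) = 0) :
    |(aMod A B p t : ℝ)| ≤ 1 := by
  obtain ⟨e, hA, hB⟩ := exists_node hp A B t h
  rw [aMod_of_node (by omega) A B t e hA hB]
  rcases quadraticChar_isQuadratic (ZMod p) (3 * e) with h | h | h <;> simp [h]

lemma aMod_of_cusp (hp : 5 ≤ p) (A B : ℤ[X]) (t : ZMod p) (hA : aeval t A = 0)
    (hB : aeval t B = 0) : aMod A B p t = 0 := by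
  rw [aMod_of_node (by omega) A B t 0 (by simp [hA]) (by simp [hB])]
  simp

lemma curve_c₄ (A B : ℤ[X]) (t : ℤ) : (curve A B t).c₄ = -48 * A.eval t := by
  simp [curve, WeierstrassCurve.c₄, b₂, b₄]
  ring

lemma curve_c₆ (A B : ℤ[X]) (t : ℤ) : (curve A B t).c₆ = -864 * B.eval t := by
  simp [curve, WeierstrassCurve.c₆, b₂, b₄, b₆]
  ring

lemma dvd_curve_c₄_iff (hp : 5 ≤ p) (A B : ℤ[X]) (t : ℤ) :
    (p : ℤ) ∣ (curve A B t).c₄ ↔ aeval (t : ZMod p) A = 0 := by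
  obtain ⟨h2, h3⟩ := two_three_ne_zero hp
  have h48 : (-48 : ZMod p) ≠ 0 := by
    have : (-48 : ZMod p) = -(2 ^ 4 * 3) := by norm_num
    rw [this]; exact neg_ne_zero.mpr (mul_ne_zero (pow_ne_zero _ h2) h3)
  rw [← ZMod.intCast_zmod_eq_zero_iff_dvd, curve_c₄, aeval_intCast_zmod]
  push_cast
  rw [mul_eq_zero, or_iff_right h48]

lemma dvd_eval_disc_iff (A B : ℤ[X]) (t : ℤ) :
    (p : ℤ) ∣ (curve A B t).Δ ↔ aeval (t : ZMod p) (discPoly A B) = 0 := by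
  rw [← ZMod.intCast_zmod_eq_zero_iff_dvd, curve_Δ, aeval_intCast_zmod]

/-- At good primes this is the point count. At bad primes the character value `χ(3e)` matches the
three definitions: `0` for a cusp, `1` for a split and `-1` for a nonsplit node. -/
lemma traceAt_eq_aMod (hp : 5 ≤ p) (A B : ℤ[X]) (t : ℤ) (hmin : MinimalAt (curve A B t) p)
    (h0 : (curve A B t).Δ ≠ 0) : traceAt (curve A B t) p = aMod A B p t := by
  by_cases hΔ : (p : ℤ) ∣ (curve A B t).Δ
  · have hng : ¬ ((atPrime (curve A B t) p).minimal ℤ_[p]).HasGoodReduction ℤ_[p] := fun h =>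
      (goodAt_iff_not_dvd_of_minimalAt _ hmin).mp h hΔ
    obtain ⟨e, hA, hB⟩ := exists_node hp A B t ((dvd_eval_disc_iff A B t).mp hΔ)
    have hmul := hasMultiplicativeReduction_minimal_iff _ hmin h0
    obtain ⟨h2, h3⟩ := two_three_ne_zero hp
    rw [aMod_of_node (by omega) A B t e hA hB]
    by_cases he : e = 0
    · have h1 : ¬ ((atPrime (curve A B t) p).minimal ℤ_[p]).HasMultiplicativeReduction ℤ_[p] := by
        rw [hmul, dvd_curve_c₄_iff hp, hA]
        simp [he]
      have h2 : ¬ ((atPrime (curve A B t) p).minimal ℤ_[p]).HasSplitMultiplicativeReduction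
          ℤ_[p] := fun h' => h1 h'.toHasMultiplicativeReduction
      simp [traceAt, localPolynomial, hng, h1, h2, he, coeff_one]
    · have hc : ¬ (p : ℤ) ∣ (curve A B t).c₄ := by
        rw [dvd_curve_c₄_iff hp, hA]
        simp [he, h3]
      have h1 := hmul.mpr ⟨hΔ, hc⟩
      have hsp := hasSplitMultiplicativeReduction_minimal_iff (by omega) _ hmin h0 hΔ hc
      -- With `A = -3e²` and `B = 2e³`, the product `-c₄ c₆` equals `3e` times the square of
      -- `288e²`.
      have hsq : IsSquare (-((curve A B t).c₄ : ZMod p) * (curve A B t).c₆) ↔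
          IsSquare (3 * e) := by
        rw [curve_c₄, curve_c₆]
        push_cast
        rw [← aeval_intCast_zmod, ← aeval_intCast_zmod, hA, hB]
        have : -(-48 * (-3 * e ^ 2)) * (-864 * (2 * e ^ 3)) =
            (2 * (12 * e) ^ 2) ^ 2 * (3 * e) := by ring
        have h12 : (12 : ZMod p) ≠ 0 := by
          have : (12 : ZMod p) = 2 ^ 2 * 3 := by norm_num
          rw [this]; exact mul_ne_zero (pow_ne_zero _ h2) h3
        rw [this]
        constructor
        · rintro ⟨s, hs⟩
          refine ⟨s / (2 * (12 * e) ^ 2), ?_⟩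
          field_simp
          field_simp at hs
          linear_combination hs
        · rintro ⟨s, hs⟩
          exact ⟨2 * (12 * e) ^ 2 * s, by rw [hs]; ring⟩
      rw [hsq] at hsp
      have h3e : 3 * e ≠ 0 := mul_ne_zero h3 he
      by_cases hs : IsSquare (3 * e)
      · rw [(quadraticChar_one_iff_isSquare h3e).mpr hs]
        simp [traceAt, localPolynomial, hng, hsp.mpr hs, coeff_one]
      · rw [quadraticChar_neg_one_iff_not_isSquare.mpr hs]
        have hs' : ¬ ((atPrime (curve A B t) p).minimal ℤ_[p]).HasSplitMultiplicativeReduction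
          ℤ_[p] := fun h => hs (hsp.mp h)
        simp [traceAt, localPolynomial, hng, hs', h1, coeff_one]
  · have hg : ((atPrime (curve A B t) p).minimal ℤ_[p]).HasGoodReduction ℤ_[p] :=
      goodAt_of_not_dvd _ hΔ
    have hq : Nat.card (IsLocalRing.ResidueField ℤ_[p]) = p := by
      rw [Nat.card_congr (PadicInt.residueField (p := p)).toEquiv, Nat.card_zmod]
    have hcard := natCard_point_reduction hp A B t hmin hΔ
    rw [traceAt, localPolynomial, if_pos hg, hcard, hq]
    simp [coeff_one]

end Local

/-! ### The number of roots of a polynomial modulo `n` -/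

section Roots

lemma map_aeval_int {R S : Type*} [CommRing R] [CommRing S] (φ : R →+* S) (x : R) (P : ℤ[X]) :
    aeval (φ x) P = φ (aeval x P) :=
  aeval_algHom_apply φ.toIntAlgHom x P

lemma nu_one (D : ℤ[X]) : nu D 1 = 1 := by
  have : Unique {t : ZMod 1 // aeval t D = 0} :=
    ⟨⟨⟨0, Subsingleton.elim _ _⟩⟩, fun x => Subsingleton.elim _ _⟩
  exact Nat.card_unique

lemma nu_mul (D : ℤ[X]) {m n : ℕ} (h : m.Coprime n) : nu D (m * n) = nu D m * nu D n := by
  rw [nu, nu, nu, ← Nat.card_prod]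
  let e := ZMod.chineseRemainder h
  have key : ∀ x : ZMod (m * n), aeval x D = 0 ↔
      aeval (e x).1 D = 0 ∧ aeval (e x).2 D = 0 := fun x => by
    have h1 := map_aeval_int ((RingHom.fst (ZMod m) (ZMod n)).comp (e : ZMod (m * n) →+* _)) x D
    have h2 := map_aeval_int ((RingHom.snd (ZMod m) (ZMod n)).comp (e : ZMod (m * n) →+* _)) x D
    simp only [RingHom.comp_apply, RingHom.coe_fst, RingHom.coe_snd, RingHom.coe_coe] at h1 h2
    rw [h1, h2, ← map_eq_zero_iff e e.injective, Prod.ext_iff]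
    rfl
  refine Nat.card_congr ?_
  exact (e.toEquiv.subtypeEquiv key).trans Equiv.subtypeProdEquivProd

lemma nu_le (D : ℤ[X]) (n : ℕ) [NeZero n] : nu D n ≤ n := by
  have := Nat.card_le_card_of_injective (Subtype.val : {t : ZMod n // aeval t D = 0} → ZMod n)
    Subtype.val_injective
  rwa [Nat.card_zmod] at this

lemma nu_eq_card (D : ℤ[X]) (n : ℕ) [NeZero n] :
    nu D n = (Finset.univ.filter fun x : ZMod n => aeval x D = 0).card := by
  rw [nu, Nat.card_eq_fintype_card, Fintype.card_subtype]

/-- Roots modulo a prime `q` prime to the resultant lift uniquely, so that their number modulo a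
power of `q` is at most the degree. -/
lemma nu_prime_pow_le (D u v : ℤ[X]) (c : ℤ) (huv : u * D + v * derivative D = C c) {q j : ℕ}
    (hq : q.Prime) (hj : 1 ≤ j) (hqc : ¬ (q : ℤ) ∣ c) (hql : ¬ (q : ℤ) ∣ D.leadingCoeff) :
    nu D (q ^ j) ≤ D.natDegree := by
  have hfq : Fact q.Prime := ⟨hq⟩
  have hne : NeZero (q ^ j) := ⟨pow_ne_zero _ hq.ne_zero⟩
  let φ : ZMod (q ^ j) →+* ZMod q := ZMod.castHom (dvd_pow_self q (by omega)) (ZMod q)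
  have hDq : D.map (Int.castRingHom (ZMod q)) ≠ 0 := by
    intro h
    have := congrArg (fun P : (ZMod q)[X] => P.coeff D.natDegree) h
    simp only [coeff_map, coeff_natDegree, eq_intCast, coeff_zero] at this
    exact hql ((ZMod.intCast_zmod_eq_zero_iff_dvd _ _).mp this)
  let F : {t : ZMod (q ^ j) // aeval t D = 0} → (D.map (Int.castRingHom (ZMod q))).roots.toFinset :=
    fun x => ⟨φ x.1, by
      rw [Multiset.mem_toFinset, mem_roots hDq, IsRoot.def, eval_map]
      have h1 : aeval (φ x.1) D = 0 := by rw [map_aeval_int, x.2, map_zero]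
      exact h1⟩
  -- Two roots `a ≡ b` modulo `q` satisfy `D(a) - D(b) = (a - b)(D'(b) + k(a - b))`. The Bézout
  -- relation makes `D'(b)` a unit modulo `q`, so the second factor is prime to `q` and `a ≡ b`
  -- modulo `q ^ j`.
  have hF : Function.Injective F := by
    rintro ⟨x, hx⟩ ⟨y, hy⟩ hxy
    have hxy' : φ x = φ y := congrArg (fun z => z.1) hxy
    obtain ⟨a, rfl⟩ := ZMod.intCast_surjective x
    obtain ⟨b, rfl⟩ := ZMod.intCast_surjective y
    rw [aeval_intCast_zmod, ZMod.intCast_zmod_eq_zero_iff_dvd] at hx hy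
    simp only [map_intCast] at hxy'
    rw [ZMod.intCast_eq_intCast_iff_dvd_sub] at hxy'
    obtain ⟨k, hk⟩ := D.binomExpansion b (a - b)
    rw [add_sub_cancel] at hk
    have hdvd : ((q ^ j : ℕ) : ℤ) ∣ (a - b) * ((derivative D).eval b + k * (a - b)) := by
      have : (a - b) * ((derivative D).eval b + k * (a - b)) = D.eval a - D.eval b := by
        rw [hk]; ring
      rw [this]
      exact dvd_sub hx hy
    have hqi : Prime (q : ℤ) := Nat.prime_iff_prime_int.mp hq
    have hab : (q : ℤ) ∣ a - b := by
      rw [← dvd_neg, neg_sub]; exact hxy'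
    have hnd : ¬ (q : ℤ) ∣ (derivative D).eval b + k * (a - b) := by
      intro h
      have h1 : (q : ℤ) ∣ (derivative D).eval b := by
        rwa [dvd_add_left (hab.mul_left k)] at h
      have h2 : (q : ℤ) ∣ D.eval b := by
        refine dvd_trans ?_ hy
        push_cast
        exact dvd_pow_self _ (by omega)
      apply hqc
      have h3 := congrArg (eval b) huv
      simp only [eval_add, eval_mul, eval_C] at h3
      rw [← h3]
      exact dvd_add (h2.mul_left _) (h1.mul_left _)
    have hcop : IsCoprime ((q ^ j : ℕ) : ℤ) ((derivative D).eval b + k * (a - b)) := by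
      push_cast
      exact ((Prime.coprime_iff_not_dvd hqi).mpr hnd).pow_left
    have hfin := hcop.dvd_of_dvd_mul_right hdvd
    refine Subtype.ext ?_
    change (a : ZMod (q ^ j)) = (b : ZMod (q ^ j))
    rw [ZMod.intCast_eq_intCast_iff_dvd_sub, ← dvd_neg, neg_sub]
    exact hfin
  calc nu D (q ^ j) ≤ Nat.card (D.map (Int.castRingHom (ZMod q))).roots.toFinset :=
        Nat.card_le_card_of_injective F hF
    _ = (D.map (Int.castRingHom (ZMod q))).roots.toFinset.card := by
        rw [Nat.card_eq_fintype_card, Fintype.card_coe]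
    _ ≤ (D.map (Int.castRingHom (ZMod q))).roots.card := Multiset.toFinset_card_le _
    _ ≤ (D.map (Int.castRingHom (ZMod q))).natDegree := card_roots' _
    _ ≤ D.natDegree := natDegree_map_le

lemma nu_prod_pow (D : ℤ[X]) (j : ℕ) (s : Finset ℕ) (hs : ∀ q ∈ s, q.Prime) :
    nu D ((∏ q ∈ s, q) ^ j) = ∏ q ∈ s, nu D (q ^ j) := by
  classical
  induction s using Finset.induction_on with
  | empty => simp [nu_one]
  | insert q s hq ih =>
    rw [Finset.prod_insert hq, Finset.prod_insert hq, mul_pow, nu_mul,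
      ih fun r hr => hs r (Finset.mem_insert_of_mem hr)]
    refine Nat.Coprime.pow _ _ (Nat.Coprime.prod_right fun r hr => ?_)
    exact (Nat.coprime_primes (hs q (Finset.mem_insert_self _ _))
      (hs r (Finset.mem_insert_of_mem hr))).mpr fun h => hq (h ▸ hr)

/-- For squarefree `d` the number of roots modulo `d ^ j` is `O(√d)`. -/
lemma exists_nu_le_sqrt (D : ℤ[X]) (j Q m : ℕ)
    (hQ : ∀ q : ℕ, q.Prime → Q ≤ q → nu D (q ^ j) ≤ m) :
    ∃ K : ℝ, 1 ≤ K ∧ ∀ d : ℕ, Squarefree d → (nu D (d ^ j) : ℝ) ≤ K * √(d : ℝ) := by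
  classical
  -- Beyond `m²` the degree bound `m` is at most `√q`; the finitely many smaller primes are absorbed
  -- in the constant by the trivial bound `q ^ j`.
  set Q' := max Q (m ^ 2 + 1) with hQ'
  let w : ℕ → ℝ := fun q => if q < Q' then (q : ℝ) ^ j else 1
  let W : ℕ → ℝ := fun q => max 1 ((q : ℝ) ^ j)
  have hW1 : ∀ q, 1 ≤ W q := fun q => le_max_left _ _
  refine ⟨∏ q ∈ Finset.range Q', W q, Finset.one_le_prod fun q _ => hW1 q, fun d hd => ?_⟩
  have hprod : ∏ q ∈ d.primeFactors, q = d := Nat.prod_primeFactors_of_squarefree hd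
  have hloc : ∀ q ∈ d.primeFactors, (nu D (q ^ j) : ℝ) ≤ w q * √(q : ℝ) := by
    intro q hq
    have hqp := Nat.prime_of_mem_primeFactors hq
    have hne : NeZero (q ^ j) := ⟨pow_ne_zero _ hqp.ne_zero⟩
    by_cases hlt : q < Q'
    · simp only [w, hlt, if_true]
      have h1 : (nu D (q ^ j) : ℝ) ≤ (q : ℝ) ^ j := by exact_mod_cast nu_le D (q ^ j)
      have h2 : 1 ≤ √(q : ℝ) := Real.one_le_sqrt.mpr (by exact_mod_cast hqp.one_lt.le)
      nlinarith [pow_nonneg (Nat.cast_nonneg (α := ℝ) q) j]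
    · simp only [w, hlt, if_false, one_mul]
      have hle : Q' ≤ q := not_lt.mp hlt
      have h1 : (nu D (q ^ j) : ℝ) ≤ m := by
        exact_mod_cast hQ q hqp (le_trans (le_max_left _ _) hle)
      refine h1.trans (Real.le_sqrt_of_sq_le ?_)
      have h2 : m ^ 2 + 1 ≤ q := le_trans (le_max_right _ _) hle
      exact_mod_cast (by omega : m ^ 2 ≤ q)
  calc (nu D (d ^ j) : ℝ) = ∏ q ∈ d.primeFactors, (nu D (q ^ j) : ℝ) := by
        conv_lhs => rw [← hprod]
        rw [nu_prod_pow D j _ fun q hq => Nat.prime_of_mem_primeFactors hq]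
        push_cast; rfl
    _ ≤ ∏ q ∈ d.primeFactors, (w q * √(q : ℝ)) :=
        Finset.prod_le_prod (fun _ _ => by positivity) hloc
    _ = (∏ q ∈ d.primeFactors, w q) * √(d : ℝ) := by
        rw [Finset.prod_mul_distrib]
        congr 1
        conv_rhs => rw [← hprod]
        push_cast
        rw [Real.sqrt_prod]
        exact fun _ _ => by positivity
    _ ≤ (∏ q ∈ Finset.range Q', W q) * √(d : ℝ) := by
        refine mul_le_mul_of_nonneg_right ?_ (Real.sqrt_nonneg _)
        calc ∏ q ∈ d.primeFactors, w q
            = ∏ q ∈ d.primeFactors.filter (· < Q'), (q : ℝ) ^ j := by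
              rw [Finset.prod_filter]
          _ ≤ ∏ q ∈ d.primeFactors.filter (· < Q'), W q :=
              Finset.prod_le_prod (fun _ _ => by positivity) fun q _ => le_max_right _ _
          _ ≤ ∏ q ∈ Finset.range Q', W q := by
              refine Finset.prod_le_prod_of_subset_of_one_le ?_ ?_ ?_
              · intro q hq
                simpa using (Finset.mem_filter.mp hq).2
              · intro q _; exact zero_le_one.trans (hW1 q)
              · intro q _ _; exact hW1 q

end Roots

/-! ### Counting integers in residue classes -/

section Counting

lemma abs_card_modEq_sub_le (N n : ℕ) (hn : 0 < n) (r : ℤ) :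
    |(((Finset.Icc (N : ℤ) (2 * N)).filter fun t => t ≡ r [ZMOD n]).card : ℝ) - N / n| ≤ 2 := by
  have hI : Finset.Icc (N : ℤ) (2 * N) = Finset.Ioc ((N : ℤ) - 1) (2 * N) := by
    ext x; simp
  have h := Int.Ioc_filter_modEq_card ((N : ℤ) - 1) (2 * N) (r := n) (by exact_mod_cast hn) r
  rw [hI]
  have hn' : (0 : ℚ) < n := by exact_mod_cast hn
  have hn1 : (1 : ℚ) ≤ n := by exact_mod_cast hn
  set x : ℚ := (((2 * N : ℤ) : ℚ) - (r : ℚ)) / ((n : ℤ) : ℚ) with hx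
  set y : ℚ := ((((N : ℤ) - 1 : ℤ) : ℚ) - (r : ℚ)) / ((n : ℤ) : ℚ) with hy
  have hxy : x - y = N / n + 1 / n := by
    rw [hx, hy]; push_cast; field_simp; ring
  have h1n : (1 : ℚ) / n ≤ 1 := by rw [div_le_one hn']; exact hn1
  have h1n' : (0 : ℚ) < 1 / n := by positivity
  have hNn : (0 : ℚ) ≤ N / n := by positivity
  have f1 := Int.floor_le x
  have f2 := Int.lt_floor_add_one x
  have f3 := Int.floor_le y
  have f4 := Int.lt_floor_add_one y
  have hc : ((((Finset.Ioc ((N : ℤ) - 1) (2 * N)).filter fun t => t ≡ r [ZMOD n]).card : ℤ) : ℚ) =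
      max ((⌊x⌋ : ℚ) - ⌊y⌋) 0 := by
    rw [h]; push_cast; rfl
  have key : |((((Finset.Ioc ((N : ℤ) - 1) (2 * N)).filter
      fun t => t ≡ r [ZMOD n]).card : ℤ) : ℚ) - N / n| ≤ 2 := by
    rw [hc, abs_le]
    rcases max_cases ((⌊x⌋ : ℚ) - ⌊y⌋) 0 with ⟨h1, h2⟩ | ⟨h1, h2⟩ <;> rw [h1] <;>
      constructor <;> linarith
  have key' := (Rat.cast_le (K := ℝ)).mpr key
  push_cast at key'
  exact key'

/-- The `t ∈ [N, 2N]` congruent to `a` modulo `P` with `D(t)` divisible by `n`. -/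
def classRoots (D : ℤ[X]) (N P : ℕ) (a : ℤ) (n : ℕ) : Finset ℤ :=
  ((Finset.Icc (N : ℤ) (2 * N)).filter fun t => t ≡ a [ZMOD P]).filter
    fun t => (n : ℤ) ∣ D.eval t

/-- By the Chinese remainder theorem each root modulo `n` combines with the class modulo `P` into
one class modulo `P * n`; the rounding error occurs once per root. -/
lemma abs_card_classRoots_sub_le (D : ℤ[X]) (N P : ℕ) (a : ℤ) (n : ℕ) (hP : 0 < P) (hn : 0 < n)
    (hPn : P.Coprime n) :
    |((classRoots D N P a n).card : ℝ) - N * nu D n / (P * n)| ≤ 2 * nu D n := by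
  classical
  have hne : NeZero n := ⟨hn.ne'⟩
  set R := Finset.univ.filter fun x : ZMod n => aeval x D = 0 with hR
  have hcard : (classRoots D N P a n).card = ∑ x ∈ R,
      ((classRoots D N P a n).filter fun t : ℤ => (t : ZMod n) = x).card := by
    refine Finset.card_eq_sum_card_fiberwise fun t ht => ?_
    have ht' := (Finset.mem_filter.mp ht).2
    simp only [hR, Finset.coe_filter, Finset.mem_univ, true_and]
    change aeval (t : ZMod n) D = 0
    rw [aeval_intCast_zmod]
    exact (ZMod.intCast_zmod_eq_zero_iff_dvd _ _).mpr ht'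
  have hfib : ∀ x ∈ R, |(((classRoots D N P a n).filter fun t : ℤ => (t : ZMod n) = x).card : ℝ) -
      N / (P * n)| ≤ 2 := by
    intro x hx
    obtain ⟨b, rfl⟩ := ZMod.intCast_surjective x
    have hb : (n : ℤ) ∣ D.eval b := by
      have := (Finset.mem_filter.mp hx).2
      rwa [aeval_intCast_zmod, ZMod.intCast_zmod_eq_zero_iff_dvd] at this
    obtain ⟨u, v, huv⟩ := Nat.isCoprime_iff_coprime.mpr hPn
    set r := a * (v * n) + b * (u * P) with hr
    have hrP : r ≡ a [ZMOD P] := by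
      rw [Int.modEq_iff_dvd]
      exact ⟨(a - b) * u, by rw [hr]; linear_combination (-a) * huv⟩
    have hrn : r ≡ b [ZMOD n] := by
      rw [Int.modEq_iff_dvd]
      exact ⟨(b - a) * v, by rw [hr]; linear_combination (-b) * huv⟩
    have hset : ((classRoots D N P a n).filter fun t : ℤ => (t : ZMod n) = b) =
        (Finset.Icc (N : ℤ) (2 * N)).filter fun t => t ≡ r [ZMOD ((P * n : ℕ) : ℤ)] := by
      ext t
      simp only [classRoots, Finset.mem_filter, and_assoc]
      refine and_congr_right fun _ => ?_
      rw [Nat.cast_mul, ← Int.modEq_and_modEq_iff_modEq_mul (by simpa using hPn)]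
      constructor
      · rintro ⟨h1, -, h3⟩
        exact ⟨h1.trans hrP.symm, ((ZMod.intCast_eq_intCast_iff _ _ _).mp h3).trans hrn.symm⟩
      · rintro ⟨h1, h2⟩
        have h3 := h2.trans hrn
        refine ⟨h1.trans hrP, ?_, (ZMod.intCast_eq_intCast_iff _ _ _).mpr h3⟩
        have h4 : (n : ℤ) ∣ D.eval t - D.eval b :=
          dvd_trans (by rw [← dvd_neg, neg_sub]; exact h3.dvd) (sub_dvd_eval_sub t b D)
        simpa using dvd_add h4 hb
    rw [hset]
    have := abs_card_modEq_sub_le N (P * n) (Nat.mul_pos hP hn) r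
    push_cast at this ⊢
    exact this
  have hν : (nu D n : ℝ) = ∑ x ∈ R, (1 : ℝ) := by
    rw [nu_eq_card, ← hR]; simp
  have e1 : ((classRoots D N P a n).card : ℝ) - N * nu D n / (P * n) = ∑ x ∈ R,
      ((((classRoots D N P a n).filter fun t : ℤ => (t : ZMod n) = x).card : ℝ) -
        N / (P * n)) := by
    rw [Finset.sum_sub_distrib, hcard]
    push_cast
    congr 1
    rw [hν, Finset.mul_sum, Finset.sum_div]
    refine Finset.sum_congr rfl fun x _ => by ring
  rw [e1]
  calc _ ≤ ∑ x ∈ R, _ := Finset.abs_sum_le_sum_abs _ _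
    _ ≤ ∑ x ∈ R, (2 : ℝ) := Finset.sum_le_sum hfib
    _ = 2 * nu D n := by rw [hν, Finset.mul_sum]; simp

end Counting

/-! ### A truncated Möbius formula -/

section Truncation

open ArithmeticFunction

lemma sum_divisors_moebius {r : ℕ} (hr : r ≠ 1) : ∑ d ∈ r.divisors, (moebius d : ℤ) = 0 := by
  have := congrArg (fun f : ArithmeticFunction ℤ => f r) moebius_mul_coe_zeta
  simpa only [coe_mul_zeta_apply, one_apply_ne hr] using this

/-- Adding factors one at a time, the first product to exceed `y` is at most `y * y`, since each
factor is at most `y`. -/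
lemma exists_subset_prod_mem_Ioc (y : ℕ) (s : Finset ℕ) (hs : ∀ q ∈ s, 1 ≤ q ∧ q ≤ y)
    (h : y < ∏ q ∈ s, q) (hy : 1 ≤ y) :
    ∃ s' ⊆ s, y < ∏ q ∈ s', q ∧ ∏ q ∈ s', q ≤ y ^ 2 := by
  classical
  induction s using Finset.induction_on with
  | empty => simp at h; omega
  | insert q s hq ih =>
    by_cases h' : y < ∏ q ∈ s, q
    · obtain ⟨s', hs', h1⟩ := ih (fun r hr => hs r (Finset.mem_insert_of_mem hr)) h'
      exact ⟨s', hs'.trans (Finset.subset_insert _ _), h1⟩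
    · refine ⟨insert q s, subset_rfl, h, ?_⟩
      rw [Finset.prod_insert hq, sq]
      exact Nat.mul_le_mul (hs q (Finset.mem_insert_self _ _)).2 (not_lt.mp h')

lemma pow_prod_dvd (j : ℕ) (n : ℤ) (s : Finset ℕ) (hs : ∀ q ∈ s, q.Prime)
    (h : ∀ q ∈ s, ((q ^ j : ℕ) : ℤ) ∣ n) : (((∏ q ∈ s, q) ^ j : ℕ) : ℤ) ∣ n := by
  rw [Int.natCast_dvd, ← Finset.prod_pow]
  refine Finset.prod_dvd_of_isRelPrime ?_ fun q hq => Int.natCast_dvd.mp (h q hq)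
  intro q hq r hr hqr
  rw [Function.onFun, ← Nat.coprime_iff_isRelPrime]
  exact Nat.Coprime.pow _ _ ((Nat.coprime_primes (hs q hq) (hs r hr)).mpr hqr)

-- Let `r` be the product of the primes `q ≤ y` with `q ^ j ∣ n`. If `r ≤ y`, the squarefree `d` in
-- the truncated sum are exactly the divisors of `r`, and Möbius inversion is exact. If `r > y`,
-- some subproduct of `r` lies in `(y, y²]`, so the right side is at least `y + 1` and dominates the
-- trivial bound. Truncating at `y` thus costs only moduli up to `y²`.
open Classical in
lemma abs_indicator_sub_sum_moebius_le (j : ℕ) (n : ℤ) (y : ℕ) (hy : 1 ≤ y) :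
    |(if ∀ q : ℕ, q.Prime → q ≤ y → ¬ ((q ^ j : ℕ) : ℤ) ∣ n then (1 : ℤ) else 0) -
      ∑ d ∈ (Finset.Icc 1 y).filter (fun d : ℕ => ((d ^ j : ℕ) : ℤ) ∣ n), moebius d| ≤
    (y + 1) * ((Finset.Ioc y (y ^ 2)).filter
      fun d : ℕ => Squarefree d ∧ ((d ^ j : ℕ) : ℤ) ∣ n).card := by
  set Z := (Finset.Icc 1 y).filter fun q : ℕ => q.Prime ∧ ((q ^ j : ℕ) : ℤ) ∣ n with hZ
  set T := (Finset.Icc 1 y).filter fun d : ℕ => ((d ^ j : ℕ) : ℤ) ∣ n with hT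
  have hZp : ∀ q ∈ Z, q.Prime := fun q hq => (Finset.mem_filter.mp hq).2.1
  have hZd : ∀ q ∈ Z, ((q ^ j : ℕ) : ℤ) ∣ n := fun q hq => (Finset.mem_filter.mp hq).2.2
  have hZy : ∀ q ∈ Z, 1 ≤ q ∧ q ≤ y := fun q hq =>
    Finset.mem_Icc.mp (Finset.mem_filter.mp hq).1
  set r := ∏ q ∈ Z, q with hr
  have hrpos : r ≠ 0 := Finset.prod_ne_zero_iff.mpr fun q hq => (hZp q hq).ne_zero
  have hrd : ((r ^ j : ℕ) : ℤ) ∣ n := pow_prod_dvd j n Z hZp hZd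
  have hsqf : ∀ s ⊆ Z, Squarefree (∏ q ∈ s, q) := fun s hs => by
    refine Finset.squarefree_prod_of_pairwise_isCoprime ?_
      fun q hq => (hZp q (hs hq)).prime.squarefree
    · intro q hq q' hq' hne
      rw [Function.onFun, ← Nat.coprime_iff_isRelPrime]
      exact (Nat.coprime_primes (hZp q (hs hq)) (hZp q' (hs hq'))).mpr hne
  have hcond : (∀ q : ℕ, q.Prime → q ≤ y → ¬ ((q ^ j : ℕ) : ℤ) ∣ n) ↔ r = 1 := by
    constructor
    · intro h
      have : Z = ∅ := Finset.filter_eq_empty_iff.mpr fun q hq hq' =>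
        h q hq'.1 (Finset.mem_Icc.mp hq).2 hq'.2
      rw [hr, this, Finset.prod_empty]
    · intro h q hq hqy hd
      have hqZ : q ∈ Z := Finset.mem_filter.mpr ⟨Finset.mem_Icc.mpr ⟨hq.one_lt.le, hqy⟩, hq, hd⟩
      have := Finset.dvd_prod_of_mem (fun q => q) hqZ
      rw [← hr, h] at this
      exact hq.one_lt.ne' (Nat.dvd_one.mp this)
  rw [if_congr hcond rfl rfl]
  rcases le_or_gt r y with hry | hry
  · have hsum : ∑ d ∈ T, moebius d = ∑ d ∈ r.divisors, moebius d := by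
      symm
      refine Finset.sum_subset ?_ ?_
      · intro d hd
        have hdr := Nat.dvd_of_mem_divisors hd
        refine Finset.mem_filter.mpr ⟨Finset.mem_Icc.mpr ⟨Nat.pos_of_mem_divisors hd,
          (Nat.le_of_dvd (Nat.pos_of_ne_zero hrpos) hdr).trans hry⟩, ?_⟩
        exact dvd_trans (by exact_mod_cast pow_dvd_pow_of_dvd hdr j) hrd
      · intro d hd hdr
        refine moebius_eq_zero_of_not_squarefree fun hsq => hdr ?_
        obtain ⟨hd1, hd2⟩ := Finset.mem_filter.mp hd
        obtain ⟨hd0, hdy⟩ := Finset.mem_Icc.mp hd1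
        rw [Nat.mem_divisors]
        refine ⟨?_, hrpos⟩
        rw [← Nat.prod_primeFactors_of_squarefree hsq]
        refine Finset.prod_dvd_prod_of_subset _ _ _ fun q hq => ?_
        have hqp := Nat.prime_of_mem_primeFactors hq
        have hqd := Nat.dvd_of_mem_primeFactors hq
        refine Finset.mem_filter.mpr ⟨Finset.mem_Icc.mpr ⟨hqp.one_lt.le,
          (Nat.le_of_dvd hd0 hqd).trans hdy⟩, hqp, ?_⟩
        exact dvd_trans (by exact_mod_cast pow_dvd_pow_of_dvd hqd j) hd2
    have h0 : (if r = 1 then (1 : ℤ) else 0) - ∑ d ∈ T, moebius d = 0 := by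
      rw [hsum]
      split_ifs with h
      · rw [h]; simp
      · rw [sum_divisors_moebius h]; simp
    rw [h0, abs_zero]
    positivity
  · obtain ⟨s', hs', h1, h2⟩ := exists_subset_prod_mem_Ioc y Z hZy hry hy
    have hmem : (∏ q ∈ s', q) ∈ (Finset.Ioc y (y ^ 2)).filter
        fun d : ℕ => Squarefree d ∧ ((d ^ j : ℕ) : ℤ) ∣ n :=
      Finset.mem_filter.mpr ⟨Finset.mem_Ioc.mpr ⟨h1, h2⟩, hsqf s' hs',
        pow_prod_dvd j n s' (fun q hq => hZp q (hs' hq)) fun q hq => hZd q (hs' hq)⟩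
    have hc : 1 ≤ ((Finset.Ioc y (y ^ 2)).filter
      fun d : ℕ => Squarefree d ∧ ((d ^ j : ℕ) : ℤ) ∣ n).card := Finset.card_pos.mpr ⟨_, hmem⟩
    have hsum : |∑ d ∈ T, moebius d| ≤ y := by
      calc |∑ d ∈ T, moebius d| ≤ ∑ d ∈ T, |moebius d| := Finset.abs_sum_le_sum_abs _ _
        _ ≤ ∑ d ∈ T, 1 := Finset.sum_le_sum fun d _ => abs_moebius_le_one
        _ ≤ y := by
          have : T.card ≤ y := (Finset.card_filter_le _ _).trans (by simp)
          simpa using this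
    have hr1 : r ≠ 1 := by omega
    rw [if_neg hr1, zero_sub, abs_neg]
    have hc' : (1 : ℤ) ≤ ((Finset.Ioc y (y ^ 2)).filter
      fun d : ℕ => Squarefree d ∧ ((d ^ j : ℕ) : ℤ) ∣ n).card := by exact_mod_cast hc
    nlinarith

end Truncation

/-! ### The sieve for power-free values -/

section Sieve

open ArithmeticFunction

variable (D : ℤ[X]) (j : ℕ)

/-- `μ(d) ν(d^j) / d^j`. -/
def sieveCoeff (d : ℕ) : ℝ := (moebius d : ℝ) * nu D (d ^ j) / (d : ℝ) ^ j

/-- The density of the `j`-th power free values of `D`, without the conditions at the primes that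
divide `P`. -/
def sieveDensity (P : ℕ) : ℝ := ∑' d : ℕ, if P.Coprime d then sieveCoeff D j d else 0

/-- The sum of `d ^ (-5/4)`. -/
def zetaFiveFourths : ℝ := ∑' d : ℕ, (d : ℝ) ^ (-(5 / 4) : ℝ)

lemma summable_rpow_five_fourths : Summable fun d : ℕ => (d : ℝ) ^ (-(5 / 4) : ℝ) :=
  Real.summable_nat_rpow.mpr (by norm_num)

lemma zetaFiveFourths_nonneg : 0 ≤ zetaFiveFourths :=
  tsum_nonneg fun d => Real.rpow_nonneg (Nat.cast_nonneg d) _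

/-- The exponent is split in half: one factor gives the saving in `y`, the other a convergent
series. -/
lemma rpow_five_halves_le {y d : ℕ} (hy : 1 ≤ y) (hd : y ≤ d) :
    (d : ℝ) ^ (-(5 / 2) : ℝ) ≤ (y : ℝ) ^ (-(5 / 4) : ℝ) * (d : ℝ) ^ (-(5 / 4) : ℝ) := by
  have hd0 : (0 : ℝ) < d := by exact_mod_cast (by omega : 0 < d)
  have hy0 : (0 : ℝ) < y := by exact_mod_cast hy
  have : (d : ℝ) ^ (-(5 / 2) : ℝ) = (d : ℝ) ^ (-(5 / 4) : ℝ) * (d : ℝ) ^ (-(5 / 4) : ℝ) := by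
    rw [← Real.rpow_add hd0]; norm_num
  rw [this]
  refine mul_le_mul_of_nonneg_right ?_ (Real.rpow_nonneg hd0.le _)
  exact Real.rpow_le_rpow_of_nonpos hy0 (by exact_mod_cast hd) (by norm_num)

lemma sum_rpow_five_halves_le {y : ℕ} (hy : 1 ≤ y) (s : Finset ℕ) (hs : ∀ d ∈ s, y ≤ d) :
    ∑ d ∈ s, (d : ℝ) ^ (-(5 / 2) : ℝ) ≤ (y : ℝ) ^ (-(5 / 4) : ℝ) * zetaFiveFourths := by
  calc ∑ d ∈ s, (d : ℝ) ^ (-(5 / 2) : ℝ)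
      ≤ ∑ d ∈ s, (y : ℝ) ^ (-(5 / 4) : ℝ) * (d : ℝ) ^ (-(5 / 4) : ℝ) :=
        Finset.sum_le_sum fun d hd => rpow_five_halves_le hy (hs d hd)
    _ = (y : ℝ) ^ (-(5 / 4) : ℝ) * ∑ d ∈ s, (d : ℝ) ^ (-(5 / 4) : ℝ) := (Finset.mul_sum _ _ _).symm
    _ ≤ _ := by
        refine mul_le_mul_of_nonneg_left ?_ (Real.rpow_nonneg (Nat.cast_nonneg _) _)
        exact summable_rpow_five_fourths.sum_le_tsum s fun d _ =>
          Real.rpow_nonneg (Nat.cast_nonneg d) _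

lemma inv_pow_le_rpow {j : ℕ} (hj : 3 ≤ j) {d : ℕ} (hd : 1 ≤ d) :
    √(d : ℝ) / (d : ℝ) ^ j ≤ (d : ℝ) ^ (-(5 / 2) : ℝ) := by
  have hd0 : (0 : ℝ) < d := by exact_mod_cast hd
  have hd1 : (1 : ℝ) ≤ d := by exact_mod_cast hd
  rw [Real.sqrt_eq_rpow, ← Real.rpow_natCast, ← Real.rpow_sub hd0]
  refine Real.rpow_le_rpow_of_exponent_le hd1 ?_
  have : (3 : ℝ) ≤ j := by exact_mod_cast hj
  linarith

variable {D j}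

lemma abs_moebius_mul_nu_le {K : ℝ} (hK0 : 0 ≤ K)
    (hK : ∀ d : ℕ, Squarefree d → (nu D (d ^ j) : ℝ) ≤ K * √(d : ℝ)) (d : ℕ) :
    |(moebius d : ℝ)| * nu D (d ^ j) ≤ K * √(d : ℝ) := by
  by_cases hd : Squarefree d
  · have h1 : |(moebius d : ℝ)| ≤ 1 := by exact_mod_cast abs_moebius_le_one (n := d)
    have h2 := hK d hd
    nlinarith [Nat.cast_nonneg (α := ℝ) (nu D (d ^ j))]
  · rw [moebius_eq_zero_of_not_squarefree hd]
    simp only [Int.cast_zero, abs_zero, zero_mul]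
    positivity

lemma abs_sieveCoeff_le (hj : 3 ≤ j) {K : ℝ} (hK0 : 0 ≤ K)
    (hK : ∀ d : ℕ, Squarefree d → (nu D (d ^ j) : ℝ) ≤ K * √(d : ℝ)) (d : ℕ) :
    |sieveCoeff D j d| ≤ K * (d : ℝ) ^ (-(5 / 2) : ℝ) := by
  rcases Nat.eq_zero_or_pos d with rfl | hd
  · simp only [sieveCoeff, ArithmeticFunction.map_zero, Int.cast_zero, zero_mul, zero_div, abs_zero,
      Nat.cast_zero]
    positivity
  · rw [sieveCoeff, abs_div, abs_mul, Nat.abs_cast, abs_of_nonneg (a := (d : ℝ) ^ j) (by positivity)]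
    calc _ ≤ K * √(d : ℝ) / (d : ℝ) ^ j :=
          div_le_div_of_nonneg_right (abs_moebius_mul_nu_le hK0 hK d) (by positivity)
      _ = K * (√(d : ℝ) / (d : ℝ) ^ j) := mul_div_assoc _ _ _
      _ ≤ _ := mul_le_mul_of_nonneg_left (inv_pow_le_rpow hj hd) hK0

lemma summable_abs_sieveCoeff (hj : 3 ≤ j) {K : ℝ} (hK0 : 0 ≤ K)
    (hK : ∀ d : ℕ, Squarefree d → (nu D (d ^ j) : ℝ) ≤ K * √(d : ℝ)) :
    Summable fun d => |sieveCoeff D j d| :=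
  Summable.of_nonneg_of_le (fun _ => abs_nonneg _) (abs_sieveCoeff_le hj hK0 hK)
    ((Real.summable_nat_rpow.mpr (by norm_num)).mul_left K)

lemma summable_sieveCoeff_coprime (hj : 3 ≤ j) {K : ℝ} (hK0 : 0 ≤ K)
    (hK : ∀ d : ℕ, Squarefree d → (nu D (d ^ j) : ℝ) ≤ K * √(d : ℝ)) (P : ℕ) :
    Summable fun d => if P.Coprime d then sieveCoeff D j d else 0 := by
  refine Summable.of_norm_bounded (summable_abs_sieveCoeff hj hK0 hK) fun d => ?_
  split_ifs <;> simp

lemma abs_sieveDensity_sub_sum_le (hj : 3 ≤ j) {K : ℝ} (hK0 : 0 ≤ K)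
    (hK : ∀ d : ℕ, Squarefree d → (nu D (d ^ j) : ℝ) ≤ K * √(d : ℝ)) (P : ℕ) {y : ℕ}
    (hy : 1 ≤ y) :
    |sieveDensity D j P - ∑ d ∈ Finset.Icc 1 y, if P.Coprime d then sieveCoeff D j d else 0| ≤
      K * ((y : ℝ) ^ (-(5 / 4) : ℝ) * zetaFiveFourths) := by
  set f : ℕ → ℝ := fun d => if P.Coprime d then sieveCoeff D j d else 0 with hf
  have hs := summable_sieveCoeff_coprime hj hK0 hK P
  have h1 := hs.sum_add_tsum_subtype_compl (Finset.Icc 1 y)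
  rw [sieveDensity, ← h1, add_sub_cancel_left]
  have hfb : ∀ d, ‖f d‖ ≤ |sieveCoeff D j d| := fun d => by
    simp only [hf]; split_ifs <;> simp
  have hbound : ∀ d : {x // x ∉ Finset.Icc 1 y}, ‖f d‖ ≤
      K * ((y : ℝ) ^ (-(5 / 4) : ℝ) * (d : ℝ) ^ (-(5 / 4) : ℝ)) := by
    rintro ⟨d, hd⟩
    rw [Finset.mem_Icc, not_and_or] at hd
    rcases Nat.eq_zero_or_pos d with rfl | hd0
    · refine (hfb 0).trans ?_
      simp [sieveCoeff]
    · refine (hfb d).trans ((abs_sieveCoeff_le hj hK0 hK d).trans ?_)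
      exact mul_le_mul_of_nonneg_left (rpow_five_halves_le hy (by omega)) hK0
  have hsum : Summable fun d : {x // x ∉ Finset.Icc 1 y} =>
      K * ((y : ℝ) ^ (-(5 / 4) : ℝ) * (d : ℝ) ^ (-(5 / 4) : ℝ)) :=
    (((summable_rpow_five_fourths.subtype _).mul_left _).mul_left _)
  rw [← Real.norm_eq_abs]
  refine (tsum_of_norm_bounded hsum.hasSum hbound).trans ?_
  rw [tsum_mul_left, tsum_mul_left]
  refine mul_le_mul_of_nonneg_left (mul_le_mul_of_nonneg_left ?_ (by positivity)) hK0
  exact Summable.tsum_subtype_le (fun d : ℕ => (d : ℝ) ^ (-(5 / 4) : ℝ)) {x | x ∉ Finset.Icc 1 y}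
    (fun d => Real.rpow_nonneg (Nat.cast_nonneg d) _) summable_rpow_five_fourths

lemma card_classRoots_le (N n : ℕ) (hn : 0 < n) (P : ℕ) (a : ℤ) :
    ((classRoots D N P a n).card : ℝ) ≤ nu D n * (N / n + 2) := by
  have h1 : classRoots D N P a n ⊆ classRoots D N 1 0 n := by
    intro t ht
    simp only [classRoots, Finset.mem_filter] at ht ⊢
    exact ⟨⟨ht.1.1, by simp [Int.modEq_one]⟩, ht.2⟩
  have h2 : ((classRoots D N P a n).card : ℝ) ≤ (classRoots D N 1 0 n).card := by
    exact_mod_cast Finset.card_le_card h1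
  have h3 := abs_le.mp (abs_card_classRoots_sub_le D N 1 0 n one_pos hn (Nat.coprime_one_left n))
  have h4 : (N : ℝ) * nu D n / (((1 : ℕ) : ℝ) * n) = nu D n * (N / n) := by
    rw [Nat.cast_one, one_mul]; ring
  rw [h4] at h3
  linarith [h3.2]

open Classical in
/-- The `t ∈ [N, 2N]` congruent to `a` modulo `P` with `D(t)` not divisible by `q ^ j` for any
prime `q ≤ y`. -/
def sifted (D : ℤ[X]) (j N P : ℕ) (a : ℤ) (y : ℕ) : Finset ℤ :=
  ((Finset.Icc (N : ℤ) (2 * N)).filter fun t => t ≡ a [ZMOD P]).filter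
    fun t => ∀ q : ℕ, q.Prime → q ≤ y → ¬ ((q ^ j : ℕ) : ℤ) ∣ D.eval t

lemma abs_card_sifted_sub_sum_le (N P : ℕ) (a : ℤ) {y : ℕ} (hy : 1 ≤ y) :
    |((sifted D j N P a y).card : ℝ) -
      ∑ d ∈ Finset.Icc 1 y, (moebius d : ℝ) * (classRoots D N P a (d ^ j)).card| ≤
    (y + 1) * ∑ d ∈ (Finset.Ioc y (y ^ 2)).filter Squarefree,
      ((classRoots D N P a (d ^ j)).card : ℝ) := by
  classical
  set I := (Finset.Icc (N : ℤ) (2 * N)).filter fun t => t ≡ a [ZMOD P] with hI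
  have e1 : ((sifted D j N P a y).card : ℤ) = ∑ t ∈ I,
      if ∀ q : ℕ, q.Prime → q ≤ y → ¬ ((q ^ j : ℕ) : ℤ) ∣ D.eval t then (1 : ℤ) else 0 := by
    rw [sifted, Finset.card_filter]
    push_cast
    rfl
  have e2 : ∑ d ∈ Finset.Icc 1 y, (moebius d : ℤ) * (classRoots D N P a (d ^ j)).card =
      ∑ t ∈ I, ∑ d ∈ (Finset.Icc 1 y).filter (fun d : ℕ => ((d ^ j : ℕ) : ℤ) ∣ D.eval t),
        moebius d := by
    simp_rw [Finset.sum_filter]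
    rw [Finset.sum_comm]
    refine Finset.sum_congr rfl fun d _ => ?_
    rw [classRoots, ← hI, Finset.card_filter]
    push_cast
    rw [Finset.mul_sum]
    refine Finset.sum_congr rfl fun t _ => ?_
    split_ifs <;> simp
  have e3 : ∑ d ∈ (Finset.Ioc y (y ^ 2)).filter Squarefree,
      ((classRoots D N P a (d ^ j)).card : ℤ) = ∑ t ∈ I, (((Finset.Ioc y (y ^ 2)).filter
      fun d : ℕ => Squarefree d ∧ ((d ^ j : ℕ) : ℤ) ∣ D.eval t).card : ℤ) := by
    have : ∀ t, (((Finset.Ioc y (y ^ 2)).filter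
        fun d : ℕ => Squarefree d ∧ ((d ^ j : ℕ) : ℤ) ∣ D.eval t).card : ℤ) =
        ∑ d ∈ (Finset.Ioc y (y ^ 2)).filter Squarefree,
          if ((d ^ j : ℕ) : ℤ) ∣ D.eval t then (1 : ℤ) else 0 := fun t => by
      rw [← Finset.filter_filter, Finset.card_filter]
      push_cast
      rfl
    simp_rw [this]
    rw [Finset.sum_comm]
    refine Finset.sum_congr rfl fun d _ => ?_
    rw [classRoots, ← hI, Finset.card_filter]
    push_cast
    rfl
  have key : |((sifted D j N P a y).card : ℤ) -
      ∑ d ∈ Finset.Icc 1 y, (moebius d : ℤ) * (classRoots D N P a (d ^ j)).card| ≤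
      (y + 1) * ∑ d ∈ (Finset.Ioc y (y ^ 2)).filter Squarefree,
        ((classRoots D N P a (d ^ j)).card : ℤ) := by
    rw [e1, e2, e3, ← Finset.sum_sub_distrib, Finset.mul_sum]
    refine (Finset.abs_sum_le_sum_abs _ _).trans (Finset.sum_le_sum fun t _ => ?_)
    convert abs_indicator_sub_sum_moebius_le j (D.eval t) y hy using 3
  exact_mod_cast key

lemma sqrt_le_of_le_sq {d y : ℕ} (h : d ≤ y ^ 2) : √(d : ℝ) ≤ y := by
  rw [Real.sqrt_le_left (Nat.cast_nonneg y)]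
  exact_mod_cast h

/-- For `d` in `(y, y²]` the expected count is at most `K N d ^ (-5/2)`, because `j ≥ 3` and the
number of roots is `O(√d)`. The rounding errors are `O(y)` for each of at most `y²` moduli. -/
lemma sum_card_classRoots_le (hj : 3 ≤ j) {K : ℝ} (hK0 : 0 ≤ K)
    (hK : ∀ d : ℕ, Squarefree d → (nu D (d ^ j) : ℝ) ≤ K * √(d : ℝ)) (N P : ℕ) (a : ℤ) {y : ℕ}
    (hy : 1 ≤ y) :
    ∑ d ∈ (Finset.Ioc y (y ^ 2)).filter Squarefree, ((classRoots D N P a (d ^ j)).card : ℝ) ≤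
      K * N * ((y : ℝ) ^ (-(5 / 4) : ℝ) * zetaFiveFourths) + 2 * K * (y : ℝ) ^ 3 := by
  set s := (Finset.Ioc y (y ^ 2)).filter Squarefree with hs
  have hmem : ∀ d ∈ s, y < d ∧ d ≤ y ^ 2 ∧ Squarefree d := fun d hd => by
    obtain ⟨h1, h2⟩ := Finset.mem_filter.mp hd
    exact ⟨(Finset.mem_Ioc.mp h1).1, (Finset.mem_Ioc.mp h1).2, h2⟩
  have hterm : ∀ d ∈ s, ((classRoots D N P a (d ^ j)).card : ℝ) ≤
      K * N * (d : ℝ) ^ (-(5 / 2) : ℝ) + 2 * K * y := by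
    intro d hd
    obtain ⟨h1, h2, h3⟩ := hmem d hd
    have hd1 : 1 ≤ d := by omega
    have hd0 : (0 : ℝ) < d := by exact_mod_cast hd1
    refine (card_classRoots_le N (d ^ j) (pow_pos hd1 j) P a).trans ?_
    have hν := hK d h3
    have hsq := sqrt_le_of_le_sq h2
    have h4 := inv_pow_le_rpow hj hd1
    calc (nu D (d ^ j) : ℝ) * (N / ((d ^ j : ℕ) : ℝ) + 2)
        ≤ (K * √(d : ℝ)) * (N / ((d ^ j : ℕ) : ℝ) + 2) :=
          mul_le_mul_of_nonneg_right hν (by positivity)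
      _ = K * N * (√(d : ℝ) / (d : ℝ) ^ j) + 2 * K * √(d : ℝ) := by push_cast; ring
      _ ≤ K * N * (d : ℝ) ^ (-(5 / 2) : ℝ) + 2 * K * y := by
          gcongr
  calc _ ≤ ∑ d ∈ s, (K * N * (d : ℝ) ^ (-(5 / 2) : ℝ) + 2 * K * y) := Finset.sum_le_sum hterm
    _ = K * N * ∑ d ∈ s, (d : ℝ) ^ (-(5 / 2) : ℝ) + s.card * (2 * K * y) := by
        rw [Finset.sum_add_distrib, ← Finset.mul_sum, Finset.sum_const, nsmul_eq_mul]
    _ ≤ K * N * ((y : ℝ) ^ (-(5 / 4) : ℝ) * zetaFiveFourths) + (y : ℝ) ^ 2 * (2 * K * y) := by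
        have hc : (s.card : ℝ) ≤ (y : ℝ) ^ 2 := by
          have : s.card ≤ y ^ 2 :=
            (Finset.card_filter_le _ _).trans (by rw [Nat.card_Ioc]; omega)
          exact_mod_cast this
        have hsum := sum_rpow_five_halves_le hy s fun d hd => (hmem d hd).1.le
        gcongr
    _ = _ := by ring

/-- If `d` shares a prime `q` with `P`, the class contains no `t` with `d ^ j ∣ D(t)`, as the
condition at `q` already excludes it. Only `d` coprime to `P` contribute, which is why the density
omits the primes of `P`. -/
lemma abs_sum_moebius_classRoots_sub_le {K : ℝ} (hK0 : 0 ≤ K)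
    (hK : ∀ d : ℕ, Squarefree d → (nu D (d ^ j) : ℝ) ≤ K * √(d : ℝ)) (N P : ℕ) (a : ℤ) (hP : 0 < P)
    (hPa : ∀ t : ℤ, t ≡ a [ZMOD P] → ∀ q : ℕ, q.Prime → q ∣ P → ¬ ((q ^ j : ℕ) : ℤ) ∣ D.eval t)
    (y : ℕ) :
    |∑ d ∈ Finset.Icc 1 y, (moebius d : ℝ) * (classRoots D N P a (d ^ j)).card -
      N / P * ∑ d ∈ Finset.Icc 1 y, if P.Coprime d then sieveCoeff D j d else 0| ≤
      2 * K * (y : ℝ) ^ 2 := by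
  rw [Finset.mul_sum, ← Finset.sum_sub_distrib]
  refine (Finset.abs_sum_le_sum_abs _ _).trans ?_
  have hP0 : (0 : ℝ) < P := by exact_mod_cast hP
  have hterm : ∀ d ∈ Finset.Icc 1 y, |(moebius d : ℝ) * (classRoots D N P a (d ^ j)).card -
      N / P * if P.Coprime d then sieveCoeff D j d else 0| ≤ 2 * K * y := by
    intro d hd
    obtain ⟨hd1, hdy⟩ := Finset.mem_Icc.mp hd
    have hd0 : (0 : ℝ) < d := by exact_mod_cast hd1
    split_ifs with hc
    · have h1 := abs_card_classRoots_sub_le D N P a (d ^ j) hP (pow_pos hd1 j)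
        (Nat.Coprime.pow_right j hc)
      have h2 : (moebius d : ℝ) * (classRoots D N P a (d ^ j)).card - N / P * sieveCoeff D j d =
          (moebius d : ℝ) * ((classRoots D N P a (d ^ j)).card -
            N * nu D (d ^ j) / (P * ((d ^ j : ℕ) : ℝ))) := by
        rw [sieveCoeff]; push_cast; field_simp
      rw [h2, abs_mul]
      calc |(moebius d : ℝ)| * _ ≤ |(moebius d : ℝ)| * (2 * nu D (d ^ j)) :=
            mul_le_mul_of_nonneg_left h1 (abs_nonneg _)
        _ = 2 * (|(moebius d : ℝ)| * nu D (d ^ j)) := by ring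
        _ ≤ 2 * (K * √(d : ℝ)) :=
            mul_le_mul_of_nonneg_left (abs_moebius_mul_nu_le hK0 hK d) (by norm_num)
        _ ≤ 2 * (K * y) := by
            have : √(d : ℝ) ≤ y := sqrt_le_of_le_sq (by nlinarith)
            gcongr
        _ = 2 * K * y := by ring
    · have hempty : classRoots D N P a (d ^ j) = ∅ := by
        rw [Finset.eq_empty_iff_forall_notMem]
        intro t ht
        simp only [classRoots, Finset.mem_filter] at ht
        obtain ⟨q, hq, hqP, hqd⟩ := Nat.Prime.not_coprime_iff_dvd.mp hc
        refine hPa t ht.1.2 q hq hqP (dvd_trans ?_ ht.2)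
        exact_mod_cast pow_dvd_pow_of_dvd hqd j
      rw [hempty]
      simp only [Finset.card_empty, Nat.cast_zero, mul_zero, sub_zero, abs_zero]
      positivity
  calc _ ≤ ∑ d ∈ Finset.Icc 1 y, 2 * K * (y : ℝ) := Finset.sum_le_sum hterm
    _ = 2 * K * (y : ℝ) ^ 2 := by
      rw [Finset.sum_const, Nat.card_Icc, Nat.add_sub_cancel, nsmul_eq_mul]
      ring

/-- The factor `y + 1` from the truncated Möbius formula turns the tail `N y ^ (-5/4)` into `N y ^
(-1/4)` and the rounding term `y³` into `y⁴`. -/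
lemma abs_card_sifted_sub_le (hj : 3 ≤ j) {K : ℝ} (hK0 : 0 ≤ K)
    (hK : ∀ d : ℕ, Squarefree d → (nu D (d ^ j) : ℝ) ≤ K * √(d : ℝ)) (N P : ℕ) (a : ℤ) (hP : 0 < P)
    (hPa : ∀ t : ℤ, t ≡ a [ZMOD P] → ∀ q : ℕ, q.Prime → q ∣ P → ¬ ((q ^ j : ℕ) : ℤ) ∣ D.eval t)
    {y : ℕ} (hy : 1 ≤ y) :
    |((sifted D j N P a y).card : ℝ) - N / P * sieveDensity D j P| ≤
      (3 * K * zetaFiveFourths + 6 * K) * (N * (y : ℝ) ^ (-(1 / 4) : ℝ) + (y : ℝ) ^ 4) := by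
  have h1 := abs_card_sifted_sub_sum_le (D := D) (j := j) N P a hy
  have h2 := sum_card_classRoots_le hj hK0 hK N P a hy
  have h3 := abs_sum_moebius_classRoots_sub_le hK0 hK N P a hP hPa y
  have h4 := abs_sieveDensity_sub_sum_le hj hK0 hK P hy
  set S1 := ∑ d ∈ Finset.Icc 1 y, (moebius d : ℝ) * (classRoots D N P a (d ^ j)).card
  set S2 := ∑ d ∈ Finset.Icc 1 y, if P.Coprime d then sieveCoeff D j d else 0
  set S3 := ∑ d ∈ (Finset.Ioc y (y ^ 2)).filter Squarefree,
    ((classRoots D N P a (d ^ j)).card : ℝ)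
  have hy1 : (1 : ℝ) ≤ y := by exact_mod_cast hy
  have hy0 : (0 : ℝ) < y := by linarith
  have hP1 : (1 : ℝ) ≤ P := by exact_mod_cast hP
  have hζ := zetaFiveFourths_nonneg
  set ζ := zetaFiveFourths
  set e := (y : ℝ) ^ (-(5 / 4) : ℝ) with he
  set e' := (y : ℝ) ^ (-(1 / 4) : ℝ) with he'
  have he0 : 0 ≤ e := Real.rpow_nonneg hy0.le _
  have hee : (y : ℝ) * e = e' := by
    rw [he, he', ← Real.rpow_one_add' hy0.le (by norm_num)]; norm_num
  have hN0 : (0 : ℝ) ≤ N := Nat.cast_nonneg N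
  have hNP0 : (0 : ℝ) ≤ N / P := by positivity
  have hNP : (N : ℝ) / P ≤ N := div_le_self hN0 hP1
  have hle : e ≤ e' := by rw [← hee]; nlinarith
  have h4' : |(N : ℝ) / P * sieveDensity D j P - N / P * S2| ≤ N * (K * (e * ζ)) := by
    rw [← mul_sub, abs_mul, abs_of_nonneg hNP0]
    exact mul_le_mul hNP h4 (abs_nonneg _) hN0
  have h1' : |((sifted D j N P a y).card : ℝ) - S1| ≤
      2 * y * (K * N * (e * ζ) + 2 * K * (y : ℝ) ^ 3) := by
    refine h1.trans ?_
    have : (y : ℝ) + 1 ≤ 2 * y := by linarith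
    have hb : 0 ≤ K * N * (e * ζ) + 2 * K * (y : ℝ) ^ 3 := by positivity
    calc ((y : ℝ) + 1) * S3 ≤ (y + 1) * (K * N * (e * ζ) + 2 * K * (y : ℝ) ^ 3) :=
          mul_le_mul_of_nonneg_left h2 (by positivity)
      _ ≤ _ := mul_le_mul_of_nonneg_right this hb
  have htri : |((sifted D j N P a y).card : ℝ) - N / P * sieveDensity D j P| ≤
      2 * y * (K * N * (e * ζ) + 2 * K * (y : ℝ) ^ 3) + 2 * K * (y : ℝ) ^ 2 +
        N * (K * (e * ζ)) := by
    rw [abs_le] at h1' h3 h4' ⊢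
    constructor <;> linarith [h1'.1, h1'.2, h3.1, h3.2, h4'.1, h4'.2]
  refine htri.trans ?_
  have hy24 : (y : ℝ) ^ 2 ≤ (y : ℝ) ^ 4 := pow_le_pow_right₀ hy1 (by norm_num)
  have e1 : 2 * (y : ℝ) * (K * N * (e * ζ) + 2 * K * (y : ℝ) ^ 3) =
      2 * K * N * ζ * e' + 4 * K * (y : ℝ) ^ 4 := by rw [← hee]; ring
  rw [e1]
  have e2 : (N : ℝ) * (K * (e * ζ)) ≤ K * N * ζ * e' := by
    calc (N : ℝ) * (K * (e * ζ)) = K * N * ζ * e := by ring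
      _ ≤ K * N * ζ * e' := mul_le_mul_of_nonneg_left hle (by positivity)
  have e3 : 2 * K * (y : ℝ) ^ 2 ≤ 2 * K * (y : ℝ) ^ 4 :=
    mul_le_mul_of_nonneg_left hy24 (by positivity)
  have e'0 : 0 ≤ e' := he0.trans hle
  have e4 : 0 ≤ 3 * K * ζ * (y : ℝ) ^ 4 := by positivity
  have e5 : 0 ≤ 6 * K * (N * e') := by positivity
  nlinarith

-- Primes above `y` are treated by a union bound: at most `m` roots for each, a convergent tail for
-- the expected counts, and `O(1)` rounding for each prime up to `Y`.
open Classical in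
lemma card_large_prime_le (hj : 3 ≤ j) {m Q : ℕ}
    (hQ : ∀ q : ℕ, q.Prime → Q ≤ q → nu D (q ^ j) ≤ m) (N y Y : ℕ) (hy : 1 ≤ y) (hQy : Q ≤ y)
    (hY : ∀ t ∈ Finset.Icc (N : ℤ) (2 * N), ∀ q : ℕ, q.Prime → ((q ^ j : ℕ) : ℤ) ∣ D.eval t →
      q ≤ Y) :
    (((Finset.Icc (N : ℤ) (2 * N)).filter
      fun t => ∃ q : ℕ, q.Prime ∧ y < q ∧ ((q ^ j : ℕ) : ℤ) ∣ D.eval t).card : ℝ) ≤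
      m * (N * ((y : ℝ) ^ (-(5 / 4) : ℝ) * zetaFiveFourths) + 2 * Y) := by
  set s := (Finset.Ioc y Y).filter Nat.Prime with hs
  have hmem : ∀ q ∈ s, y < q ∧ q ≤ Y ∧ q.Prime := fun q hq => by
    obtain ⟨h1, h2⟩ := Finset.mem_filter.mp hq
    exact ⟨(Finset.mem_Ioc.mp h1).1, (Finset.mem_Ioc.mp h1).2, h2⟩
  have hsub : ((Finset.Icc (N : ℤ) (2 * N)).filter
      fun t => ∃ q : ℕ, q.Prime ∧ y < q ∧ ((q ^ j : ℕ) : ℤ) ∣ D.eval t) ⊆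
      s.biUnion fun q => classRoots D N 1 0 (q ^ j) := by
    intro t ht
    obtain ⟨h1, q, hq, hyq, hd⟩ := Finset.mem_filter.mp ht
    refine Finset.mem_biUnion.mpr ⟨q, Finset.mem_filter.mpr
      ⟨Finset.mem_Ioc.mpr ⟨hyq, hY t h1 q hq hd⟩, hq⟩, ?_⟩
    simp only [classRoots, Finset.mem_filter]
    exact ⟨⟨h1, by simp [Int.modEq_one]⟩, hd⟩
  have hcard := (Finset.card_le_card hsub).trans Finset.card_biUnion_le
  have hterm : ∀ q ∈ s, ((classRoots D N 1 0 (q ^ j)).card : ℝ) ≤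
      m * (N * (q : ℝ) ^ (-(5 / 2) : ℝ) + 2) := by
    intro q hq
    obtain ⟨h1, h2, h3⟩ := hmem q hq
    have hq1 : 1 ≤ q := h3.one_lt.le
    have hq0 : (0 : ℝ) < q := by exact_mod_cast hq1
    refine (card_classRoots_le N (q ^ j) (pow_pos hq1 j) 1 0).trans ?_
    have hν : (nu D (q ^ j) : ℝ) ≤ m := by exact_mod_cast hQ q h3 (by omega)
    have h4 := inv_pow_le_rpow hj hq1
    have h5 : (1 : ℝ) ≤ √(q : ℝ) := Real.one_le_sqrt.mpr (by exact_mod_cast hq1)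
    have h6 : (N : ℝ) / ((q ^ j : ℕ) : ℝ) ≤ N * (q : ℝ) ^ (-(5 / 2) : ℝ) := by
      push_cast
      rw [div_eq_mul_inv]
      refine mul_le_mul_of_nonneg_left (le_trans ?_ h4) (Nat.cast_nonneg _)
      rw [inv_eq_one_div]
      exact div_le_div_of_nonneg_right h5 (by positivity)
    have h7 : (N : ℝ) / ((q ^ j : ℕ) : ℝ) + 2 ≤ N * (q : ℝ) ^ (-(5 / 2) : ℝ) + 2 := by linarith
    exact mul_le_mul hν h7 (by positivity) (Nat.cast_nonneg _)
  calc _ ≤ ((∑ q ∈ s, (classRoots D N 1 0 (q ^ j)).card : ℕ) : ℝ) := by exact_mod_cast hcard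
    _ = ∑ q ∈ s, ((classRoots D N 1 0 (q ^ j)).card : ℝ) := by push_cast; rfl
    _ ≤ ∑ q ∈ s, (m : ℝ) * (N * (q : ℝ) ^ (-(5 / 2) : ℝ) + 2) := Finset.sum_le_sum hterm
    _ = m * (N * ∑ q ∈ s, (q : ℝ) ^ (-(5 / 2) : ℝ) + 2 * s.card) := by
        rw [← Finset.mul_sum, Finset.sum_add_distrib, ← Finset.mul_sum, Finset.sum_const,
          nsmul_eq_mul, mul_comm (s.card : ℝ)]
    _ ≤ _ := by
        have hc : (s.card : ℝ) ≤ Y := by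
          have : s.card ≤ Y := (Finset.card_filter_le _ _).trans (by rw [Nat.card_Ioc]; omega)
          exact_mod_cast this
        have hsum := sum_rpow_five_halves_le hy s fun q hq => (hmem q hq).1.le
        gcongr

end Sieve

/-! ### The density of power-free values -/

section Density

open ArithmeticFunction

variable {D : ℤ[X]} {j : ℕ}

lemma sieveCoeff_one : sieveCoeff D j 1 = 1 := by
  simp [sieveCoeff, nu_one]

lemma sieveCoeff_prime_mul {p : ℕ} (hp : p.Prime) (e : ℕ) :
    sieveCoeff D j (p * e) =
      -((nu D (p ^ j) : ℝ) / (p : ℝ) ^ j) * if p.Coprime e then sieveCoeff D j e else 0 := by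
  have hp0 : (p : ℝ) ≠ 0 := by exact_mod_cast hp.ne_zero
  split_ifs with h
  · rw [sieveCoeff, sieveCoeff, isMultiplicative_moebius.map_mul_of_coprime h,
      moebius_apply_prime hp, mul_pow, nu_mul D (Nat.Coprime.pow _ _ h)]
    push_cast
    simp only [div_eq_mul_inv, mul_pow, mul_inv]
    ring
  · have : ¬ Squarefree (p * e) := fun hs => h (Nat.coprime_of_squarefree_mul hs)
    rw [sieveCoeff, moebius_eq_zero_of_not_squarefree this]
    simp

/-- One Euler factor is split off. The terms lost by requiring `p ∤ d` are those with `d = p * e`,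
and multiplicativity gives each as `-ν(p ^ j) / p ^ j` times the term of `e`, or zero when `p ∣ e`.
-/
lemma sieveDensity_eq_mul (hj : 3 ≤ j) {K : ℝ} (hK0 : 0 ≤ K)
    (hK : ∀ d : ℕ, Squarefree d → (nu D (d ^ j) : ℝ) ≤ K * √(d : ℝ)) {p : ℕ} (hp : p.Prime)
    (P : ℕ) (hP : P.Coprime p) :
    sieveDensity D j P = (1 - (nu D (p ^ j) : ℝ) / (p : ℝ) ^ j) * sieveDensity D j (P * p) := by
  have hs := summable_sieveCoeff_coprime hj hK0 hK P
  have hs' := summable_sieveCoeff_coprime hj hK0 hK (P * p)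
  set f : ℕ → ℝ := fun d => if P.Coprime d then sieveCoeff D j d else 0 with hf
  set f' : ℕ → ℝ := fun d => if (P * p).Coprime d then sieveCoeff D j d else 0 with hf'
  have hinj : Function.Injective fun e : ℕ => p * e := mul_right_injective₀ hp.ne_zero
  have hsub : Summable fun d => f d - f' d := hs.sub hs'
  have hsupp : Function.support (fun d => f d - f' d) ⊆ Set.range fun e : ℕ => p * e := by
    intro d hd
    by_contra hn
    have hpd : p.Coprime d := (Nat.Prime.coprime_iff_not_dvd hp).mpr fun ⟨e, he⟩ => hn ⟨e, he.symm⟩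
    refine hd ?_
    simp only [hf, hf', Nat.coprime_mul_iff_left]
    by_cases h : P.Coprime d
    · rw [if_pos h, if_pos ⟨h, hpd⟩, sub_self]
    · rw [if_neg h, if_neg fun h' => h h'.1, sub_self]
  have h1 : ∑' d, (f d - f' d) = ∑' e, (f (p * e) - f' (p * e)) := (hinj.tsum_eq hsupp).symm
  have h2 : ∀ e, f (p * e) - f' (p * e) = -((nu D (p ^ j) : ℝ) / (p : ℝ) ^ j) * f' e := by
    intro e
    have hf'0 : f' (p * e) = 0 := by
      simp only [hf']
      refine if_neg fun h => ?_
      have := Nat.Coprime.coprime_mul_left h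
      exact hp.one_lt.ne' ((Nat.coprime_self p).mp this.coprime_mul_right_right)
    rw [hf'0, sub_zero]
    simp only [hf, hf', Nat.coprime_mul_iff_left, Nat.coprime_mul_iff_right]
    by_cases hPe : P.Coprime e
    · rw [if_pos ⟨hP, hPe⟩, sieveCoeff_prime_mul hp e]
      by_cases hpe : p.Coprime e
      · rw [if_pos hpe, if_pos ⟨hPe, hpe⟩]
      · rw [if_neg hpe, if_neg fun h => hpe h.2]
    · rw [if_neg fun h => hPe h.2, if_neg fun h => hPe h.1, mul_zero]
  rw [hs.tsum_sub hs', tsum_congr h2, tsum_mul_left] at h1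
  change sieveDensity D j P - sieveDensity D j (P * p) = _ * sieveDensity D j (P * p) at h1
  linear_combination h1

/-- No infinite product is needed. Splitting off all primes up to `y` leaves positive factors times
a density whose terms `1 < d ≤ y` vanish; for large `y` its tail is below `1/2`, so it exceeds
`1/2`. -/
lemma sieveDensity_pos (hj : 3 ≤ j) {K : ℝ} (hK0 : 0 ≤ K)
    (hK : ∀ d : ℕ, Squarefree d → (nu D (d ^ j) : ℝ) ≤ K * √(d : ℝ))
    (hloc : ∀ p : ℕ, p.Prime → nu D (p ^ j) < p ^ j) : 0 < sieveDensity D j 1 := by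
  classical
  have hiter : ∀ s : Finset ℕ, (∀ q ∈ s, q.Prime) →
      ∃ c : ℝ, 0 < c ∧ sieveDensity D j 1 = c * sieveDensity D j (∏ q ∈ s, q) := by
    intro s
    induction s using Finset.induction_on with
    | empty => intro _; exact ⟨1, one_pos, by simp⟩
    | insert q s hq ih =>
      intro hs
      obtain ⟨c, hc, h⟩ := ih fun r hr => hs r (Finset.mem_insert_of_mem hr)
      have hqp := hs q (Finset.mem_insert_self _ _)
      have hcop : (∏ q ∈ s, q).Coprime q := Nat.Coprime.prod_left fun r hr =>
        (Nat.coprime_primes (hs r (Finset.mem_insert_of_mem hr)) hqp).mpr fun h => hq (h ▸ hr)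
      have hq0 : (0 : ℝ) < (q : ℝ) ^ j := pow_pos (by exact_mod_cast hqp.pos) _
      refine ⟨c * (1 - (nu D (q ^ j) : ℝ) / (q : ℝ) ^ j), mul_pos hc ?_, ?_⟩
      · rw [sub_pos, div_lt_one hq0]
        exact_mod_cast hloc q hqp
      · rw [h, sieveDensity_eq_mul hj hK0 hK hqp _ hcop, Finset.prod_insert hq, mul_comm q]
        ring
  have htend : Filter.Tendsto
      (fun y : ℕ => K * ((y : ℝ) ^ (-(5 / 4) : ℝ) * zetaFiveFourths)) Filter.atTop (nhds 0) := by
    have := ((tendsto_rpow_neg_atTop (by norm_num : (0 : ℝ) < 5 / 4)).comp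
      tendsto_natCast_atTop_atTop).mul_const zetaFiveFourths |>.const_mul K
    simpa using this
  obtain ⟨y, hy, hy1⟩ := ((htend.eventually (gt_mem_nhds (by norm_num : (0 : ℝ) < 1 / 2))).and
    (Filter.eventually_ge_atTop 1)).exists
  obtain ⟨c, hc, h⟩ := hiter ((Finset.Icc 1 y).filter Nat.Prime)
    fun q hq => (Finset.mem_filter.mp hq).2
  set P := ∏ q ∈ (Finset.Icc 1 y).filter Nat.Prime, q with hP
  have hsum : (∑ d ∈ Finset.Icc 1 y, if P.Coprime d then sieveCoeff D j d else 0) = 1 := by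
    rw [Finset.sum_eq_single 1]
    · simp [sieveCoeff_one]
    · intro d hd hd1
      refine if_neg fun hcop => ?_
      obtain ⟨hd0, hdy⟩ := Finset.mem_Icc.mp hd
      have hq := Nat.minFac_prime hd1
      have hqP : d.minFac ∣ P := Finset.dvd_prod_of_mem _ (Finset.mem_filter.mpr
        ⟨Finset.mem_Icc.mpr ⟨hq.one_lt.le, (Nat.minFac_le hd0).trans hdy⟩, hq⟩)
      exact Nat.Prime.not_coprime_iff_dvd.mpr ⟨_, hq, hqP, Nat.minFac_dvd d⟩ hcop
    · intro h1
      exact absurd (Finset.mem_Icc.mpr ⟨le_rfl, hy1⟩) h1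
  have habs := abs_sieveDensity_sub_sum_le hj hK0 hK P hy1
  rw [hsum] at habs
  rw [h]
  refine mul_pos hc ?_
  have := (abs_le.mp habs).1
  linarith

lemma abs_sieveDensity_le (hj : 3 ≤ j) {K : ℝ} (hK0 : 0 ≤ K)
    (hK : ∀ d : ℕ, Squarefree d → (nu D (d ^ j) : ℝ) ≤ K * √(d : ℝ)) (P : ℕ) :
    |sieveDensity D j P| ≤ ∑' d, |sieveCoeff D j d| := by
  rw [← Real.norm_eq_abs]
  refine tsum_of_norm_bounded (summable_abs_sieveCoeff hj hK0 hK).hasSum fun d => ?_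
  split_ifs <;> simp

end Density

/-! ### Values of polynomials -/

lemma exists_abs_eval_le (f : ℤ[X]) : ∃ C : ℝ, 1 ≤ C ∧ ∀ N : ℕ, 1 ≤ N →
    ∀ t ∈ Finset.Icc (N : ℤ) (2 * N), |((f.eval t : ℤ) : ℝ)| ≤ C * (N : ℝ) ^ f.natDegree := by
  refine ⟨1 + ∑ i ∈ Finset.range (f.natDegree + 1), |(f.coeff i : ℝ)| * 2 ^ i,
    le_add_of_nonneg_right (Finset.sum_nonneg fun i _ => by positivity), fun N hN t ht => ?_⟩
  obtain ⟨h1, h2⟩ := Finset.mem_Icc.mp ht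
  have hN1 : (1 : ℝ) ≤ N := by exact_mod_cast hN
  have ht0 : (0 : ℝ) ≤ t := by exact_mod_cast (by omega : (0 : ℤ) ≤ t)
  have ht2 : (t : ℝ) ≤ 2 * N := by exact_mod_cast h2
  rw [eval_eq_sum_range]
  push_cast
  calc _ ≤ ∑ i ∈ Finset.range (f.natDegree + 1), |(f.coeff i : ℝ) * (t : ℝ) ^ i| :=
        Finset.abs_sum_le_sum_abs _ _
    _ ≤ ∑ i ∈ Finset.range (f.natDegree + 1),
          |(f.coeff i : ℝ)| * 2 ^ i * (N : ℝ) ^ f.natDegree := by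
        refine Finset.sum_le_sum fun i hi => ?_
        rw [abs_mul, abs_of_nonneg (pow_nonneg ht0 i), mul_assoc]
        refine mul_le_mul_of_nonneg_left ?_ (abs_nonneg _)
        calc (t : ℝ) ^ i ≤ (2 * N) ^ i := pow_le_pow_left₀ ht0 ht2 i
          _ = 2 ^ i * (N : ℝ) ^ i := mul_pow _ _ _
          _ ≤ 2 ^ i * (N : ℝ) ^ f.natDegree := by
            gcongr
            exact Nat.lt_succ_iff.mp (Finset.mem_range.mp hi)
    _ = (∑ i ∈ Finset.range (f.natDegree + 1), |(f.coeff i : ℝ)| * 2 ^ i) *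
          (N : ℝ) ^ f.natDegree := (Finset.sum_mul _ _ _).symm
    _ ≤ _ := by
        refine mul_le_mul_of_nonneg_right ?_ (by positivity)
        linarith

lemma exists_forall_eval_ne_zero {f : ℤ[X]} (hf : f ≠ 0) :
    ∃ M : ℕ, ∀ t : ℤ, (M : ℤ) ≤ t → f.eval t ≠ 0 := by
  refine ⟨∑ r ∈ f.roots.toFinset, (r.natAbs + 1), fun t ht h0 => ?_⟩
  have hmem : t ∈ f.roots.toFinset := by
    rw [Multiset.mem_toFinset, mem_roots hf]; exact h0
  have := Finset.single_le_sum (f := fun r : ℤ => r.natAbs + 1) (fun _ _ => Nat.zero_le _) hmem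
  omega

/-! ### Products of coprime irreducible polynomials -/

/-- The Bézout relation over `ℚ` with denominators cleared; `c` plays the role of the resultant of
`D` and `D'`. -/
lemma exists_bezout_of_separable {D : ℤ[X]} (h : (D.map (Int.castRingHom ℚ)).Separable) :
    ∃ (u v : ℤ[X]) (c : ℤ), c ≠ 0 ∧ u * D + v * derivative D = C c := by
  obtain ⟨u', v', huv⟩ := h
  obtain ⟨b, hb, hu⟩ := IsLocalization.integerNormalization_spec (nonZeroDivisors ℤ) u'
  obtain ⟨c, hc, hv⟩ := IsLocalization.integerNormalization_spec (nonZeroDivisors ℤ) v'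
  set u := IsLocalization.integerNormalization (nonZeroDivisors ℤ) u'
  set v := IsLocalization.integerNormalization (nonZeroDivisors ℤ) v'
  refine ⟨C c * u, C b * v, b * c,
    mul_ne_zero (nonZeroDivisors.ne_zero hb) (nonZeroDivisors.ne_zero hc), ?_⟩
  apply map_injective (Int.castRingHom ℚ) Int.cast_injective
  change u.map (Int.castRingHom ℚ) = _ at hu
  change v.map (Int.castRingHom ℚ) = _ at hv
  have hsb : ∀ (n : ℤ) (w : ℚ[X]), n • w = C (n : ℚ) * w := fun n w => by
    rw [zsmul_eq_mul]; simp
  rw [hsb] at hu hv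
  rw [derivative_map] at huv
  rw [Polynomial.map_add, Polynomial.map_mul, Polynomial.map_mul, Polynomial.map_mul,
    Polynomial.map_mul, map_C, map_C, map_C, hu, hv, map_mul, C_mul]
  simp only [Int.coe_castRingHom]
  linear_combination C (b : ℚ) * C (c : ℚ) * huv

/-- By Gauss's lemma primitive irreducibles stay irreducible over `ℚ`, and normalization makes
distinct factors non-associated, hence coprime. -/
lemma separable_map_prod (s : Finset ℤ[X]) (hirr : ∀ f ∈ s, Irreducible f)
    (hdeg : ∀ f ∈ s, 0 < f.natDegree) (hnorm : ∀ f ∈ s, normalize f = f) :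
    ((∏ f ∈ s, f).map (Int.castRingHom ℚ)).Separable := by
  have hprim : ∀ f ∈ s, f.IsPrimitive := fun f hf => (hirr f hf).isPrimitive (hdeg f hf).ne'
  have hirr' : ∀ f ∈ s, Irreducible (f.map (Int.castRingHom ℚ)) := fun f hf =>
    (IsPrimitive.Int.irreducible_iff_irreducible_map_cast (hprim f hf)).mp (hirr f hf)
  rw [Polynomial.map_prod]
  refine separable_prod' (fun f hf g hg hfg => ?_) fun f hf => (hirr' f hf).separable
  refine (EuclideanDomain.dvd_or_coprime _ _ (hirr' f hf)).resolve_left fun hd => hfg ?_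
  have h1 : f ∣ g := (IsPrimitive.Int.dvd_iff_map_cast_dvd_map_cast f g (hprim f hf)).mpr hd
  have h2 : Associated f g := (hirr f hf).associated_of_dvd (hirr g hg) h1
  rw [← hnorm f hf, ← hnorm g hg]
  exact normalize_eq_normalize_iff_associated.mpr h2

lemma exists_nu_prime_pow_le {D : ℤ[X]} (h : (D.map (Int.castRingHom ℚ)).Separable) {j : ℕ}
    (hj : 1 ≤ j) : ∃ Q : ℕ, ∀ q : ℕ, q.Prime → Q ≤ q → nu D (q ^ j) ≤ D.natDegree := by
  obtain ⟨u, v, c, hc, huv⟩ := exists_bezout_of_separable h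
  have hD : D ≠ 0 := fun h0 => by
    rw [h0, Polynomial.map_zero] at h
    exact not_separable_zero h
  have hnd : ∀ {x : ℤ} {q : ℕ}, x ≠ 0 → x.natAbs < q → ¬ (q : ℤ) ∣ x := fun hx hq hd => by
    have := Nat.le_of_dvd (Int.natAbs_pos.mpr hx) (Int.natCast_dvd.mp hd)
    omega
  refine ⟨c.natAbs + D.leadingCoeff.natAbs + 1, fun q hq hQ => nu_prime_pow_le D u v c huv hq hj
    (hnd hc (by omega)) (hnd (leadingCoeff_ne_zero.mpr hD) (by omega))⟩

/-- As `q` divides only one of the values, the full power `q ^ j` falls on a single factor. This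
makes the degree of each factor matter, rather than that of `D`. -/
lemma exists_dvd_of_pow_dvd_prod (s : Finset ℤ[X]) {t : ℤ} {q j : ℕ} (hq : q.Prime) (hj : 1 ≤ j)
    (hcop : ∀ f ∈ s, ∀ g ∈ s, f ≠ g → ¬ ((q : ℤ) ∣ f.eval t ∧ (q : ℤ) ∣ g.eval t))
    (h : ((q ^ j : ℕ) : ℤ) ∣ (∏ f ∈ s, f).eval t) : ∃ f ∈ s, ((q ^ j : ℕ) : ℤ) ∣ f.eval t := by
  classical
  rw [eval_prod] at h
  have hqi : Prime (q : ℤ) := Nat.prime_iff_prime_int.mp hq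
  have hq1 : (q : ℤ) ∣ ∏ f ∈ s, f.eval t :=
    (Int.natCast_dvd_natCast.mpr (dvd_pow_self q (by omega))).trans h
  obtain ⟨f, hf, hqf⟩ := hqi.exists_mem_finset_dvd hq1
  refine ⟨f, hf, ?_⟩
  rw [← Finset.mul_prod_erase s _ hf] at h
  push_cast at h ⊢
  refine (IsCoprime.pow_left ?_).dvd_of_dvd_mul_right h
  rw [Prime.coprime_iff_not_dvd hqi]
  intro hd
  obtain ⟨g, hg, hqg⟩ := hqi.exists_mem_finset_dvd hd
  exact hcop f hf g (Finset.mem_of_mem_erase hg) (Finset.ne_of_mem_erase hg).symm ⟨hqf, hqg⟩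

/-- A prime whose `j`-th power divides a value of a product of coprime polynomials of degree less
than `j` is small compared to the argument. -/
lemma exists_prime_le_of_pow_dvd (s : Finset ℤ[X]) {j : ℕ} (hj : 1 ≤ j) (h0 : ∀ f ∈ s, f ≠ 0)
    (hdeg : ∀ f ∈ s, f.natDegree < j)
    (hcop : ∀ f ∈ s, ∀ g ∈ s, f ≠ g → ∀ (t : ℤ) (q : ℕ), q.Prime →
      ¬ ((q : ℤ) ∣ f.eval t ∧ (q : ℤ) ∣ g.eval t)) :
    ∃ (c : ℝ) (M : ℕ), 1 ≤ c ∧ ∀ N : ℕ, M ≤ N → ∀ t ∈ Finset.Icc (N : ℤ) (2 * N), ∀ q : ℕ,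
      q.Prime → ((q ^ j : ℕ) : ℤ) ∣ (∏ f ∈ s, f).eval t → (q : ℝ) ≤ c * (N : ℝ) ^ (1 - 1 / (j : ℝ)) := by
  choose! C hC1 hC using fun f : ℤ[X] => exists_abs_eval_le f
  choose! R hR using fun (f : ℤ[X]) (hf : f ∈ s) => exists_forall_eval_ne_zero (h0 f hf)
  have hC0 : ∀ f ∈ s, 0 ≤ C f := fun f _ => zero_le_one.trans (hC1 f)
  refine ⟨1 + ∑ f ∈ s, C f, 1 + ∑ f ∈ s, R f, le_add_of_nonneg_right (Finset.sum_nonneg hC0),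
    fun N hN t ht q hq hd => ?_⟩
  obtain ⟨f, hf, hqf⟩ := exists_dvd_of_pow_dvd_prod s hq hj
    (fun f hf g hg hfg => hcop f hf g hg hfg t q hq) hd
  have hRf : R f ≤ ∑ f ∈ s, R f := Finset.single_le_sum (fun _ _ => Nat.zero_le _) hf
  have hCf : C f ≤ ∑ f ∈ s, C f := Finset.single_le_sum hC0 hf
  have ht' := (Finset.mem_Icc.mp ht).1
  have hne := hR f hf t (by omega)
  have hNpos : 1 ≤ N := by omega
  have hN1 : (1 : ℝ) ≤ N := by exact_mod_cast hNpos
  have h1 : (q : ℝ) ^ j ≤ |((f.eval t : ℤ) : ℝ)| := by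
    have := Int.le_of_dvd (abs_pos.mpr hne) ((dvd_abs _ _).mpr hqf)
    exact_mod_cast this
  have h2 := hC f N hNpos t ht
  set c := 1 + ∑ f ∈ s, C f
  have hc1 : 1 ≤ c := le_add_of_nonneg_right (Finset.sum_nonneg hC0)
  have hj0 : (0 : ℝ) < j := by exact_mod_cast hj
  have hc0 : 0 ≤ c := by linarith
  have hN0 : (0 : ℝ) ≤ N := by linarith
  -- The factor has degree at most `j - 1`, so its nonzero value is `O(N ^ (j - 1))`; the `j`-th
  -- root saves a power over `N`.
  have h3 : (q : ℝ) ^ j ≤ (c * (N : ℝ) ^ (1 - 1 / (j : ℝ))) ^ j := by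
    have e1 : ((N : ℝ) ^ (1 - 1 / (j : ℝ))) ^ j = (N : ℝ) ^ (j - 1) := by
      rw [← Real.rpow_natCast, ← Real.rpow_mul hN0, ← Real.rpow_natCast, Nat.cast_sub hj]
      congr 1
      field_simp
      simp
    rw [mul_pow, e1]
    calc (q : ℝ) ^ j ≤ C f * (N : ℝ) ^ f.natDegree := h1.trans h2
      _ ≤ c ^ j * (N : ℝ) ^ (j - 1) := by
        have hd := hdeg f hf
        refine mul_le_mul ?_ (pow_le_pow_right₀ hN1 (by omega)) (by positivity) (by positivity)
        calc C f ≤ c := by linarith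
          _ = c ^ 1 := (pow_one c).symm
          _ ≤ c ^ j := pow_le_pow_right₀ hc1 hj
  exact le_of_pow_le_pow_left₀ (by omega) (by positivity) h3

/-! ### Equidistribution of power-free values in residue classes -/

section Equidistribution

variable {D : ℤ[X]} {j : ℕ}

open Classical in
/-- The `t ∈ [N, 2N]` congruent to `a` modulo `P` with `D(t)` free of `j`-th powers. -/
def powerFreeClass (D : ℤ[X]) (j N P : ℕ) (a : ℤ) : Finset ℤ :=
  (Finset.Icc (N : ℤ) (2 * N)).filter
    fun t => t ≡ a [ZMOD P] ∧ ∀ q : ℕ, q.Prime → ¬ ((q ^ j : ℕ) : ℤ) ∣ D.eval t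

/-- Sifting by primes up to `y` overcounts at most those `t` at which some prime above `y` violates
the power-free condition. -/
lemma abs_card_powerFreeClass_sub_le (hj : 3 ≤ j) {K : ℝ} (hK0 : 0 ≤ K)
    (hK : ∀ d : ℕ, Squarefree d → (nu D (d ^ j) : ℝ) ≤ K * √(d : ℝ)) {m Q : ℕ}
    (hQ : ∀ q : ℕ, q.Prime → Q ≤ q → nu D (q ^ j) ≤ m) (N P : ℕ) (a : ℤ) (hP : 0 < P)
    (hPa : ∀ t : ℤ, t ≡ a [ZMOD P] → ∀ q : ℕ, q.Prime → q ∣ P → ¬ ((q ^ j : ℕ) : ℤ) ∣ D.eval t)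
    (y Y : ℕ) (hy : 1 ≤ y) (hQy : Q ≤ y)
    (hY : ∀ t ∈ Finset.Icc (N : ℤ) (2 * N), ∀ q : ℕ, q.Prime → ((q ^ j : ℕ) : ℤ) ∣ D.eval t →
      q ≤ Y) :
    |((powerFreeClass D j N P a).card : ℝ) - N / P * sieveDensity D j P| ≤
      (3 * K * zetaFiveFourths + 6 * K) * (N * (y : ℝ) ^ (-(1 / 4) : ℝ) + (y : ℝ) ^ 4) +
      m * (N * ((y : ℝ) ^ (-(5 / 4) : ℝ) * zetaFiveFourths) + 2 * Y) := by
  classical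
  have h1 := abs_card_sifted_sub_le hj hK0 hK N P a hP hPa hy
  have h2 := card_large_prime_le hj hQ N y Y hy hQy hY
  set Z := (Finset.Icc (N : ℤ) (2 * N)).filter
      fun t => ∃ q : ℕ, q.Prime ∧ y < q ∧ ((q ^ j : ℕ) : ℤ) ∣ D.eval t with hZ
  have hsub : powerFreeClass D j N P a ⊆ sifted D j N P a y := by
    intro t ht
    simp only [powerFreeClass, sifted, Finset.mem_filter] at ht ⊢
    exact ⟨⟨ht.1, ht.2.1⟩, fun q hq _ => ht.2.2 q hq⟩
  have hsub2 : sifted D j N P a y ⊆ powerFreeClass D j N P a ∪ Z := by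
    intro t ht
    simp only [sifted, Finset.mem_filter] at ht
    by_cases h : ∃ q : ℕ, q.Prime ∧ y < q ∧ ((q ^ j : ℕ) : ℤ) ∣ D.eval t
    · exact Finset.mem_union_right _ (Finset.mem_filter.mpr ⟨ht.1.1, h⟩)
    · refine Finset.mem_union_left _ (Finset.mem_filter.mpr ⟨ht.1.1, ht.1.2, fun q hq hd => ?_⟩)
      by_cases hqy : q ≤ y
      · exact ht.2 q hq hqy hd
      · exact h ⟨q, hq, by omega, hd⟩
  have c1 : ((powerFreeClass D j N P a).card : ℝ) ≤ (sifted D j N P a y).card := by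
    exact_mod_cast Finset.card_le_card hsub
  have c2 : ((sifted D j N P a y).card : ℝ) ≤ (powerFreeClass D j N P a).card + Z.card := by
    exact_mod_cast (Finset.card_le_card hsub2).trans (Finset.card_union_le _ _)
  have hZ0 : (0 : ℝ) ≤ Z.card := Nat.cast_nonneg _
  rw [abs_le] at h1 ⊢
  constructor <;> linarith [h1.1, h1.2]

lemma half_rpow_le_floor {x : ℝ} (hx : 1 ≤ x) : x / 2 ≤ (⌊x⌋₊ : ℝ) := by
  have h1 := Nat.lt_floor_add_one x
  have h2 : (1 : ℝ) ≤ ⌊x⌋₊ := by exact_mod_cast Nat.one_le_floor_iff x |>.mpr hx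
  linarith

theorem exists_abs_card_powerFreeClass_sub_le (s : Finset ℤ[X]) (hirr : ∀ f ∈ s, Irreducible f)
    (hpos : ∀ f ∈ s, 0 < f.natDegree) (hnorm : ∀ f ∈ s, normalize f = f) (hj : 3 ≤ j)
    (hdeg : ∀ f ∈ s, f.natDegree < j)
    (hcop : ∀ f ∈ s, ∀ g ∈ s, f ≠ g → ∀ (t : ℤ) (q : ℕ), q.Prime →
      ¬ ((q : ℤ) ∣ f.eval t ∧ (q : ℤ) ∣ g.eval t)) (hD : D = ∏ f ∈ s, f) :
    ∃ (δ K C : ℝ) (M : ℕ), 0 < δ ∧ 0 ≤ K ∧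
      (∀ d : ℕ, Squarefree d → (nu D (d ^ j) : ℝ) ≤ K * √(d : ℝ)) ∧ 0 ≤ C ∧ 1 ≤ M ∧
      ∀ N : ℕ, M ≤ N → ∀ (P : ℕ) (a : ℤ), 0 < P →
        (∀ t : ℤ, t ≡ a [ZMOD P] → ∀ q : ℕ, q.Prime → q ∣ P → ¬ ((q ^ j : ℕ) : ℤ) ∣ D.eval t) →
        |((powerFreeClass D j N P a).card : ℝ) - N / P * sieveDensity D j P| ≤
          C * (N : ℝ) ^ (1 - δ) := by
  have hsep := separable_map_prod s hirr hpos hnorm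
  rw [← hD] at hsep
  obtain ⟨Q, hQ⟩ := exists_nu_prime_pow_le hsep (j := j) (by omega)
  obtain ⟨K, hK1, hK⟩ := exists_nu_le_sqrt D j Q D.natDegree hQ
  have hK0 : 0 ≤ K := by linarith
  obtain ⟨c, M, hc1, hM⟩ := exists_prime_le_of_pow_dvd s (j := j) (by omega)
    (fun f hf => (hirr f hf).ne_zero) hdeg hcop
  rw [← hD] at hM
  have hζ := zetaFiveFourths_nonneg
  set ζ := zetaFiveFourths
  set m := D.natDegree
  have hj0 : (3 : ℝ) ≤ j := by exact_mod_cast hj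
  -- With `y` about `N ^ (1/8)` the errors are `N ^ (31/32)` from `N y ^ (-1/4)`, `N ^ (1/2)` from
  -- `y⁴`, and `N ^ (1 - 1/j)` from the large primes; `δ = 1 / (32 j)` is below all three savings.
  -- Requiring `N ≥ (Q + 1) ^ 8` ensures `y ≥ Q`, so the bound on roots applies to every prime above
  -- `y`.
  refine ⟨1 / (32 * j), K, (3 * K * ζ + 6 * K) * 3 + m * (2 * ζ + 2 * c), M + (Q + 1) ^ 8,
    by positivity, hK0, hK, by positivity, by have := Nat.one_le_pow 8 (Q + 1) (by omega); omega,
    fun N hN P a hP hPa => ?_⟩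
  have hQN : (Q + 1) ^ 8 ≤ N := by omega
  have hN1 : 1 ≤ N := (Nat.one_le_pow 8 (Q + 1) (by omega)).trans hQN
  have hN1' : (1 : ℝ) ≤ N := by exact_mod_cast hN1
  have hN0 : (0 : ℝ) < N := by linarith
  set x : ℝ := (N : ℝ) ^ (1 / 8 : ℝ) with hx
  have hx8 : x ^ 8 = N := by
    rw [hx, ← Real.rpow_natCast, ← Real.rpow_mul hN0.le]; norm_num
  have hx0 : 0 ≤ x := Real.rpow_nonneg hN0.le _
  have hQx : (Q : ℝ) + 1 ≤ x := by
    refine le_of_pow_le_pow_left₀ (n := 8) (by norm_num) hx0 ?_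
    rw [hx8]
    exact_mod_cast hQN
  have hx1 : 1 ≤ x := by linarith [Nat.cast_nonneg (α := ℝ) Q]
  set y := ⌊x⌋₊ with hy
  have hyx : (y : ℝ) ≤ x := Nat.floor_le hx0
  have hy2 : x / 2 ≤ y := half_rpow_le_floor hx1
  have hQy : Q + 1 ≤ y := Nat.le_floor (by push_cast; exact hQx)
  set Y := ⌊c * (N : ℝ) ^ (1 - 1 / (j : ℝ))⌋₊ with hYdef
  have hYle : (Y : ℝ) ≤ c * (N : ℝ) ^ (1 - 1 / (j : ℝ)) := Nat.floor_le (by positivity)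
  have main := abs_card_powerFreeClass_sub_le hj hK0 hK hQ N P a hP hPa y Y (by omega) (by omega)
    fun t ht q hq hd => Nat.le_floor (hM N (by omega) t ht q hq hd)
  refine main.trans ?_
  have hj1 : 1 / (32 * (j : ℝ)) ≤ 1 / (j : ℝ) :=
    one_div_le_one_div_of_le (by linarith) (by linarith)
  have hj2 : 1 / (32 * (j : ℝ)) ≤ 1 / 32 := one_div_le_one_div_of_le (by norm_num) (by linarith)
  set δ := 1 / (32 * (j : ℝ))
  set E := (N : ℝ) ^ (1 - δ) with hE
  have e1 : (N : ℝ) * (y : ℝ) ^ (-(1 / 4) : ℝ) ≤ 2 * E := by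
    have h1 : (y : ℝ) ^ (-(1 / 4) : ℝ) ≤ (x / 2) ^ (-(1 / 4) : ℝ) :=
      Real.rpow_le_rpow_of_nonpos (by linarith) hy2 (by norm_num)
    have h2 : (x / 2) ^ (-(1 / 4) : ℝ) = (N : ℝ) ^ (-(1 / 32) : ℝ) * 2 ^ (1 / 4 : ℝ) := by
      rw [Real.div_rpow hx0 (by norm_num), hx, ← Real.rpow_mul hN0.le, Real.rpow_neg (by norm_num),
        div_inv_eq_mul]
      norm_num
    have h3 : (2 : ℝ) ^ (1 / 4 : ℝ) ≤ 2 := by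
      calc (2 : ℝ) ^ (1 / 4 : ℝ) ≤ 2 ^ (1 : ℝ) :=
            Real.rpow_le_rpow_of_exponent_le (by norm_num) (by norm_num)
        _ = 2 := Real.rpow_one 2
    calc (N : ℝ) * (y : ℝ) ^ (-(1 / 4) : ℝ)
        ≤ N * ((N : ℝ) ^ (-(1 / 32) : ℝ) * 2) := by
          rw [h2] at h1
          gcongr
          exact h1.trans (by gcongr)
      _ = 2 * (N : ℝ) ^ (1 - 1 / 32 : ℝ) := by
          rw [sub_eq_add_neg, Real.rpow_add hN0, Real.rpow_one]; ring
      _ ≤ 2 * E := by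
          rw [hE]
          gcongr
  have e2 : (y : ℝ) ^ 4 ≤ E := by
    calc (y : ℝ) ^ 4 ≤ x ^ 4 := by gcongr
      _ = (N : ℝ) ^ (1 / 2 : ℝ) := by
        rw [hx, ← Real.rpow_natCast, ← Real.rpow_mul hN0.le]; norm_num
      _ ≤ E := Real.rpow_le_rpow_of_exponent_le hN1' (by linarith)
  have e3 : (y : ℝ) ^ (-(5 / 4) : ℝ) ≤ (y : ℝ) ^ (-(1 / 4) : ℝ) :=
    Real.rpow_le_rpow_of_exponent_le (by exact_mod_cast (by omega : 1 ≤ y)) (by norm_num)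
  have e4 : (Y : ℝ) ≤ c * E := hYle.trans
    (mul_le_mul_of_nonneg_left (Real.rpow_le_rpow_of_exponent_le hN1' (by linarith)) (by linarith))
  have e5 : (N : ℝ) * ((y : ℝ) ^ (-(5 / 4) : ℝ) * ζ) ≤ 2 * E * ζ := by
    rw [← mul_assoc]
    refine mul_le_mul_of_nonneg_right (le_trans ?_ e1) hζ
    gcongr
  calc _ ≤ (3 * K * ζ + 6 * K) * (2 * E + E) + m * (2 * E * ζ + 2 * (c * E)) := by gcongr
    _ = _ := by ring

/-- The power-free values of `D` are equidistributed in the residue classes modulo a prime `p`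
that are not excluded by the condition at `p`. -/
theorem exists_equidistribution (s : Finset ℤ[X]) (hirr : ∀ f ∈ s, Irreducible f)
    (hpos : ∀ f ∈ s, 0 < f.natDegree) (hnorm : ∀ f ∈ s, normalize f = f) (hj : 3 ≤ j)
    (hdeg : ∀ f ∈ s, f.natDegree < j)
    (hcop : ∀ f ∈ s, ∀ g ∈ s, f ≠ g → ∀ (t : ℤ) (q : ℕ), q.Prime →
      ¬ ((q : ℤ) ∣ f.eval t ∧ (q : ℤ) ∣ g.eval t)) (hD : D = ∏ f ∈ s, f)
    (hloc : ∀ p : ℕ, p.Prime → nu D (p ^ j) < p ^ j) :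
    ∃ (δ C : ℝ) (M : ℕ), 0 < δ ∧ 0 ≤ C ∧ 1 ≤ M ∧
      (∀ p : ℕ, p.Prime → (1 - (nu D (p ^ j) : ℝ) / (p : ℝ) ^ j)⁻¹ ≤ C) ∧
      ∀ N : ℕ, M ≤ N → 0 < (powerFreeClass D j N 1 0).card ∧ ∀ (p : ℕ) (a : ℤ), p.Prime →
        (∀ t : ℤ, t ≡ a [ZMOD p] → ¬ ((p ^ j : ℕ) : ℤ) ∣ D.eval t) →
        |((powerFreeClass D j N p a).card : ℝ) / (powerFreeClass D j N 1 0).card -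
          (1 - (nu D (p ^ j) : ℝ) / (p : ℝ) ^ j)⁻¹ / p| ≤ C * (N : ℝ) ^ (-δ) := by
  obtain ⟨δ, K, C, M, hδ, hK0, hK, hC0, hM1, hM⟩ :=
    exists_abs_card_powerFreeClass_sub_le s hirr hpos hnorm hj hdeg hcop hD
  have hG := sieveDensity_pos hj hK0 hK hloc
  set G := sieveDensity D j 1 with hGdef
  set T := ∑' d, |sieveCoeff D j d|
  have hx1 : ∀ p : ℕ, p.Prime → 0 < 1 - (nu D (p ^ j) : ℝ) / (p : ℝ) ^ j := fun p hp => by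
    have : (0 : ℝ) < (p : ℝ) ^ j := pow_pos (by exact_mod_cast hp.pos) _
    rw [sub_pos, div_lt_one this]
    exact_mod_cast hloc p hp
  have hGp : ∀ p : ℕ, p.Prime →
      sieveDensity D j p = (1 - (nu D (p ^ j) : ℝ) / (p : ℝ) ^ j)⁻¹ * G := fun p hp => by
    have h := sieveDensity_eq_mul hj hK0 hK hp 1 (Nat.coprime_one_left p)
    rw [one_mul] at h
    rw [hGdef, h, ← mul_assoc, inv_mul_cancel₀ (hx1 p hp).ne', one_mul]
  -- The Euler factor times `G` is the density without the condition at `p`, which is at most the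
  -- absolute series; hence a bound uniform in `p`.
  have hH : ∀ p : ℕ, p.Prime → (1 - (nu D (p ^ j) : ℝ) / (p : ℝ) ^ j)⁻¹ ≤ T / G := fun p hp => by
    rw [le_div_iff₀ hG, ← hGp p hp]
    exact (le_abs_self _).trans (abs_sieveDensity_le hj hK0 hK p)
  have hT0 : 0 ≤ T / G := div_nonneg (tsum_nonneg fun _ => abs_nonneg _) hG.le
  have htend : Filter.Tendsto (fun N : ℕ => C * (N : ℝ) ^ (-δ)) Filter.atTop (nhds 0) := by
    have := ((tendsto_rpow_neg_atTop hδ).comp tendsto_natCast_atTop_atTop).const_mul C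
    simpa using this
  obtain ⟨M', hM'⟩ := Filter.eventually_atTop.mp
    (htend.eventually (gt_mem_nhds (half_pos hG)))
  refine ⟨δ, T / G + 2 * C * (1 + T / G) / G, M + M', hδ, by positivity, by omega,
    fun p hp => (hH p hp).trans (le_add_of_nonneg_right (by positivity)), fun N hN => ?_⟩
  have hN0 : (0 : ℝ) < N := by exact_mod_cast (by omega : 0 < N)
  have hEN : (N : ℝ) ^ (1 - δ) = N * (N : ℝ) ^ (-δ) := by
    rw [sub_eq_add_neg, Real.rpow_add hN0, Real.rpow_one]
  have hF := hM N (by omega) 1 0 one_pos fun t _ q hq h1 =>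
    absurd (Nat.dvd_one.mp h1) hq.one_lt.ne'
  rw [Nat.cast_one, div_one, hEN] at hF
  set F : ℝ := ((powerFreeClass D j N 1 0).card : ℝ) with hFdef
  set e := (N : ℝ) ^ (-δ) with he
  have he0 : 0 ≤ e := Real.rpow_nonneg hN0.le _
  have hsmall : C * e < G / 2 := hM' N (by omega)
  -- Positive density gives a family of size at least `N G / 2`; dividing by it turns the counting
  -- error into `O(N ^ (-δ))`.
  have hFlow : N * (G / 2) ≤ F := by
    have h1 := (abs_le.mp hF).1
    have h2 : N * (C * e) ≤ N * (G / 2) := mul_le_mul_of_nonneg_left hsmall.le hN0.le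
    have h3 : C * (N * e) = N * (C * e) := by ring
    have h4 : N * G = N * (G / 2) + N * (G / 2) := by ring
    linarith
  have hFpos : 0 < F := lt_of_lt_of_le (by positivity) hFlow
  refine ⟨Nat.cast_pos.mp hFpos, fun p a hp hpa => ?_⟩
  have hp1 : (1 : ℝ) ≤ p := by exact_mod_cast hp.one_lt.le
  have hp0 : (0 : ℝ) < p := by linarith
  have hA := hM N (by omega) p a hp.pos fun t ht q hq hqp => by
    rw [(Nat.prime_dvd_prime_iff_eq hq hp).mp hqp]; exact hpa t ht
  rw [hEN, hGp p hp] at hA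
  have hHp := hH p hp
  have hH0 := inv_nonneg.mpr (hx1 p hp).le
  set H := (1 - (nu D (p ^ j) : ℝ) / (p : ℝ) ^ j)⁻¹
  set n : ℝ := ((powerFreeClass D j N p a).card : ℝ)
  have key : |n - H / p * F| ≤ C * (N * e) * (1 + T / G) := by
    have hHp' : H / p ≤ T / G := (div_le_self hH0 hp1).trans hHp
    have hHp0 : 0 ≤ H / p := by positivity
    have e1 : n - H / p * F = (n - N / p * (H * G)) + -(H / p * (F - N * G)) := by
      field_simp; ring
    rw [e1]
    refine (abs_add_le _ _).trans ?_
    rw [abs_neg, abs_mul, abs_of_nonneg hHp0]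
    calc _ ≤ C * (N * e) + T / G * (C * (N * e)) := by gcongr
      _ = _ := by ring
  have e2 : n / F - H / p = (n - H / p * F) / F := by
    field_simp
  rw [e2, abs_div, abs_of_pos hFpos, div_le_iff₀ hFpos]
  refine key.trans ?_
  have h5 : 2 * C * (1 + T / G) / G * e * (N * (G / 2)) ≤ 2 * C * (1 + T / G) / G * e * F := by
    gcongr
  have h6 : 2 * C * (1 + T / G) / G * e * (N * (G / 2)) = C * (N * e) * (1 + T / G) := by
    field_simp
  have h7 : 0 ≤ T / G * e * F := by positivity
  linarith

end Equidistribution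

/-! ### Equidistribution of the family -/

lemma discPoly_ne_zero {A B : ℤ[X]}
    (hcontent : ∀ p : ℕ, p.Prime → (p : ℤ) ∣ (discPoly A B).content → p = 2 ∨ p = 3) :
    discPoly A B ≠ 0 := by
  intro h
  have := hcontent 5 (by norm_num) (by rw [h, content_zero]; exact dvd_zero _)
  omega

lemma nu_lt_iff_exists (D : ℤ[X]) {n : ℕ} (hn : n ≠ 0) (h : ∃ t : ℤ, ¬ (n : ℤ) ∣ D.eval t) :
    nu D n < n := by
  have : NeZero n := ⟨hn⟩
  obtain ⟨t, ht⟩ := h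
  rw [nu_eq_card]
  conv_rhs => rw [← ZMod.card n]
  refine Finset.card_lt_univ_of_notMem (x := (t : ZMod n)) fun hm => ht ?_
  have h0 := (Finset.mem_filter.mp hm).2
  rw [aeval_intCast_zmod] at h0
  exact (ZMod.intCast_zmod_eq_zero_iff_dvd _ _).mp h0

lemma family_coe_eq (A B : ℤ[X]) (j N : ℕ) :
    family A B j N = powerFreeClass (sievePoly A B) j N 1 0 := by
  ext t
  simp only [family, powerFreeClass, Finset.mem_filter]
  constructor
  · rintro ⟨h1, h2⟩
    refine ⟨h1, by simp [Int.modEq_one], fun q hq => ?_⟩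
    have := h2 j rfl q hq
    exact_mod_cast this
  · rintro ⟨h1, -, h2⟩
    refine ⟨h1, fun i hi q hq => ?_⟩
    have := h2 q hq
    rw [← Nat.cast_inj.mp hi]
    exact_mod_cast this

lemma family_filter_coe_eq (A B : ℤ[X]) (j N p : ℕ) (a : ℤ) :
    (family A B j N).filter (fun t => t ≡ a [ZMOD p]) =
      powerFreeClass (sievePoly A B) j N p a := by
  ext t
  rw [family_coe_eq]
  simp only [powerFreeClass, Finset.mem_filter, Int.modEq_one, Nat.cast_one, true_and]
  tauto

/-- For `k = ∞` the family is the power-free family of the constant polynomial `1`, with no sieve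
condition; the exponent `3` is arbitrary. One equidistribution theorem thus covers both cases. -/
lemma family_top_filter_eq (A B : ℤ[X]) (N p : ℕ) (a : ℤ) :
    (family A B ⊤ N).filter (fun t => t ≡ a [ZMOD p]) = powerFreeClass 1 3 N p a := by
  ext t
  simp only [family, powerFreeClass, Finset.mem_filter, PowerFree, eval_one, ENat.top_ne_natCast,
    false_imp_iff, implies_true, and_true, and_congr_right_iff]
  refine fun _ => (and_iff_left fun q hq hd => ?_).symm
  have h1 := Int.eq_one_of_dvd_one (by positivity) hd
  have h2 : q ^ 3 = 1 := by exact_mod_cast h1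
  have h3 := hq.two_le
  nlinarith [Nat.pow_le_pow_left h3 3]

lemma family_top_eq (A B : ℤ[X]) (N : ℕ) : family A B ⊤ N = powerFreeClass 1 3 N 1 0 := by
  rw [← family_top_filter_eq A B]
  simp [Int.modEq_one]

lemma nu_one_left {n : ℕ} (hn : 1 < n) : nu 1 n = 0 := by
  have : Fact (1 < n) := ⟨hn⟩
  rw [nu, Nat.card_eq_zero]
  left
  exact ⟨fun x => by simpa using x.2⟩

lemma sieveH_top (D : ℤ[X]) (p : ℕ) : sieveH D ⊤ p = 1 := if_pos rfl

lemma sieveH_coe (D : ℤ[X]) (j : ℕ) {p : ℕ} (hp : p.Prime) (h : nu D (p ^ j) < p ^ j) :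
    sieveH D j p = (1 - (nu D (p ^ j) : ℝ) / (p : ℝ) ^ j)⁻¹ := by
  have hp0 : (0 : ℝ) < (p : ℝ) ^ j := pow_pos (by exact_mod_cast hp.pos) _
  have h1 : 0 < 1 - (nu D (p ^ j) : ℝ) / (p : ℝ) ^ j := by
    rw [sub_pos, div_lt_one hp0]
    exact_mod_cast h
  rw [sieveH, if_neg (ENat.natCast_ne_top j), ENat.toNat_natCast]
  set x := (nu D (p ^ j) : ℝ) / (p : ℝ) ^ j
  field_simp
  ring

lemma discFactors_spec {A B f : ℤ[X]} (hf : f ∈ discFactors A B) :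
    Irreducible f ∧ 0 < f.natDegree ∧ normalize f = f := by
  classical
  simp only [discFactors, Finset.mem_filter, Multiset.mem_toFinset] at hf
  exact ⟨UniqueFactorizationMonoid.irreducible_of_normalized_factor f hf.1, hf.2,
    UniqueFactorizationMonoid.normalize_normalized_factor f hf.1⟩

theorem exists_family_equidistribution (A B : ℤ[X]) (k : ℕ∞) (hk : 3 ≤ k)
    (hfactors : ∀ f ∈ discFactors A B, ∀ g ∈ discFactors A B, f ≠ g →
      ∀ (t : ℤ) (p : ℕ), p.Prime → ¬ ((p : ℤ) ∣ f.eval t ∧ (p : ℤ) ∣ g.eval t))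
    (hdeg : ∀ f ∈ discFactors A B, (f.natDegree : ℕ∞) < k)
    (hlocal : ∀ j : ℕ, k = j → ∀ p : ℕ, p.Prime →
      ∃ t : ℤ, ¬ (p : ℤ) ^ j ∣ (sievePoly A B).eval t) :
    ∃ (δ C : ℝ) (M : ℕ), 0 < δ ∧ 0 ≤ C ∧ 1 ≤ M ∧
      (∀ p : ℕ, p.Prime → 0 < sieveH (sievePoly A B) k p ∧ sieveH (sievePoly A B) k p ≤ C) ∧
      ∀ N : ℕ, M ≤ N → 0 < (family A B k N).card ∧ ∀ (p : ℕ) (a : ℤ), p.Prime →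
        (∀ j : ℕ, k = j → ∀ t : ℤ, t ≡ a [ZMOD p] → ¬ (p : ℤ) ^ j ∣ (sievePoly A B).eval t) →
        |(((family A B k N).filter (fun t => t ≡ a [ZMOD p])).card : ℝ) / (family A B k N).card -
          sieveH (sievePoly A B) k p / p| ≤ C * (N : ℝ) ^ (-δ) := by
  induction k using ENat.recTopCoe with
  | top =>
    have hν : ∀ p : ℕ, p.Prime → nu 1 (p ^ 3) = 0 := fun p hp =>
      nu_one_left (Nat.one_lt_pow (by norm_num) hp.one_lt)
    obtain ⟨δ, C, M, hδ, hC, hM1, hH, hM⟩ := exists_equidistribution (D := 1) (j := 3) ∅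
      (by simp) (by simp) (by simp) le_rfl (by simp) (by simp) (by simp)
      (fun p hp => by rw [hν p hp]; exact pow_pos hp.pos 3)
    refine ⟨δ, C, M, hδ, hC, hM1, fun p hp => ?_, fun N hN => ?_⟩
    · have := hH p hp
      rw [hν p hp] at this
      rw [sieveH_top]
      simpa using this
    · obtain ⟨h1, h2⟩ := hM N hN
      refine ⟨by rwa [family_top_eq], fun p a hp _ => ?_⟩
      have h3 := h2 p a hp fun t _ hd => by
        rw [eval_one] at hd
        have h1 := Int.eq_one_of_dvd_one (by positivity) hd
        have h4 : p ^ 3 = 1 := by exact_mod_cast h1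
        exact absurd h4 (Nat.one_lt_pow (by norm_num) hp.one_lt).ne'
      rw [family_top_filter_eq, family_top_eq, sieveH_top]
      rw [hν p hp] at h3
      simpa using h3
  | coe j =>
    have hj : 3 ≤ j := by exact_mod_cast hk
    have hloc : ∀ p : ℕ, p.Prime → nu (sievePoly A B) (p ^ j) < p ^ j := fun p hp =>
      nu_lt_iff_exists _ (pow_ne_zero _ hp.ne_zero) (by
        obtain ⟨t, ht⟩ := hlocal j rfl p hp
        exact ⟨t, by exact_mod_cast ht⟩)
    obtain ⟨δ, C, M, hδ, hC, hM1, hH, hM⟩ := exists_equidistribution (D := sievePoly A B) (j := j)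
      (discFactors A B) (fun f hf => (discFactors_spec hf).1) (fun f hf => (discFactors_spec hf).2.1)
      (fun f hf => (discFactors_spec hf).2.2) hj (fun f hf => by exact_mod_cast hdeg f hf)
      hfactors rfl hloc
    refine ⟨δ, C, M, hδ, hC, hM1, fun p hp => ?_, fun N hN => ?_⟩
    · rw [sieveH_coe _ _ hp (hloc p hp)]
      have hp0 : (0 : ℝ) < (p : ℝ) ^ j := pow_pos (by exact_mod_cast hp.pos) _
      refine ⟨inv_pos.mpr ?_, hH p hp⟩
      rw [sub_pos, div_lt_one hp0]
      exact_mod_cast hloc p hp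
    · obtain ⟨h1, h2⟩ := hM N hN
      refine ⟨by rwa [family_coe_eq], fun p a hp hpa => ?_⟩
      rw [family_filter_coe_eq, family_coe_eq, sieveH_coe _ _ hp (hloc p hp)]
      exact h2 p a hp fun t ht hd => hpa j rfl t ht (by exact_mod_cast hd)

/-! ### Power sums of the roots of a quadratic polynomial -/

/-- The power sums of the roots of `X² - s X + q`. -/
def powerSum (s q : ℝ) : ℕ → ℝ
  | 0 => 2
  | 1 => s
  | m + 2 => s * powerSum s q (m + 1) - q * powerSum s q m

lemma powerSum_eq {s q : ℝ} {u v : ℂ} (h1 : u + v = s) (h2 : u * v = q) (m : ℕ) :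
    (powerSum s q m : ℂ) = u ^ m + v ^ m := by
  induction m using Nat.twoStepInduction with
  | zero => simp [powerSum]; norm_num
  | one => simp [powerSum, h1]
  | more m ih1 ih2 =>
    rw [powerSum]
    push_cast
    rw [ih1, ih2, ← h1, ← h2]
    ring

lemma exists_roots (s q : ℝ) : ∃ u v : ℂ, u + v = s ∧ u * v = q := by
  obtain ⟨w, hw⟩ := IsAlgClosed.exists_pow_nat_eq ((s : ℂ) ^ 2 - 4 * q) (n := 2) (by norm_num)
  exact ⟨(s + w) / 2, (s - w) / 2, by ring, by linear_combination -hw / 4⟩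

/-- A bound for the roots of `X² - (a / p) X + 1 / p`, where `a` is a Frobenius trace. -/
def rootBound (p : ℝ) : ℝ := min (1 - 1 / p) (31 / √p)

lemma rootBound_nonneg {p : ℝ} (hp : 1 ≤ p) : 0 ≤ rootBound p :=
  le_min (sub_nonneg.mpr ((div_le_one (by linarith)).mpr hp)) (by positivity)

lemma rootBound_lt_one {p : ℝ} (hp : 0 < p) : rootBound p < 1 :=
  (min_le_left _ _).trans_lt (sub_lt_self _ (by positivity))

/-- For `p ≥ 3844 = 62²` the bound `31/√p` is at most `1/2`; below that `1 - 1/p` is used. The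
result is a common ratio less than `1` for all primes. -/
lemma rootBound_le {p : ℝ} (hp : 0 < p) : rootBound p ≤ 1 - 1 / 3844 := by
  rcases le_total p 3844 with h | h
  · refine (min_le_left _ _).trans (sub_le_sub_left ?_ _)
    exact one_div_le_one_div_of_le hp h
  · refine (min_le_right _ _).trans ?_
    have h1 : (62 : ℝ) ≤ √p := Real.le_sqrt_of_sq_le (by norm_num; exact h)
    rw [div_le_iff₀ (by linarith)]
    linarith

/-- Since `|a|` may exceed `2√p` under the bounds available, real roots must be allowed. A real root
satisfies `|x| (1 - |x|) ≥ 1/p`; a nonreal one has modulus `1/√p`, which is at most `1 - 1/p` for `p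
≥ 3`. -/
lemma norm_le_sub_of_root {p a : ℝ} (hp : 3 ≤ p) (ha : |a| ≤ p) {z : ℂ}
    (hz : z ^ 2 - (a / p : ℝ) * z + (1 / p : ℝ) = 0) : ‖z‖ ≤ 1 - 1 / p := by
  have hp0 : 0 < p := by linarith
  have hre := congrArg Complex.re hz
  have him := congrArg Complex.im hz
  simp only [pow_two, Complex.add_re, Complex.sub_re, Complex.mul_re, Complex.ofReal_re,
    Complex.ofReal_im, zero_mul, sub_zero, Complex.zero_re, Complex.add_im, Complex.sub_im,
    Complex.mul_im, add_zero, Complex.zero_im] at hre him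
  set x := z.re
  set y := z.im
  by_cases hy : y = 0
  · have hzn : ‖z‖ = |x| := by
      rw [Complex.norm_eq_sqrt_sq_add_sq]
      change √(x ^ 2 + y ^ 2) = |x|
      rw [hy]
      simp [Real.sqrt_sq_eq_abs]
    rw [hzn]
    rw [hy] at hre
    have h1 : x ^ 2 + 1 / p ≤ |x| := by
      have h2 : a / p * x ≤ |x| := by
        calc a / p * x ≤ |a / p * x| := le_abs_self _
          _ = |a| / p * |x| := by rw [abs_mul, abs_div, abs_of_pos hp0]
          _ ≤ 1 * |x| := by
            gcongr
            exact (div_le_one hp0).mpr ha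
          _ = |x| := one_mul _
      nlinarith
    have hq : 0 < 1 / p := by positivity
    have hx2 : x ^ 2 = |x| ^ 2 := (sq_abs x).symm
    rw [hx2] at h1
    have hx0 := abs_nonneg x
    have hx1 : |x| ≤ 1 := by nlinarith
    nlinarith
  · have h1 : 2 * x = a / p := by
      have : y * (2 * x - a / p) = 0 := by linear_combination him
      rcases mul_eq_zero.mp this with h | h
      · exact absurd h hy
      · linarith
    have h2 : x ^ 2 + y ^ 2 = 1 / p := by rw [← h1] at hre; linarith
    rw [Complex.norm_eq_sqrt_sq_add_sq]
    change √(x ^ 2 + y ^ 2) ≤ _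
    rw [h2]
    have hq : 1 / p ≤ 1 / 3 := one_div_le_one_div_of_le (by norm_num) hp
    refine Real.sqrt_le_iff.mpr ⟨by linarith, ?_⟩
    nlinarith

/-- The rescaled modulus `w = ‖z‖ √p` satisfies `w² ≤ 30w + 1`, which forces `w ≤ 31`. -/
lemma norm_le_div_sqrt_of_root {p a : ℝ} (hp : 0 < p) (ha : |a| ≤ 30 * √p) {z : ℂ}
    (hz : z ^ 2 - (a / p : ℝ) * z + (1 / p : ℝ) = 0) : ‖z‖ ≤ 31 / √p := by
  have hs : 0 < √p := Real.sqrt_pos.mpr hp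
  have hss : √p * √p = p := Real.mul_self_sqrt hp.le
  have h1 : ‖z‖ ^ 2 ≤ 30 / √p * ‖z‖ + 1 / p := by
    have h2 : z ^ 2 = (a / p : ℝ) * z - (1 / p : ℝ) := by linear_combination hz
    rw [← norm_pow, h2]
    refine (norm_sub_le _ _).trans ?_
    rw [norm_mul, Complex.norm_real, Complex.norm_real, Real.norm_eq_abs, Real.norm_eq_abs,
      abs_of_pos (by positivity : 0 < 1 / p), abs_div, abs_of_pos hp]
    gcongr ?_ * _ + _
    rw [div_le_div_iff₀ hp hs]
    calc |a| * √p ≤ 30 * √p * √p := by gcongr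
      _ = 30 * p := by rw [mul_assoc, hss]
  rw [le_div_iff₀ hs]
  by_contra! hlt
  set w := ‖z‖ * √p with hw
  have h3 : w ^ 2 ≤ 30 * w + 1 := by
    have h4 := mul_le_mul_of_nonneg_right h1 hp.le
    have e1 : ‖z‖ ^ 2 * p = w ^ 2 := by rw [hw, mul_pow, Real.sq_sqrt hp.le]
    have e2 : (30 / √p * ‖z‖ + 1 / p) * p = 30 * w + 1 := by
      rw [hw]
      nth_rewrite 2 3 [← hss]
      field_simp
    rwa [e1, e2] at h4
  nlinarith

lemma abs_powerSum_le {p a : ℝ} (hp : 3 ≤ p) (ha : |a| ≤ p) (ha' : |a| ≤ 30 * √p) (m : ℕ) :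
    |powerSum (a / p) (1 / p) m| ≤ 2 * rootBound p ^ m := by
  obtain ⟨u, v, h1, h2⟩ := exists_roots (a / p) (1 / p)
  have hp0 : 0 < p := by linarith
  have hu : u ^ 2 - (a / p : ℝ) * u + (1 / p : ℝ) = 0 := by rw [← h1, ← h2]; ring
  have hv : v ^ 2 - (a / p : ℝ) * v + (1 / p : ℝ) = 0 := by rw [← h1, ← h2]; ring
  have hu' : ‖u‖ ≤ rootBound p :=
    le_min (norm_le_sub_of_root hp ha hu) (norm_le_div_sqrt_of_root hp0 ha' hu)
  have hv' : ‖v‖ ≤ rootBound p :=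
    le_min (norm_le_sub_of_root hp ha hv) (norm_le_div_sqrt_of_root hp0 ha' hv)
  rw [← Real.norm_eq_abs, ← Complex.norm_real, powerSum_eq h1 h2]
  refine (norm_add_le _ _).trans ?_
  rw [norm_pow, norm_pow, two_mul]
  gcongr

/-- The two geometric series from exponent `3` on combine over the denominator `(1 - u)(1 - v) = (p
+ 1 - a) / p`. Division by this linear form in `a` separates the terms in `a⁰`, `a¹`, `a²` from a
remainder divisible by `a³`; these are the weights in `S₀`, `S₁`, `S₂` and the tilde term. -/
lemma hasSum_powerSum {p a : ℝ} (hp : 3 ≤ p) (ha : |a| ≤ p) :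
    HasSum (fun m => powerSum (a / p) (1 / p) (m + 3))
      (2 / (p * (p + 1)) - a * (3 * p + 1) / (p * (p + 1) ^ 2) -
        a ^ 2 * (4 * p ^ 2 + 3 * p + 1) / (p ^ 2 * (p + 1) ^ 3) +
        a ^ 3 * (p - 1) / ((p + 1) ^ 3 * (p + 1 - a))) := by
  obtain ⟨u, v, h1, h2⟩ := exists_roots (a / p) (1 / p)
  have hp0 : 0 < p := by linarith
  have hq0 : 0 < 1 / p := by positivity
  have hu : u ^ 2 - (a / p : ℝ) * u + (1 / p : ℝ) = 0 := by rw [← h1, ← h2]; ring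
  have hv : v ^ 2 - (a / p : ℝ) * v + (1 / p : ℝ) = 0 := by rw [← h1, ← h2]; ring
  have hu' : ‖u‖ < 1 := (norm_le_sub_of_root hp ha hu).trans_lt (by linarith)
  have hv' : ‖v‖ < 1 := (norm_le_sub_of_root hp ha hv).trans_lt (by linarith)
  have hu1 : 1 - u ≠ 0 := fun h => by
    have : u = 1 := by linear_combination -h
    rw [this, norm_one] at hu'
    exact lt_irrefl _ hu'
  have hv1 : 1 - v ≠ 0 := fun h => by
    have : v = 1 := by linear_combination -h
    rw [this, norm_one] at hv'
    exact lt_irrefl _ hv'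
  have ha1 : p + 1 - a ≠ 0 := by linarith [le_abs_self a]
  have hp1 : p + 1 ≠ 0 := by linarith
  rw [← Complex.hasSum_ofReal]
  have hsum := ((hasSum_geometric_of_norm_lt_one hu').mul_left (u ^ 3)).add
    ((hasSum_geometric_of_norm_lt_one hv').mul_left (v ^ 3))
  have hfun : ∀ m : ℕ, ((powerSum (a / p) (1 / p) (m + 3) : ℝ) : ℂ) =
      u ^ 3 * u ^ m + v ^ 3 * v ^ m := fun m => by
    rw [powerSum_eq h1 h2]
    ring
  simp only [hfun]
  suffices hval : ((2 / (p * (p + 1)) - a * (3 * p + 1) / (p * (p + 1) ^ 2) -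
      a ^ 2 * (4 * p ^ 2 + 3 * p + 1) / (p ^ 2 * (p + 1) ^ 3) +
      a ^ 3 * (p - 1) / ((p + 1) ^ 3 * (p + 1 - a)) : ℝ) : ℂ) =
      u ^ 3 * (1 - u)⁻¹ + v ^ 3 * (1 - v)⁻¹ by
    rw [hval]
    exact hsum
  have hpC : (p : ℂ) ≠ 0 := by exact_mod_cast hp0.ne'
  have hp1C : (p : ℂ) + 1 ≠ 0 := by exact_mod_cast hp1
  have ha1C : (p : ℂ) + 1 - a ≠ 0 := by exact_mod_cast ha1
  push_cast at h1 h2 ⊢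
  have e1 : (a : ℂ) = p * (u + v) := by rw [h1]; field_simp
  have e2 : (p : ℂ) * (u * v) = 1 := by rw [h2]; field_simp
  have hden : (1 - u) * (1 - v) = ((p : ℂ) + 1 - a) / p := by
    rw [eq_div_iff hpC, e1]; linear_combination e2
  have e3 : u ^ 3 * (1 - u)⁻¹ + v ^ 3 * (1 - v)⁻¹ =
      ((a / p) ^ 3 - 3 * (a / p) * (1 / p) - (1 / p) * ((a / p) ^ 2 - 2 * (1 / p))) /
        (((p : ℂ) + 1 - a) / p) := by
    rw [← hden, ← h1, ← h2]
    field_simp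
    ring
  rw [e3]
  field_simp
  ring

/-! ### The local terms of the family -/

open Classical in
/-- The sum of the `m`-th powers of the normalized Satake parameters at `t` modulo `p`. -/
def localSum (A B : ℤ[X]) (p : ℕ) [Fact p.Prime] (t : ZMod p) (m : ℕ) : ℝ :=
  if aeval t (discPoly A B) = 0 then ((aMod A B p t : ℝ) / p) ^ m
  else powerSum ((aMod A B p t : ℝ) / p) (1 / p) m

section LocalTerms

variable {A B : ℤ[X]} (hΔ : discPoly A B ≠ 0)
  (hadd : ∀ t : ℤ, (discPoly A B).eval t ≠ 0 →
      AdditiveAt (curve A B t) 2 ∧ AdditiveAt (curve A B t) 3)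

lemma additiveAt_not_goodAt {E : WeierstrassCurve ℤ} {p : ℕ} [Fact p.Prime]
    (h : AdditiveAt E p) : ¬ GoodAt E p :=
  WeierstrassCurve.HasAdditiveReduction.not_hasGoodReduction ℤ_[p] h

include hΔ in
lemma exists_eval_ne_zero_modEq (p : ℕ) (t : ZMod p) [NeZero p] :
    ∃ x : ℤ, (x : ZMod p) = t ∧ (discPoly A B).eval x ≠ 0 := by
  obtain ⟨M, hM⟩ := exists_forall_eval_ne_zero hΔ
  refine ⟨t.val + p * M, by simp, hM _ ?_⟩
  have : 1 ≤ p := NeZero.one_le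
  have h1 : (M : ℤ) ≤ p * M := by exact_mod_cast Nat.le_mul_of_pos_left M this
  have h2 : (0 : ℤ) ≤ t.val := by positivity
  linarith

-- Every class modulo `p` contains a `t` with `Δ(t) ≠ 0`, where additive reduction forces `p ∣
-- Δ(t)`. For `p = 3` this says `A(t)³ ≡ 0`, so the equation has no linear term; for `p = 2` the
-- trace is always zero.
include hΔ hadd in
lemma aMod_eq_zero_of_lt_five {p : ℕ} [hp : Fact p.Prime] (h5 : p < 5) (t : ZMod p) :
    aeval t (discPoly A B) = 0 ∧ aMod A B p t = 0 := by
  obtain ⟨x, rfl, hx⟩ := exists_eval_ne_zero_modEq hΔ p t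
  have hp2 := hp.out.two_le
  interval_cases p
  · refine ⟨?_, aMod_two A B _⟩
    by_contra h
    rw [← dvd_eval_disc_iff] at h
    exact additiveAt_not_goodAt (hadd x hx).1 (goodAt_of_not_dvd _ h)
  · have h : aeval ((x : ℤ) : ZMod 3) (discPoly A B) = 0 := by
      by_contra h
      rw [← dvd_eval_disc_iff] at h
      exact additiveAt_not_goodAt (hadd x hx).2 (goodAt_of_not_dvd _ h)
    refine ⟨h, aMod_three A B _ ?_⟩
    have h3 : (3 : ZMod 3) = 0 := by exact_mod_cast CharP.cast_eq_zero (ZMod 3) 3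
    simp only [discPoly, map_mul, map_add, map_pow, map_neg, map_ofNat] at h
    have h6 : (aeval ((x : ℤ) : ZMod 3) A) ^ 3 = 0 := by
      linear_combination -h + (-21 * aeval ((x : ℤ) : ZMod 3) A ^ 3 -
        144 * aeval ((x : ℤ) : ZMod 3) B ^ 2) * h3
    exact pow_eq_zero_iff (by norm_num) |>.mp h6
  · exact absurd hp.out (by norm_num)

include hΔ hadd in
lemma localSum_eq_zero_of_lt_five {p : ℕ} [hp : Fact p.Prime] (h5 : p < 5) (t : ZMod p) {m : ℕ}
    (hm : m ≠ 0) : localSum A B p t m = 0 := by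
  obtain ⟨h1, h2⟩ := aMod_eq_zero_of_lt_five hΔ hadd h5 t
  rw [localSum, if_pos h1, h2]
  simp [hm]

include hΔ hadd in
lemma abs_localSum_le {p : ℕ} [hp : Fact p.Prime] (t : ZMod p) {m : ℕ} (hm : m ≠ 0) :
    |localSum A B p t m| ≤ 2 * rootBound p ^ m := by
  have hp1 : (1 : ℝ) ≤ p := by exact_mod_cast hp.out.one_lt.le
  have hr0 := rootBound_nonneg hp1
  by_cases h5 : p < 5
  · rw [localSum_eq_zero_of_lt_five hΔ hadd h5 t hm, abs_zero]
    positivity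
  · have hp5 : (5 : ℝ) ≤ p := by exact_mod_cast not_lt.mp h5
    rw [localSum]
    split_ifs with h
    · have h1 : |(aMod A B p t : ℝ)| ≤ 1 := by exact_mod_cast abs_aMod_le_one (not_lt.mp h5) A B t h
      have hs : √(p : ℝ) ≤ p := by
        rw [Real.sqrt_le_iff]
        exact ⟨by linarith, by nlinarith⟩
      have h2 : 1 / (p : ℝ) ≤ rootBound p := by
        refine le_min ?_ ?_
        · have : 1 / (p : ℝ) ≤ 1 / 5 := one_div_le_one_div_of_le (by norm_num) hp5
          linarith
        · rw [div_le_div_iff₀ (by linarith) (Real.sqrt_pos.mpr (by linarith))]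
          linarith
      rw [abs_pow, abs_div, Nat.abs_cast]
      calc (|(aMod A B p t : ℝ)| / p) ^ m ≤ (1 / (p : ℝ)) ^ m := by gcongr
        _ ≤ rootBound p ^ m := by gcongr
        _ ≤ 2 * rootBound p ^ m := by linarith [pow_nonneg hr0 m]
    · exact abs_powerSum_le (by linarith) (abs_aMod_le A B p (by omega) t)
        (abs_aMod_le_sqrt A B p (by omega) t) m

lemma div_sqrt_pow_eq {p : ℝ} (hp : 0 < p) (a : ℝ) (m : ℕ) :
    ((a / √p : ℝ) : ℂ) ^ m / ((√p ^ m : ℝ) : ℂ) = (((a / p) ^ m : ℝ) : ℂ) := by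
  have : a / p = a / √p / √p := by rw [div_div, Real.mul_self_sqrt hp.le]
  rw [this]
  push_cast
  rw [div_pow ((a : ℂ) / _)]

-- Dividing the Satake parameters by `√p` gives the roots of `X² - (a/p) X + 1/p` at good primes and
-- the single value `a/p` at bad ones. All dependence on `t` beyond its residue thereby disappears.
include hadd in
lemma satake_eq_localSum {p : ℕ} [hp : Fact p.Prime] {t : ℤ} (ht : (discPoly A B).eval t ≠ 0)
    (hΔ : discPoly A B ≠ 0) (hmin : 5 ≤ p → MinimalAt (curve A B t) p) {m : ℕ} (hm : m ≠ 0) :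
    (satakeAlpha (curve A B t) p ^ m + satakeBeta (curve A B t) p ^ m) /
      ((√(p : ℝ) ^ m : ℝ) : ℂ) = (localSum A B p t m : ℂ) := by
  have h0 : (curve A B t).Δ ≠ 0 := by rwa [curve_Δ]
  have hp0 : (0 : ℝ) < p := by exact_mod_cast hp.out.pos
  by_cases h5 : p < 5
  · have hA : AdditiveAt (curve A B t) p := by
      have hp2 := hp.out.two_le
      interval_cases p
      · exact (hadd t ht).1
      · exact (hadd t ht).2
      · exact absurd hp.out (by norm_num)
    have hdvd : p ∣ conductor (curve A B t) :=
      (dvd_conductor_iff _ h0).mpr (additiveAt_not_goodAt hA)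
    have hl : lam (curve A B t) p = 0 := by rw [lam, traceAt_of_additiveAt _ hA]; simp
    rw [localSum_eq_zero_of_lt_five hΔ hadd h5 _ hm, satakeAlpha, satakeBeta, if_pos hdvd,
      if_pos hdvd, hl]
    simp [hm]
  · have h5' : 5 ≤ p := not_lt.mp h5
    have hmn := hmin h5'
    have htr : lam (curve A B t) p = aMod A B p t / √(p : ℝ) := by
      rw [lam, traceAt_eq_aMod h5' A B t hmn h0]
    by_cases hb : aeval (t : ZMod p) (discPoly A B) = 0
    · have hdvd : p ∣ conductor (curve A B t) := by
        rw [dvd_conductor_iff _ h0, goodAt_iff_not_dvd_of_minimalAt _ hmn, not_not,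
          dvd_eval_disc_iff]
        exact hb
      rw [localSum, if_pos hb, satakeAlpha, satakeBeta, if_pos hdvd, if_pos hdvd, zero_pow hm,
        add_zero, htr, div_sqrt_pow_eq hp0]
    · have hdvd : ¬ p ∣ conductor (curve A B t) := by
        rw [dvd_conductor_iff _ h0, goodAt_iff_not_dvd_of_minimalAt _ hmn, not_not,
          dvd_eval_disc_iff]
        exact hb
      rw [localSum, if_neg hb, satakeAlpha, satakeBeta, if_neg hdvd, if_neg hdvd, htr]
      set l : ℂ := ((aMod A B p t / √(p : ℝ) : ℝ) : ℂ) with hl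
      set w : ℂ := (l ^ 2 - 4) ^ (1 / 2 : ℂ) with hw
      have hw2 : w ^ 2 = l ^ 2 - 4 := by
        have := Complex.cpow_nat_inv_pow (l ^ 2 - 4) (n := 2) (by norm_num)
        rw [hw]
        convert this using 3
        norm_num
      have hsC : ((√(p : ℝ) : ℝ) : ℂ) ≠ 0 := by
        exact_mod_cast (Real.sqrt_pos.mpr hp0).ne'
      have hss : ((√(p : ℝ) : ℝ) : ℂ) * ((√(p : ℝ) : ℝ) : ℂ) = p := by
        exact_mod_cast Real.mul_self_sqrt hp0.le
      have hpC : (p : ℂ) ≠ 0 := by exact_mod_cast hp0.ne'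
      set r : ℂ := ((√(p : ℝ) : ℝ) : ℂ)
      have hlr : l = (aMod A B p t : ℂ) / r := by rw [hl]; push_cast; rfl
      rw [powerSum_eq (u := (l + w) / 2 / r) (v := (l - w) / 2 / r)]
      · push_cast
        rw [div_pow _ r, div_pow _ r, ← add_div]
      · push_cast
        rw [← add_div, ← hss, ← div_div, ← hlr]
        ring
      · push_cast
        rw [← hss]
        field_simp
        linear_combination -hw2

end LocalTerms

/-! ### Bounds for the terms of the expansion -/

/-- `log p / p^{3/2}`. -/
def weight (p : ℕ) : ℝ := Real.log p / √(p : ℝ) ^ 3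

lemma weight_nonneg (p : ℕ) : 0 ≤ weight p :=
  div_nonneg (Real.log_natCast_nonneg p) (by positivity)

/-- The extra `log²` comes from the quadratic bound for `g x - g 0`. A loss of `p ^ (1/4)` absorbs
all three logarithms, with constant `12³ = 1728`. -/
lemma summable_weight_mul_log_sq :
    Summable fun p : Nat.Primes => weight p * Real.log p ^ 2 := by
  refine Summable.of_nonneg_of_le
    (fun p => mul_nonneg (weight_nonneg _) (sq_nonneg _)) (fun p => ?_)
    ((Nat.Primes.summable_rpow.mpr (by norm_num : (-(5 / 4) : ℝ) < -1)).mul_left 1728)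
  have hp : (0 : ℝ) < (p : ℕ) := by exact_mod_cast p.2.pos
  have h1 := Real.log_le_rpow_div hp.le (by norm_num : (0 : ℝ) < 1 / 12)
  have h0 := Real.log_natCast_nonneg (p : ℕ)
  have e1 : √((p : ℕ) : ℝ) ^ 3 = ((p : ℕ) : ℝ) ^ (3 / 2 : ℝ) := by
    rw [Real.sqrt_eq_rpow, ← Real.rpow_natCast, ← Real.rpow_mul hp.le]; norm_num
  have e2 : (((p : ℕ) : ℝ) ^ (1 / 12 : ℝ) / (1 / 12)) ^ 3 =
      1728 * ((p : ℕ) : ℝ) ^ (1 / 4 : ℝ) := by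
    rw [div_pow, ← Real.rpow_natCast (((p : ℕ) : ℝ) ^ (1 / 12 : ℝ)), ← Real.rpow_mul hp.le]
    norm_num
    ring
  have e3 : weight p * Real.log p ^ 2 = Real.log p ^ 3 / ((p : ℕ) : ℝ) ^ (3 / 2 : ℝ) := by
    rw [weight, e1]; ring
  have e4 : ((p : ℕ) : ℝ) ^ (-(5 / 4) : ℝ) =
      ((p : ℕ) : ℝ) ^ (1 / 4 : ℝ) / ((p : ℕ) : ℝ) ^ (3 / 2 : ℝ) := by
    rw [← Real.rpow_sub hp]; norm_num
  rw [e3, e4, ← mul_div_assoc, ← e2]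
  gcongr

lemma summable_weight : Summable fun p : Nat.Primes => weight p := by
  have hl : 0 < Real.log 2 := Real.log_pos (by norm_num)
  refine Summable.of_nonneg_of_le (fun p => weight_nonneg _) (fun p => ?_)
    (summable_weight_mul_log_sq.mul_left ((Real.log 2 ^ 2)⁻¹))
  have h1 : Real.log 2 ≤ Real.log (p : ℕ) :=
    Real.log_le_log (by norm_num) (by exact_mod_cast p.2.two_le)
  have h2 : Real.log 2 ^ 2 ≤ Real.log (p : ℕ) ^ 2 := by gcongr
  rw [inv_mul_eq_div, le_div_iff₀ (by positivity)]
  exact mul_le_mul_of_nonneg_left h2 (weight_nonneg _)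

section Bounds

variable {A B : ℤ[X]} {k : ℕ∞} {C : ℝ}

open Classical in
/-- The contribution of the `t` of good reduction at `p` and of the exponent `m + 1`, without the
factor `1 / log R` and the test function. -/
def goodPart (A B : ℤ[X]) (k : ℕ∞) (p : Nat.Primes) (m : ℕ) : ℝ :=
  haveI : Fact (p : ℕ).Prime := ⟨p.2⟩
  HLog A B k p / p * ∑ t : ZMod p with aeval t (discPoly A B) ≠ 0,
    powerSum ((aMod A B p t : ℝ) / p) (1 / p) (m + 1)

lemma abs_HLog_le (hC : ∀ p : ℕ, p.Prime → 0 < sieveH (sievePoly A B) k p ∧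
      sieveH (sievePoly A B) k p ≤ C) {p : ℕ} (hp : p.Prime) :
    |HLog A B k p| ≤ C * Real.log p := by
  have h0 := Real.log_natCast_nonneg p
  rw [HLog, abs_mul, abs_of_pos (hC p hp).1, abs_of_nonneg h0]
  exact mul_le_mul_of_nonneg_right (hC p hp).2 h0

lemma HLog_mul_sum_localSum (p : Nat.Primes) (m : ℕ) :
    haveI : Fact (p : ℕ).Prime := ⟨p.2⟩
    HLog A B k p / p * ∑ t : ZMod p, localSum A B p t (m + 1) =
      termA' A B k p m + goodPart A B k p m := by
  classical
  have : Fact (p : ℕ).Prime := ⟨p.2⟩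
  have hp0 : ((p : ℕ) : ℝ) ≠ 0 := by exact_mod_cast p.2.ne_zero
  rw [termA', goodPart, calA',
    ← Finset.sum_filter_add_sum_filter_not Finset.univ
      (fun t : ZMod p => aeval t (discPoly A B) = 0), mul_add]
  congr 1
  · have : ∀ t ∈ Finset.univ.filter (fun t : ZMod p => aeval t (discPoly A B) = 0),
        localSum A B p t (m + 1) = (aMod A B p t : ℝ) ^ (m + 1) / (p : ℝ) ^ (m + 1) := by
      intro t ht
      rw [localSum, if_pos (Finset.mem_filter.mp ht).2, div_pow]
    rw [Finset.sum_congr rfl this, ← Finset.sum_div]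
    field_simp
    ring
  · congr 1
    refine Finset.sum_congr rfl fun t ht => ?_
    rw [localSum, if_neg (Finset.mem_filter.mp ht).2]

lemma goodPart_zero (p : Nat.Primes) : goodPart A B k p 0 = main1 A B k p := by
  classical
  have : Fact (p : ℕ).Prime := ⟨p.2⟩
  have hp0 : ((p : ℕ) : ℝ) ≠ 0 := by exact_mod_cast p.2.ne_zero
  simp only [goodPart, main1, calA, powerSum, pow_one]
  rw [← Finset.sum_div]
  field_simp

/-- Here `u² + v² = (a/p)² - 2/p`; the constant part is the source of the term in `S₀` that keeps
the test function. -/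
lemma goodPart_one (p : Nat.Primes) :
    goodPart A B k p 1 = main2 A B k p - main0 A B k p := by
  classical
  have : Fact (p : ℕ).Prime := ⟨p.2⟩
  have hp0 : ((p : ℕ) : ℝ) ≠ 0 := by exact_mod_cast p.2.ne_zero
  have h : ∀ a : ℝ, powerSum (a / (p : ℕ)) (1 / (p : ℕ)) (1 + 1) =
      a ^ 2 / (p : ℝ) ^ 2 - 2 / p * a ^ 0 := fun a => by
    rw [powerSum, powerSum, powerSum]
    field_simp
  simp only [goodPart, main2, main0, calA, h]
  rw [Finset.sum_sub_distrib, ← Finset.sum_div, ← Finset.mul_sum]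
  field_simp

variable (hΔ : discPoly A B ≠ 0)
  (hadd : ∀ t : ℤ, (discPoly A B).eval t ≠ 0 →
      AdditiveAt (curve A B t) 2 ∧ AdditiveAt (curve A B t) 3)

open Classical in
include hΔ hadd in
lemma sum_good_eq_zero_of_lt_five {p : ℕ} [Fact p.Prime] (h5 : p < 5) (F : ZMod p → ℝ) :
    ∑ t : ZMod p with aeval t (discPoly A B) ≠ 0, F t = 0 :=
  Finset.sum_eq_zero fun t ht =>
    absurd (aMod_eq_zero_of_lt_five hΔ hadd h5 t).1 (Finset.mem_filter.mp ht).2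

open Classical in
include hΔ hadd in
/-- A sum over the classes of good reduction is bounded by `p` times a bound for its terms. -/
lemma abs_sum_good_le {p : ℕ} [Fact p.Prime] (F : ZMod p → ℝ) {b : ℝ} (hb : 0 ≤ b)
    (hF : 5 ≤ p → ∀ t, |F t| ≤ b) :
    |∑ t : ZMod p with aeval t (discPoly A B) ≠ 0, F t| ≤ p * b := by
  by_cases h5 : p < 5
  · rw [sum_good_eq_zero_of_lt_five hΔ hadd h5, abs_zero]
    positivity
  · refine (Finset.abs_sum_le_sum_abs _ _).trans ?_
    refine (Finset.sum_le_card_nsmul _ _ b fun t _ => hF (not_lt.mp h5) t).trans ?_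
    rw [nsmul_eq_mul]
    refine mul_le_mul_of_nonneg_right ?_ hb
    have := (Finset.card_filter_le (Finset.univ : Finset (ZMod p))
      fun t => aeval t (discPoly A B) ≠ 0)
    rw [Finset.card_univ, ZMod.card] at this
    exact_mod_cast this

include hΔ hadd in
lemma abs_calA_le (p r : ℕ) [Fact p.Prime] : |calA A B r p| ≤ p * (30 * √(p : ℝ)) ^ r := by
  refine abs_sum_good_le hΔ hadd _ (by positivity) fun h5 t => ?_
  rw [abs_pow]
  gcongr
  exact abs_aMod_le_sqrt A B p (by omega) t

-- The denominator satisfies `p + 1 - a ≥ p / 3600`: for `p ≤ 3600` because `a ≤ p`, and beyond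
-- because `30√p ≤ p / 2`.
include hΔ hadd in
lemma abs_calATilde_le (p : ℕ) [hp : Fact p.Prime] : |calATilde A B p| ≤ 27000 * 3600 := by
  have hp0 : (0 : ℝ) < p := by exact_mod_cast hp.out.pos
  have : |calATilde A B p| ≤ p * (27000 * (3600 / p)) := by
    refine abs_sum_good_le hΔ hadd _ (by positivity) fun h5 t => ?_
    have ha := abs_aMod_le_sqrt A B p (by omega) t
    have ha' := abs_aMod_le A B p (by omega) t
    set a : ℝ := (aMod A B p t : ℝ)
    have hs0 : 0 < √(p : ℝ) := Real.sqrt_pos.mpr hp0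
    have hss : √(p : ℝ) * √(p : ℝ) = p := Real.mul_self_sqrt hp0.le
    have e1 : (p : ℝ) ^ (3 / 2 : ℝ) = √(p : ℝ) ^ 3 := by
      rw [Real.sqrt_eq_rpow, ← Real.rpow_natCast, ← Real.rpow_mul hp0.le]; norm_num
    have h1 : (p : ℝ) / 3600 ≤ p + 1 - a := by
      rcases le_total (p : ℝ) 3600 with h | h
      · linarith [le_abs_self a]
      · have h60 : (60 : ℝ) ≤ √(p : ℝ) := Real.le_sqrt_of_sq_le (by norm_num; exact_mod_cast h)
        nlinarith [le_abs_self a]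
    have hpa : 0 < p + 1 - a := lt_of_lt_of_le (by positivity) h1
    rw [e1, abs_div, abs_mul, abs_pow, abs_of_pos hpa, abs_of_pos (pow_pos hs0 3),
      div_le_iff₀ (by positivity)]
    calc |a| ^ 3 ≤ (30 * √(p : ℝ)) ^ 3 := by gcongr
      _ = 27000 * (3600 / p) * (√(p : ℝ) ^ 3 * (p / 3600)) := by field_simp; norm_num
      _ ≤ 27000 * (3600 / p) * (√(p : ℝ) ^ 3 * (p + 1 - a)) := by gcongr
  refine this.trans (le_of_eq ?_)
  field_simp

lemma div_le_weight_mul {p : ℕ} (hp : p.Prime) {x c : ℝ} (hx : x ≤ c * Real.log p) (n : ℕ)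
    (hc : 0 ≤ c) (hn : 3 ≤ n) : x / √(p : ℝ) ^ n ≤ c * weight p := by
  have hs1 : (1 : ℝ) ≤ √(p : ℝ) := Real.one_le_sqrt.mpr (by exact_mod_cast hp.one_lt.le)
  have hl := Real.log_natCast_nonneg p
  rw [weight, ← mul_div_assoc]
  calc x / √(p : ℝ) ^ n ≤ c * Real.log p / √(p : ℝ) ^ n := by gcongr
    _ ≤ c * Real.log p / √(p : ℝ) ^ 3 := by gcongr

variable (hC0 : 0 ≤ C) (hC : ∀ p : ℕ, p.Prime → 0 < sieveH (sievePoly A B) k p ∧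
      sieveH (sievePoly A B) k p ≤ C)

include hΔ hadd hC0 hC

lemma abs_term0_le (p : Nat.Primes) : |term0 A B k p| ≤ 2 * C * weight p := by
  have : Fact (p : ℕ).Prime := ⟨p.2⟩
  have hp0 : (0 : ℝ) < (p : ℕ) := by exact_mod_cast p.2.pos
  have hs : √((p : ℕ) : ℝ) ^ 2 = (p : ℕ) := Real.sq_sqrt hp0.le
  have hs0 : 0 < √((p : ℕ) : ℝ) := Real.sqrt_pos.mpr hp0
  have hA := abs_calA_le hΔ hadd p 0
  have hH := abs_HLog_le hC p.2
  have hl := Real.log_natCast_nonneg (p : ℕ)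
  rw [term0, abs_div, abs_mul, abs_mul, abs_of_pos (by positivity : (0 : ℝ) < 2),
    abs_of_pos (by positivity : 0 < ((p : ℕ) : ℝ) ^ 2 * (((p : ℕ) : ℝ) + 1))]
  rw [pow_zero, mul_one] at hA
  calc _ ≤ 2 * (p : ℕ) * (C * Real.log (p : ℕ)) / (((p : ℕ) : ℝ) ^ 2 * (p : ℕ)) := by
        gcongr
        linarith
    _ = 2 * C * Real.log (p : ℕ) / √((p : ℕ) : ℝ) ^ 4 := by
        generalize Real.log ((p : ℕ) : ℝ) = l
        generalize √((p : ℕ) : ℝ) = s at hs hs0 ⊢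
        rw [← hs]
        field_simp
    _ ≤ _ := div_le_weight_mul p.2 le_rfl 4 (by positivity) (by norm_num)

lemma abs_term1_le (p : Nat.Primes) : |term1 A B k p| ≤ 120 * C * weight p := by
  have : Fact (p : ℕ).Prime := ⟨p.2⟩
  have hp1 : (1 : ℝ) ≤ (p : ℕ) := by exact_mod_cast p.2.one_lt.le
  have hp0 : (0 : ℝ) < (p : ℕ) := by linarith
  have hs : √((p : ℕ) : ℝ) ^ 2 = (p : ℕ) := Real.sq_sqrt hp0.le
  have hs0 : 0 < √((p : ℕ) : ℝ) := Real.sqrt_pos.mpr hp0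
  have hA := abs_calA_le hΔ hadd p 1
  have hH := abs_HLog_le hC p.2
  have hl := Real.log_natCast_nonneg (p : ℕ)
  rw [term1, abs_div, abs_mul, abs_mul,
    abs_of_pos (by positivity : 0 < ((p : ℕ) : ℝ) ^ 2 * (((p : ℕ) : ℝ) + 1) ^ 2),
    abs_of_pos (by positivity : 0 < 3 * ((p : ℕ) : ℝ) + 1)]
  rw [pow_one] at hA
  calc _ ≤ (p : ℕ) * (30 * √((p : ℕ) : ℝ)) * (C * Real.log (p : ℕ)) * (4 * (p : ℕ)) /
        (((p : ℕ) : ℝ) ^ 2 * ((p : ℕ) : ℝ) ^ 2) := by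
        gcongr <;> linarith
    _ = 120 * C * Real.log (p : ℕ) / √((p : ℕ) : ℝ) ^ 3 := by
        generalize Real.log ((p : ℕ) : ℝ) = l
        generalize √((p : ℕ) : ℝ) = s at hs hs0 ⊢
        rw [← hs]
        field_simp
        ring
    _ ≤ _ := div_le_weight_mul p.2 le_rfl 3 (by positivity) (by norm_num)

lemma abs_term2_le (p : Nat.Primes) : |term2 A B k p| ≤ 7200 * C * weight p := by
  have : Fact (p : ℕ).Prime := ⟨p.2⟩
  have hp1 : (1 : ℝ) ≤ (p : ℕ) := by exact_mod_cast p.2.one_lt.le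
  have hp0 : (0 : ℝ) < (p : ℕ) := by linarith
  have hs : √((p : ℕ) : ℝ) ^ 2 = (p : ℕ) := Real.sq_sqrt hp0.le
  have hs0 : 0 < √((p : ℕ) : ℝ) := Real.sqrt_pos.mpr hp0
  have hA := abs_calA_le hΔ hadd p 2
  have hH := abs_HLog_le hC p.2
  have hl := Real.log_natCast_nonneg (p : ℕ)
  rw [term2, abs_div, abs_mul, abs_mul,
    abs_of_pos (by positivity : 0 < ((p : ℕ) : ℝ) ^ 3 * (((p : ℕ) : ℝ) + 1) ^ 3),
    abs_of_pos (by positivity : 0 < 4 * ((p : ℕ) : ℝ) ^ 2 + 3 * (p : ℕ) + 1)]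
  rw [mul_pow, hs] at hA
  calc _ ≤ (p : ℕ) * (30 ^ 2 * (p : ℕ)) * (C * Real.log (p : ℕ)) * (8 * ((p : ℕ) : ℝ) ^ 2) /
        (((p : ℕ) : ℝ) ^ 3 * ((p : ℕ) : ℝ) ^ 3) := by
        gcongr
        · nlinarith
        · linarith
    _ = 7200 * C * Real.log (p : ℕ) / (√((p : ℕ) : ℝ) ^ 2) ^ 2 := by
        rw [hs]; field_simp; ring
    _ = 7200 * C * Real.log (p : ℕ) / √((p : ℕ) : ℝ) ^ 4 := by rw [← pow_mul]
    _ ≤ _ := div_le_weight_mul p.2 le_rfl 4 (by positivity) (by norm_num)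

lemma abs_termTilde_le (p : Nat.Primes) :
    |termTilde A B k p| ≤ 27000 * 3600 * C * weight p := by
  have : Fact (p : ℕ).Prime := ⟨p.2⟩
  have hp1 : (1 : ℝ) ≤ (p : ℕ) := by exact_mod_cast p.2.one_lt.le
  have hp0 : (0 : ℝ) < (p : ℕ) := by linarith
  have hs : √((p : ℕ) : ℝ) ^ 2 = (p : ℕ) := Real.sq_sqrt hp0.le
  have hs0 : 0 < √((p : ℕ) : ℝ) := Real.sqrt_pos.mpr hp0
  have e1 : ((p : ℕ) : ℝ) ^ (3 / 2 : ℝ) = √((p : ℕ) : ℝ) ^ 3 := by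
    rw [Real.sqrt_eq_rpow, ← Real.rpow_natCast, ← Real.rpow_mul hp0.le]; norm_num
  have hA := abs_calATilde_le hΔ hadd p
  have hH := abs_HLog_le hC p.2
  have hl := Real.log_natCast_nonneg (p : ℕ)
  rw [termTilde, e1, abs_div, abs_mul, abs_mul, abs_mul,
    abs_of_pos (by positivity : 0 < ((p : ℕ) : ℝ) * (((p : ℕ) : ℝ) + 1) ^ 3),
    abs_of_nonneg (by linarith : 0 ≤ ((p : ℕ) : ℝ) - 1), abs_of_pos (pow_pos hs0 3)]
  calc _ ≤ 27000 * 3600 * (C * Real.log (p : ℕ)) * √((p : ℕ) : ℝ) ^ 3 * (p : ℕ) /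
        (((p : ℕ) : ℝ) * ((p : ℕ) : ℝ) ^ 3) := by
        gcongr <;> linarith
    _ = 27000 * 3600 * C * Real.log (p : ℕ) / √((p : ℕ) : ℝ) ^ 3 := by
        generalize Real.log ((p : ℕ) : ℝ) = l
        generalize √((p : ℕ) : ℝ) = s at hs hs0 ⊢
        rw [← hs]
        field_simp
    _ ≤ _ := div_le_weight_mul p.2 le_rfl 3 (by positivity) (by norm_num)

end Bounds

/-! ### Double series over primes and exponents -/

/-- The ratio of a geometric series that dominates all the local series. -/
def theta : ℝ := 3843 / 3844

lemma theta_nonneg : 0 ≤ theta := by norm_num [theta]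

lemma theta_lt_one : theta < 1 := by norm_num [theta]

lemma summable_weight_mul_theta :
    Summable fun x : Nat.Primes × ℕ => weight x.1 * theta ^ x.2 :=
  Summable.mul_of_nonneg summable_weight (summable_geometric_of_lt_one theta_nonneg theta_lt_one)
    (fun _ => weight_nonneg _) fun _ => pow_nonneg theta_nonneg _

lemma summable_weight_mul_sq_mul_theta (i : ℕ) :
    Summable fun x : Nat.Primes × ℕ =>
      weight x.1 * Real.log x.1 ^ 2 * (((x.2 : ℝ) + i) ^ 2 * theta ^ x.2) := by
  have hθ : ‖theta‖ < 1 := by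
    rw [Real.norm_of_nonneg theta_nonneg]; exact theta_lt_one
  have h : Summable fun m : ℕ => ((m : ℝ) + i) ^ 2 * theta ^ m := by
    have h2 := summable_pow_mul_geometric_of_norm_lt_one 2 hθ
    have h1 := summable_pow_mul_geometric_of_norm_lt_one 1 hθ
    have h0 := summable_pow_mul_geometric_of_norm_lt_one 0 hθ
    refine ((h2.add (h1.mul_left (2 * (i : ℝ)))).add (h0.mul_left ((i : ℝ) ^ 2))).congr fun m => ?_
    ring
  exact Summable.mul_of_nonneg summable_weight_mul_log_sq h
    (fun p => mul_nonneg (weight_nonneg _) (sq_nonneg _))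
    fun m => mul_nonneg (sq_nonneg _) (pow_nonneg theta_nonneg _)

lemma summable_of_abs_le_weight {f : Nat.Primes × ℕ → ℝ} {R : ℝ}
    (hf : ∀ x, |f x| ≤ R * (weight x.1 * theta ^ x.2)) : Summable f :=
  Summable.of_norm_bounded (summable_weight_mul_theta.mul_left R) hf

/-- Replacing an even test function by its value at `0` in a rapidly convergent double series. -/
lemma norm_tsum_mul_sub_le {f : Nat.Primes × ℕ → ℝ} {R K : ℝ} (i : ℕ)
    (hf : ∀ x, |f x| ≤ R * (weight x.1 * theta ^ x.2)) {g : ℝ → ℂ}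
    (hg : ∀ x, ‖g x - g 0‖ ≤ K * x ^ 2) {L : ℝ} (hL : 0 < L) :
    Summable (fun x : Nat.Primes × ℕ => ((f x / L : ℝ) : ℂ) *
      (g (((x.2 : ℝ) + i) * (Real.log x.1 / L)) - g 0)) ∧
    ‖∑' x : Nat.Primes × ℕ, ((f x / L : ℝ) : ℂ) *
      (g (((x.2 : ℝ) + i) * (Real.log x.1 / L)) - g 0)‖ ≤
    R * K * (∑' x : Nat.Primes × ℕ,
      weight x.1 * Real.log x.1 ^ 2 * (((x.2 : ℝ) + i) ^ 2 * theta ^ x.2)) / L ^ 3 := by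
  have hb : ∀ x : Nat.Primes × ℕ, ‖((f x / L : ℝ) : ℂ) *
      (g (((x.2 : ℝ) + i) * (Real.log x.1 / L)) - g 0)‖ ≤ R * K / L ^ 3 *
      (weight x.1 * Real.log x.1 ^ 2 * (((x.2 : ℝ) + i) ^ 2 * theta ^ x.2)) := by
    intro x
    rw [norm_mul, Complex.norm_real, Real.norm_eq_abs, abs_div, abs_of_pos hL]
    calc _ ≤ R * (weight x.1 * theta ^ x.2) / L * (K * (((x.2 : ℝ) + i) * (Real.log x.1 / L)) ^ 2) := by
          refine mul_le_mul (div_le_div_of_nonneg_right (hf x) hL.le) (hg _) (norm_nonneg _) ?_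
          exact div_nonneg ((abs_nonneg _).trans (hf x)) hL.le
      _ = _ := by field_simp
  have hs := (summable_weight_mul_sq_mul_theta i).mul_left (R * K / L ^ 3)
  refine ⟨Summable.of_norm_bounded hs hb, ?_⟩
  refine (tsum_of_norm_bounded hs.hasSum hb).trans (le_of_eq ?_)
  rw [tsum_mul_left]
  ring

/-! ### Domination of the bad terms and of the exponents from `3` on, and the closed form of the
local series -/

section Bounds

variable {A B : ℤ[X]} {k : ℕ∞} {C : ℝ}

-- When `p` does not divide the content, `Δ` stays nonzero modulo `p` and has at most `deg Δ` roots,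
-- so the bad classes are bounded in number independently of `p`.
open Classical in
lemma card_bad_le {p : ℕ} [Fact p.Prime]
    (hp : ¬ (p : ℤ) ∣ (discPoly A B).content) :
    (Finset.univ.filter fun t : ZMod p => aeval t (discPoly A B) = 0).card ≤
      (discPoly A B).natDegree := by
  set P := (discPoly A B).map (Int.castRingHom (ZMod p)) with hP
  have hP0 : P ≠ 0 := by
    intro h0
    refine hp ?_
    rw [dvd_content_iff_C_dvd, C_dvd_iff_dvd_coeff]
    intro i
    have := congrArg (fun Q : (ZMod p)[X] => Q.coeff i) h0
    simp only [hP, coeff_map, coeff_zero, eq_intCast] at this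
    exact (ZMod.intCast_zmod_eq_zero_iff_dvd _ _).mp this
  have hsub : (Finset.univ.filter fun t : ZMod p => aeval t (discPoly A B) = 0) ⊆
      P.roots.toFinset := by
    intro t ht
    rw [Multiset.mem_toFinset, mem_roots hP0, IsRoot.def, hP, eval_map]
    exact (Finset.mem_filter.mp ht).2
  calc _ ≤ P.roots.toFinset.card := Finset.card_le_card hsub
    _ ≤ P.roots.card := Multiset.toFinset_card_le _
    _ ≤ P.natDegree := card_roots' P
    _ ≤ _ := natDegree_map_le

variable (hcontent : ∀ p : ℕ, p.Prime → (p : ℤ) ∣ (discPoly A B).content → p = 2 ∨ p = 3)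
  (hadd : ∀ t : ℤ, (discPoly A B).eval t ≠ 0 →
      AdditiveAt (curve A B t) 2 ∧ AdditiveAt (curve A B t) 3)
  (hC0 : 0 ≤ C) (hC : ∀ p : ℕ, p.Prime → 0 < sieveH (sievePoly A B) k p ∧
      sieveH (sievePoly A B) k p ≤ C)

include hcontent hadd

lemma abs_calA'_le {p m : ℕ} [hp : Fact p.Prime] (hm : m ≠ 0) :
    |calA' A B m p| ≤ (discPoly A B).natDegree := by
  classical
  by_cases h5 : p < 5
  · have : calA' A B m p = 0 := Finset.sum_eq_zero fun t _ => by
      rw [(aMod_eq_zero_of_lt_five (discPoly_ne_zero hcontent) hadd h5 t).2]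
      simp [hm]
    rw [this, abs_zero]
    positivity
  · rw [calA']
    refine (Finset.abs_sum_le_sum_abs _ _).trans ?_
    refine (Finset.sum_le_card_nsmul _ _ 1 fun t ht => ?_).trans ?_
    · rw [abs_pow]
      refine pow_le_one₀ (abs_nonneg _) ?_
      exact_mod_cast abs_aMod_le_one (not_lt.mp h5) A B t (Finset.mem_filter.mp ht).2
    · rw [nsmul_eq_mul, mul_one]
      have hnd : ¬ (p : ℤ) ∣ (discPoly A B).content := fun h => by
        have := hcontent p hp.out h
        omega
      exact_mod_cast card_bad_le hnd

include hC0 hC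

lemma abs_termA'_le (p : Nat.Primes) (m : ℕ) :
    |termA' A B k p m| ≤ (discPoly A B).natDegree * C * (weight p * theta ^ m) := by
  have : Fact (p : ℕ).Prime := ⟨p.2⟩
  have hp2 : (2 : ℝ) ≤ (p : ℕ) := by exact_mod_cast p.2.two_le
  have hp0 : (0 : ℝ) < (p : ℕ) := by linarith
  have hA := abs_calA'_le hcontent hadd (p := p) (Nat.succ_ne_zero m)
  have hH := abs_HLog_le hC p.2
  have hl := Real.log_natCast_nonneg (p : ℕ)
  have hs : √((p : ℕ) : ℝ) ^ 2 = (p : ℕ) := Real.sq_sqrt hp0.le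
  have hw := div_le_weight_mul p.2 (x := Real.log (p : ℕ)) (c := 1) (by rw [one_mul]) 4
    (by norm_num) (by norm_num)
  have hθ : (1 / ((p : ℕ) : ℝ)) ^ m ≤ theta ^ m := by
    refine pow_le_pow_left₀ (by positivity) ?_ m
    calc 1 / ((p : ℕ) : ℝ) ≤ 1 / 2 := one_div_le_one_div_of_le (by norm_num) hp2
      _ ≤ theta := by norm_num [theta]
  have e1 : √((p : ℕ) : ℝ) ^ 4 = ((p : ℕ) : ℝ) ^ 2 := by rw [← hs]; ring_nf; rw [hs]
  rw [e1, one_mul] at hw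
  rw [termA', abs_div, abs_mul, abs_of_pos (pow_pos hp0 _)]
  calc _ ≤ (discPoly A B).natDegree * (C * Real.log (p : ℕ)) / ((p : ℕ) : ℝ) ^ (m + 2) := by
        gcongr
    _ = (discPoly A B).natDegree * C *
        (Real.log (p : ℕ) / ((p : ℕ) : ℝ) ^ 2 * (1 / ((p : ℕ) : ℝ)) ^ m) := by
        rw [pow_add, div_pow, one_pow]
        field_simp
    _ ≤ _ := by
        gcongr
        exact weight_nonneg p

/-- The index `m + 2` means exponent `m + 3`: three factors of the root bound give `p ^ (-3/2)`, and
the others give the geometric factor. Exponents `1` and `2` lack this decay and keep the test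
function. -/
lemma abs_goodPart_le (p : Nat.Primes) (m : ℕ) :
    |goodPart A B k p (m + 2)| ≤ 2 * 31 ^ 3 * C * (weight p * theta ^ m) := by
  have : Fact (p : ℕ).Prime := ⟨p.2⟩
  have hp2 : (2 : ℝ) ≤ (p : ℕ) := by exact_mod_cast p.2.two_le
  have hp0 : (0 : ℝ) < (p : ℕ) := by linarith
  have hH := abs_HLog_le hC p.2
  have hl := Real.log_natCast_nonneg (p : ℕ)
  have hr0 := rootBound_nonneg (by linarith : (1 : ℝ) ≤ (p : ℕ))
  have hsum := abs_sum_good_le (discPoly_ne_zero hcontent) hadd (p := p)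
    (fun t => powerSum ((aMod A B p t : ℝ) / p) (1 / p) (m + 2 + 1))
    (b := 2 * rootBound (p : ℕ) ^ (m + 3)) (by positivity) fun h5 t =>
      abs_powerSum_le (by have : (5 : ℝ) ≤ (p : ℕ) := (by exact_mod_cast h5); linarith)
        (abs_aMod_le A B p (by omega) t) (abs_aMod_le_sqrt A B p (by omega) t) _
  have hr : rootBound (p : ℕ) ^ (m + 3) ≤ theta ^ m * (31 ^ 3 / √((p : ℕ) : ℝ) ^ 3) := by
    rw [pow_add, ← div_pow]
    have h1 : rootBound (p : ℕ) ≤ theta := by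
      have := rootBound_le hp0
      norm_num [theta] at this ⊢
      exact this
    have h2 : rootBound (p : ℕ) ≤ 31 / √((p : ℕ) : ℝ) := min_le_right _ _
    exact mul_le_mul (pow_le_pow_left₀ hr0 h1 m) (pow_le_pow_left₀ hr0 h2 3) (by positivity)
      (pow_nonneg theta_nonneg m)
  rw [goodPart, abs_mul, abs_div, Nat.abs_cast]
  calc _ ≤ C * Real.log (p : ℕ) / (p : ℕ) * ((p : ℕ) * (2 * rootBound (p : ℕ) ^ (m + 3))) :=
        mul_le_mul (by gcongr) hsum (abs_nonneg _) (by positivity)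
    _ = 2 * C * Real.log (p : ℕ) * rootBound (p : ℕ) ^ (m + 3) := by field_simp
    _ ≤ 2 * C * Real.log (p : ℕ) * (theta ^ m * (31 ^ 3 / √((p : ℕ) : ℝ) ^ 3)) := by gcongr
    _ = _ := by rw [weight]; ring

omit hC0 hC in
lemma hasSum_goodPart (p : Nat.Primes) :
    HasSum (fun m => goodPart A B k p (m + 2))
      (term0 A B k p - term1 A B k p - term2 A B k p + termTilde A B k p) := by
  classical
  have : Fact (p : ℕ).Prime := ⟨p.2⟩
  have hp0 : (0 : ℝ) < (p : ℕ) := by exact_mod_cast p.2.pos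
  by_cases h5 : (p : ℕ) < 5
  · have hz := fun F => sum_good_eq_zero_of_lt_five (discPoly_ne_zero hcontent) hadd (p := p) h5 F
    simp only [goodPart, term0, term1, term2, termTilde, calA, calATilde, hz]
    simp
  · have h5' : 5 ≤ (p : ℕ) := not_lt.mp h5
    have hp5 : (5 : ℝ) ≤ (p : ℕ) := by exact_mod_cast h5'
    have h := (hasSum_sum (s := Finset.univ.filter fun t : ZMod p => aeval t (discPoly A B) ≠ 0)
      fun t _ => hasSum_powerSum (p := (p : ℕ)) (a := (aMod A B p t : ℝ)) (by linarith)
        (abs_aMod_le A B p (by omega) t)).mul_left (HLog A B k p / (p : ℕ))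
    refine Eq.subst (motive := fun z => HasSum (fun m => goodPart A B k p (m + 2)) z) ?_ h
    symm
    rw [Finset.sum_add_distrib, Finset.sum_sub_distrib, Finset.sum_sub_distrib, mul_add, mul_sub,
      mul_sub]
    simp only [term0, term1, term2, termTilde, calA, calATilde]
    have e32 : (0 : ℝ) < ((p : ℕ) : ℝ) ^ (3 / 2 : ℝ) := Real.rpow_pos_of_pos hp0 _
    congr 1
    · congr 1
      · congr 1
        · simp only [pow_zero, Finset.sum_const, nsmul_eq_mul]
          field_simp
        · rw [Finset.mul_sum, Finset.sum_mul, Finset.sum_mul, Finset.sum_div]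
          refine Finset.sum_congr rfl fun t _ => ?_
          field_simp
      · rw [Finset.mul_sum, Finset.sum_mul, Finset.sum_mul, Finset.sum_div]
        refine Finset.sum_congr rfl fun t _ => ?_
        field_simp
    · rw [Finset.mul_sum, Finset.sum_mul, Finset.sum_mul, Finset.sum_mul, Finset.sum_div]
      refine Finset.sum_congr rfl fun t _ => ?_
      have : ((p : ℕ) : ℝ) + 1 - (aMod A B p t : ℝ) ≠ 0 := by
        have := (le_abs_self _).trans (abs_aMod_le A B p (by omega) t)
        linarith
      field_simp

/-- The series in the expansion converge absolutely. -/
lemma summable_terms :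
    Summable (fun x : Nat.Primes × ℕ => termA' A B k x.1 x.2) ∧
      Summable (term0 A B k) ∧ Summable (term1 A B k) ∧
      Summable (term2 A B k) ∧ Summable (termTilde A B k) := by
  have hΔ := discPoly_ne_zero hcontent
  exact ⟨summable_of_abs_le_weight fun x => abs_termA'_le hcontent hadd hC0 hC x.1 x.2,
    Summable.of_norm_bounded (summable_weight.mul_left _) (abs_term0_le hΔ hadd hC0 hC),
    Summable.of_norm_bounded (summable_weight.mul_left _) (abs_term1_le hΔ hadd hC0 hC),
    Summable.of_norm_bounded (summable_weight.mul_left _) (abs_term2_le hΔ hadd hC0 hC),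
    Summable.of_norm_bounded (summable_weight.mul_left _) (abs_termTilde_le hΔ hadd hC0 hC)⟩

end Bounds

/-! ### Test functions -/

lemma fourier_neg_of_even {f : ℝ → ℂ} (hf : ∀ x, f (-x) = f x) (x : ℝ) : 𝓕 f (-x) = 𝓕 f x := by
  rw [← Real.fourierInv_eq_fourier_neg, Real.fourierInv_eq_fourier_comp_neg]
  simp only [hf]

/-- Evenness kills the derivative at `0`, and the second derivative is bounded; two applications of
the mean value inequality give the quadratic bound. -/
lemma exists_norm_sub_le_sq (ψ : 𝓢(ℝ, ℂ)) (hψ : ∀ x, ψ (-x) = ψ x) :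
    ∃ K : ℝ, 0 ≤ K ∧ ∀ x, ‖ψ x - ψ 0‖ ≤ K * x ^ 2 := by
  set ψ' := derivCLM ℂ ℂ ψ with hψ'
  have hd : ∀ x, deriv ψ x = ψ' x := fun x => rfl
  have h0 : ψ' 0 = 0 := by
    have h1 := deriv_comp_neg (⇑ψ) 0
    simp only [hψ, neg_zero] at h1
    rw [← hd]
    exact self_eq_neg.mp h1
  obtain ⟨K, hK, hKb⟩ := ψ'.decay 0 1
  have hK' : ∀ x, ‖deriv ψ' x‖ ≤ K := fun x => by
    have := hKb x
    rwa [pow_zero, one_mul, norm_iteratedFDeriv_eq_norm_iteratedDeriv, iteratedDeriv_one] at this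
  have h1 : ∀ x, ‖ψ' x‖ ≤ K * |x| := fun x => by
    have := convex_univ.norm_image_sub_le_of_norm_deriv_le (f := ψ') (x := 0) (y := x)
      (fun y _ => ψ'.differentiableAt) (fun y _ => hK' y) (Set.mem_univ _) (Set.mem_univ _)
    rwa [h0, sub_zero, sub_zero, Real.norm_eq_abs] at this
  refine ⟨K, hK.le, fun x => ?_⟩
  have := (convex_closedBall (0 : ℝ) |x|).norm_image_sub_le_of_norm_deriv_le (f := ψ) (x := 0)
    (y := x) (C := K * |x|) (fun y _ => ψ.differentiableAt) (fun y hy => by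
      rw [hd]
      refine (h1 y).trans (mul_le_mul_of_nonneg_left ?_ hK.le)
      simpa using hy) (by simp) (by simp)
  rw [sub_zero, Real.norm_eq_abs] at this
  calc _ ≤ K * |x| * |x| := this
    _ = K * x ^ 2 := by rw [mul_assoc, ← pow_two, sq_abs]

lemma exists_testFunction_bounds (φ : 𝓢(ℝ, ℂ)) (hφ : ∀ x, φ (-x) = φ x) :
    ∃ G K : ℝ, 0 ≤ G ∧ 0 ≤ K ∧ (∀ x, ‖𝓕 (φ : ℝ → ℂ) x‖ ≤ G) ∧
      ∀ x, ‖𝓕 (φ : ℝ → ℂ) x - 𝓕 (φ : ℝ → ℂ) 0‖ ≤ K * x ^ 2 := by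
  rw [← fourier_coe]
  obtain ⟨G, hG, hGb⟩ := (𝓕 φ).decay 0 0
  obtain ⟨K, hK, hKb⟩ := exists_norm_sub_le_sq (𝓕 φ) fun x => by
    rw [fourier_coe]; exact fourier_neg_of_even hφ x
  refine ⟨G, K, hG.le, hK, fun x => ?_, hKb⟩
  have := hGb x
  rwa [pow_zero, one_mul, norm_iteratedFDeriv_zero] at this

/-! ### Prime powers of bounded size -/

/-- The primes less than `n`. -/
def primesLT (n : ℕ) : Finset Nat.Primes := (Finset.range n).subtype Nat.Prime

lemma card_primesLT_le (n : ℕ) : (primesLT n).card ≤ n := by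
  refine (Finset.card_subtype Nat.Prime (Finset.range n)).le.trans ?_
  exact (Finset.card_filter_le _ _).trans (Finset.card_range n).le

lemma mem_primesLT {n : ℕ} {p : Nat.Primes} (h : (p : ℕ) < n) : p ∈ primesLT n :=
  Finset.mem_subtype.mpr (Finset.mem_range.mpr h)

/-- A finite set that contains all `(p, m)` with `p ^ (m + 1) < X`. -/
def primeBox (X : ℝ) : Finset (Nat.Primes × ℕ) :=
  primesLT ⌈X⌉₊ ×ˢ Finset.range ⌈X⌉₊

lemma card_primeBox_le {X : ℝ} (hX : 1 ≤ X) : ((primeBox X).card : ℝ) ≤ (2 * X) ^ 2 := by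
  have h1 : (primeBox X).card ≤ ⌈X⌉₊ ^ 2 := by
    rw [primeBox, Finset.card_product, Finset.card_range, pow_two]
    exact Nat.mul_le_mul_right _ (card_primesLT_le _)
  have h2 : (⌈X⌉₊ : ℝ) ≤ 2 * X := by linarith [Nat.ceil_lt_add_one (zero_le_one.trans hX)]
  calc ((primeBox X).card : ℝ) ≤ (⌈X⌉₊ : ℝ) ^ 2 := by exact_mod_cast h1
    _ ≤ _ := by gcongr

lemma prime_lt_exp {p : Nat.Primes} {m : ℕ} {σ L : ℝ} (hL : 0 < L)
    (h : ((m : ℝ) + 1) * (Real.log p / L) < σ) :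
    ((p : ℕ) : ℝ) ^ (m + 1) < Real.exp (σ * L) := by
  have hp : (0 : ℝ) < (p : ℕ) := by exact_mod_cast p.2.pos
  rw [← mul_div_assoc, div_lt_iff₀ hL] at h
  rw [← Real.log_lt_iff_lt_exp (pow_pos hp _), Real.log_pow]
  push_cast
  exact h

lemma mem_primeBox {p : Nat.Primes} {m : ℕ} {X : ℝ} (h : ((p : ℕ) : ℝ) ^ (m + 1) < X) :
    (p, m) ∈ primeBox X := by
  have h2 := p.2.two_le
  have h1 : (p : ℕ) ≤ (p : ℕ) ^ (m + 1) := Nat.le_self_pow (Nat.succ_ne_zero m) _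
  have h3 : m ≤ (p : ℕ) ^ (m + 1) :=
    (Nat.le_succ m).trans ((Nat.lt_pow_self (by omega : 1 < (p : ℕ))).le)
  have h4 : (p : ℕ) ^ (m + 1) < ⌈X⌉₊ := Nat.lt_ceil.mpr (by exact_mod_cast h)
  rw [primeBox, Finset.mem_product, Finset.mem_range]
  exact ⟨mem_primesLT (h1.trans_lt h4), h3.trans_lt h4⟩

lemma tsum_prod_eq_add_add {f : Nat.Primes × ℕ → ℂ} (hf : Summable f) :
    ∑' x, f x = ∑' p, f (p, 0) + ∑' p, f (p, 1) + ∑' x : Nat.Primes × ℕ, f (x.1, x.2 + 2) := by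
  have h2 : Summable fun x : Nat.Primes × ℕ => f (x.1, x.2 + 2) :=
    hf.comp_injective (i := fun x : Nat.Primes × ℕ => (x.1, x.2 + 2)) fun x y h => by
      simp only [Prod.mk.injEq, add_left_inj] at h
      exact Prod.ext h.1 h.2
  have h0 : Summable fun p : Nat.Primes => f (p, 0) :=
    hf.comp_injective (i := fun p : Nat.Primes => (p, 0)) fun x y h => (Prod.mk.inj h).1
  have h1 : Summable fun p : Nat.Primes => f (p, 1) :=
    hf.comp_injective (i := fun p : Nat.Primes => (p, 1)) fun x y h => (Prod.mk.inj h).1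
  rw [hf.tsum_prod, h2.tsum_prod, ← h0.tsum_add h1, ← (h0.add h1).tsum_add h2.prod]
  refine tsum_congr fun p => ?_
  have := (hf.prod_factor p).sum_add_tsum_nat_add 2
  rw [← this]
  simp [Finset.sum_range_succ]

section Asymptotics

variable {A B : ℤ[X]} {k : ℕ∞}

lemma mem_family {N : ℕ} {t : ℤ} (h : t ∈ family A B k N) :
    t ∈ Finset.Icc (N : ℤ) (2 * N) ∧ PowerFree k ((sievePoly A B).eval t) := by
  simpa only [family, Finset.mem_filter] using h

/-! ### The average log-conductor -/

/-- Additive reduction at `2` makes every conductor even, so `log R` is bounded away from zero. The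
upper bound converts a power saving in `N` into one in `log R` and fixes the admissible support. -/
lemma exists_logR_bounds (hΔ : discPoly A B ≠ 0)
    (hadd : ∀ t : ℤ, (discPoly A B).eval t ≠ 0 →
      AdditiveAt (curve A B t) 2 ∧ AdditiveAt (curve A B t) 3) :
    ∃ (c : ℝ) (M : ℕ), 0 < c ∧ ∀ N : ℕ, M ≤ N → 0 < (family A B k N).card →
      Real.log 2 ≤ logR A B k N ∧ logR A B k N ≤ c * Real.log N := by
  obtain ⟨M, hM⟩ := exists_forall_eval_ne_zero hΔ
  obtain ⟨C, hC1, hC⟩ := exists_abs_eval_le (discPoly A B)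
  have hlC : 0 ≤ Real.log C := Real.log_nonneg hC1
  refine ⟨3 * Real.log C + 3 * (discPoly A B).natDegree + 1, M + 3, by positivity,
    fun N hN hF => ?_⟩
  have hF' : (0 : ℝ) < (family A B k N).card := by exact_mod_cast hF
  have hN3 : (3 : ℝ) ≤ N := by exact_mod_cast (by omega : 3 ≤ N)
  have hN0 : (0 : ℝ) < N := by linarith
  have hlog1 : 1 ≤ Real.log N := by
    rw [Real.le_log_iff_exp_le hN0]
    linarith [Real.exp_one_lt_d9]
  have hterm : ∀ t ∈ family A B k N, Real.log 2 ≤ Real.log (conductor (curve A B t)) ∧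
      Real.log (conductor (curve A B t)) ≤
        (3 * Real.log C + 3 * (discPoly A B).natDegree + 1) * Real.log N := by
    intro t ht
    obtain ⟨htI, -⟩ := mem_family ht
    have ht0 := hM t (by have := (Finset.mem_Icc.mp htI).1; omega)
    have h0 : (curve A B t).Δ ≠ 0 := by rwa [curve_Δ]
    have hc0 := conductor_ne_zero _ h0
    have hc2 : 2 ≤ conductor (curve A B t) := Nat.le_of_dvd (Nat.pos_of_ne_zero hc0)
      ((dvd_conductor_iff _ h0).mpr (additiveAt_not_goodAt (hadd t ht0).1))
    refine ⟨Real.log_le_log (by norm_num) (by exact_mod_cast hc2), ?_⟩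
    have h1 : (conductor (curve A B t) : ℝ) ≤ |(((discPoly A B).eval t : ℤ) : ℝ)| ^ 3 := by
      have h2 := conductor_le _ h0
      rw [curve_Δ] at h2
      rw [← Int.cast_abs, ← Nat.cast_natAbs]
      exact_mod_cast h2
    have h2 := hC N (by omega) t htI
    have h3 : (conductor (curve A B t) : ℝ) ≤ (C * (N : ℝ) ^ (discPoly A B).natDegree) ^ 3 :=
      h1.trans (by gcongr)
    calc Real.log (conductor (curve A B t))
        ≤ Real.log ((C * (N : ℝ) ^ (discPoly A B).natDegree) ^ 3) :=
          Real.log_le_log (by exact_mod_cast Nat.pos_of_ne_zero hc0) h3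
      _ = 3 * (Real.log C + (discPoly A B).natDegree * Real.log N) := by
          rw [Real.log_pow, Real.log_mul (by linarith) (by positivity), Real.log_pow]
          norm_num
      _ ≤ _ := by nlinarith
  constructor
  · rw [logR, le_div_iff₀ hF', mul_comm, ← nsmul_eq_mul]
    exact Finset.card_nsmul_le_sum _ _ _ fun t ht => (hterm t ht).1
  · rw [logR, div_le_iff₀ hF', mul_comm, ← nsmul_eq_mul]
    exact Finset.sum_le_card_nsmul _ _ _ fun t ht => (hterm t ht).2

/-! ### Averages over the family -/

open Classical in
lemma card_family_mul_sum (F : Finset ℤ) {p : ℕ} [Fact p.Prime] (f : ZMod p → ℝ) :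
    ∑ t ∈ F, f (t : ZMod p) =
      ∑ a : ZMod p, ((F.filter fun t => t ≡ a.val [ZMOD p]).card : ℝ) * f a := by
  rw [← Finset.sum_fiberwise F (fun t : ℤ => (t : ZMod p))]
  refine Finset.sum_congr rfl fun a _ => ?_
  have hfil : (F.filter fun t => t ≡ a.val [ZMOD p]) =
      F.filter fun t : ℤ => (t : ZMod p) = a := by
    refine Finset.filter_congr fun t _ => ?_
    rw [← ZMod.intCast_eq_intCast_iff]
    simp
  rw [hfil, ← nsmul_eq_mul, ← Finset.sum_const]
  refine Finset.sum_congr rfl fun t ht => ?_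
  rw [(Finset.mem_filter.mp ht).2]

lemma localSum_eq_zero_of_pow_dvd (hΔ : discPoly A B ≠ 0)
    (hadd : ∀ t : ℤ, (discPoly A B).eval t ≠ 0 →
      AdditiveAt (curve A B t) 2 ∧ AdditiveAt (curve A B t) 3)
    (hcusp : ∀ j : ℕ, k = j → ∀ (t : ℤ) (p : ℕ), p.Prime → 5 ≤ p →
      (p : ℤ) ^ j ∣ (sievePoly A B).eval t → (p : ℤ) ∣ A.eval t ∧ (p : ℤ) ∣ B.eval t)
    {p : ℕ} [hp : Fact p.Prime] {j : ℕ} (hj : k = j) {t : ℤ}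
    (h : (p : ℤ) ^ j ∣ (sievePoly A B).eval t) {m : ℕ} (hm : m ≠ 0) :
    localSum A B p t m = 0 := by
  by_cases h5 : p < 5
  · exact localSum_eq_zero_of_lt_five hΔ hadd h5 _ hm
  · obtain ⟨h1, h2⟩ := hcusp j hj t p hp.out (not_lt.mp h5) h
    have hA : aeval (t : ZMod p) A = 0 := by
      rw [aeval_intCast_zmod]; exact (ZMod.intCast_zmod_eq_zero_iff_dvd _ _).mpr h1
    have hB : aeval (t : ZMod p) B = 0 := by
      rw [aeval_intCast_zmod]; exact (ZMod.intCast_zmod_eq_zero_iff_dvd _ _).mpr h2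
    have hbad : aeval (t : ZMod p) (discPoly A B) = 0 := by
      simp [discPoly, hA, hB]
    rw [localSum, if_pos hbad, aMod_of_cusp (not_lt.mp h5) A B _ hA hB]
    simp [hm]

/-- The average is grouped by residue classes, and each class contributes at most `2e` of error. The
density need be known only for classes in which no `t` has `p ^ j ∣ D(t)`. -/
lemma norm_average_sub_le (hΔ : discPoly A B ≠ 0)
    (hadd : ∀ t : ℤ, (discPoly A B).eval t ≠ 0 →
      AdditiveAt (curve A B t) 2 ∧ AdditiveAt (curve A B t) 3)
    (hmin : ∀ t : ℤ, (discPoly A B).eval t ≠ 0 → PowerFree k ((sievePoly A B).eval t) →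
      ∀ (p : ℕ) [Fact p.Prime], 5 ≤ p → MinimalAt (curve A B t) p)
    (hcusp : ∀ j : ℕ, k = j → ∀ (t : ℤ) (p : ℕ), p.Prime → 5 ≤ p →
      (p : ℤ) ^ j ∣ (sievePoly A B).eval t → (p : ℤ) ∣ A.eval t ∧ (p : ℤ) ∣ B.eval t)
    {N : ℕ} {e : ℝ} (he : 0 ≤ e) (hN : ∀ t ∈ family A B k N, (discPoly A B).eval t ≠ 0)
    (p : ℕ) [hp : Fact p.Prime]
    (hdist : ∀ a : ℤ,
      (∀ j : ℕ, k = j → ∀ t : ℤ, t ≡ a [ZMOD p] → ¬ (p : ℤ) ^ j ∣ (sievePoly A B).eval t) →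
      |(((family A B k N).filter (fun t => t ≡ a [ZMOD p])).card : ℝ) / (family A B k N).card -
        sieveH (sievePoly A B) k p / p| ≤ e) (m : ℕ) :
    ‖(1 / ((family A B k N).card : ℂ)) * (∑ t ∈ family A B k N,
        (satakeAlpha (curve A B t) p ^ (m + 1) + satakeBeta (curve A B t) p ^ (m + 1)) /
          ((√(p : ℝ) ^ (m + 1) : ℝ) : ℂ)) -
      ((sieveH (sievePoly A B) k p / p * ∑ a : ZMod p, localSum A B p a (m + 1) : ℝ) : ℂ)‖ ≤
      p * (2 * e) := by
  classical
  have hp1 : (1 : ℝ) ≤ p := by exact_mod_cast hp.out.one_lt.le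
  set F := family A B k N with hFdef
  have h1 : ∑ t ∈ F, (satakeAlpha (curve A B t) p ^ (m + 1) +
      satakeBeta (curve A B t) p ^ (m + 1)) / ((√(p : ℝ) ^ (m + 1) : ℝ) : ℂ) =
      ((∑ t ∈ F, localSum A B p t (m + 1) : ℝ) : ℂ) := by
    push_cast
    refine Finset.sum_congr rfl fun t ht => ?_
    have := satake_eq_localSum hadd (hN t ht) hΔ
      (fun h5 => hmin t (hN t ht) (mem_family ht).2 p h5) (Nat.succ_ne_zero m)
    exact_mod_cast this
  rw [h1, card_family_mul_sum F fun a => localSum A B p a (m + 1)]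
  have h2 : (1 / (F.card : ℂ)) * ((∑ a : ZMod p,
      ((F.filter fun t => t ≡ a.val [ZMOD p]).card : ℝ) * localSum A B p a (m + 1) : ℝ) : ℂ) -
      ((sieveH (sievePoly A B) k p / p * ∑ a : ZMod p, localSum A B p a (m + 1) : ℝ) : ℂ) =
      ((∑ a : ZMod p, (((F.filter fun t => t ≡ a.val [ZMOD p]).card : ℝ) / F.card -
        sieveH (sievePoly A B) k p / p) * localSum A B p a (m + 1) : ℝ) : ℂ) := by
    have : ∀ x : ℝ, (1 / (F.card : ℂ)) * (x : ℂ) = ((x / F.card : ℝ) : ℂ) := fun x => by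
      push_cast; ring
    rw [this, ← Complex.ofReal_sub]
    congr 1
    rw [Finset.sum_div, Finset.mul_sum, ← Finset.sum_sub_distrib]
    refine Finset.sum_congr rfl fun a _ => by ring
  rw [h2, Complex.norm_real, Real.norm_eq_abs]
  refine (Finset.abs_sum_le_sum_abs _ _).trans ?_
  refine (Finset.sum_le_card_nsmul _ _ (2 * e) fun a _ => ?_).trans ?_
  · rw [abs_mul]
    -- If the sieve touches the class, the equation has a cusp there for `p ≥ 5`, and for `p < 5`
    -- every local sum is zero. In either case the class contributes nothing, whatever its density.
    by_cases hex : ∀ j : ℕ, k = j → ∀ t : ℤ, t ≡ a.val [ZMOD p] →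
        ¬ (p : ℤ) ^ j ∣ (sievePoly A B).eval t
    · have hb := abs_localSum_le hΔ hadd a (m := m + 1) (Nat.succ_ne_zero m)
      have hr : rootBound p ^ (m + 1) ≤ 1 :=
        pow_le_one₀ (rootBound_nonneg hp1) (rootBound_lt_one (by linarith)).le
      have hd := hdist a.val hex
      calc _ ≤ e * 2 := mul_le_mul hd (by linarith) (abs_nonneg _) he
        _ = 2 * e := mul_comm _ _
    · push Not at hex
      obtain ⟨j, hj, t, ht, hd⟩ := hex
      have hta : (t : ZMod p) = a := by
        rw [← ZMod.intCast_eq_intCast_iff] at ht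
        simpa using ht
      rw [← hta, localSum_eq_zero_of_pow_dvd hΔ hadd hcusp hj hd (Nat.succ_ne_zero m), abs_zero,
        mul_zero]
      positivity
  · rw [Finset.card_univ, ZMod.card, nsmul_eq_mul]

/-! ### The expansion -/

/-- The arguments of `g` are nonnegative and tend to infinity, so its vanishing beyond `σ` leaves
finitely many pairs. Summability then needs no bound on `f`. -/
lemma summable_of_support_lt {f : Nat.Primes × ℕ → ℂ} {g : ℝ → ℂ} {σ L : ℝ} (hL : 0 < L)
    (hg : ∀ y, σ ≤ y → g y = 0) :
    Summable fun x : Nat.Primes × ℕ => f x * g (((x.2 : ℝ) + 1) * (Real.log x.1 / L)) := by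
  refine summable_of_ne_finset_zero (s := primeBox (Real.exp (σ * L))) fun x hx => ?_
  by_cases h : ((x.2 : ℝ) + 1) * (Real.log x.1 / L) < σ
  · exact absurd (mem_primeBox (prime_lt_exp hL h)) hx
  · rw [hg _ (not_lt.mp h), mul_zero]

/-- The main term, in terms of the sums over the residue classes, is the sum of the five terms of
the expansion up to the error of replacing the test function by its value at `0`. -/
lemma neg_two_mul_tsum_eq {C : ℝ}
    (hcontent : ∀ p : ℕ, p.Prime → (p : ℤ) ∣ (discPoly A B).content → p = 2 ∨ p = 3)
    (hadd : ∀ t : ℤ, (discPoly A B).eval t ≠ 0 →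
      AdditiveAt (curve A B t) 2 ∧ AdditiveAt (curve A B t) 3)
    (hC0 : 0 ≤ C) (hC : ∀ p : ℕ, p.Prime → 0 < sieveH (sievePoly A B) k p ∧
      sieveH (sievePoly A B) k p ≤ C) {g : ℝ → ℂ} {σ K : ℝ} {N : ℕ} (hL : 0 < logR A B k N)
    (hg : ∀ y, σ ≤ y → g y = 0) (hK : ∀ x, ‖g x - g 0‖ ≤ K * x ^ 2) :
    -2 * ∑' x : Nat.Primes × ℕ,
      (((termA' A B k x.1 x.2 + goodPart A B k x.1 x.2) / logR A B k N : ℝ) : ℂ) *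
        g (((x.2 : ℝ) + 1) * (Real.log x.1 / logR A B k N)) =
    SA' A B k g N + S0 A B k g N + S1 A B k g N + S2 A B k g N + STilde A B k g N -
      2 * (∑' x : Nat.Primes × ℕ, ((termA' A B k x.1 x.2 / logR A B k N : ℝ) : ℂ) *
        (g (((x.2 : ℝ) + (1 : ℕ)) * (Real.log x.1 / logR A B k N)) - g 0)) -
      2 * (∑' x : Nat.Primes × ℕ, ((goodPart A B k x.1 (x.2 + 2) / logR A B k N : ℝ) : ℂ) *
        (g (((x.2 : ℝ) + (3 : ℕ)) * (Real.log x.1 / logR A B k N)) - g 0)) := by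
  set L := logR A B k N with hLdef
  have hcast : ∀ {ι : Type} {f : ι → ℝ}, Summable f → Summable fun x => ((f x / L : ℝ) : ℂ) :=
    fun h => Complex.summable_ofReal.mpr (h.div_const L)
  obtain ⟨sA, s0, s1, s2, sT⟩ := summable_terms hcontent hadd hC0 hC
  have sG : Summable fun x : Nat.Primes × ℕ => goodPart A B k x.1 (x.2 + 2) :=
    summable_of_abs_le_weight fun x => abs_goodPart_le hcontent hadd hC0 hC x.1 x.2
  have e1 := (norm_tsum_mul_sub_le 1 (fun x => abs_termA'_le hcontent hadd hC0 hC x.1 x.2) hK hL).1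
  have e3 := (norm_tsum_mul_sub_le 3 (f := fun x => goodPart A B k x.1 (x.2 + 2))
    (fun x => abs_goodPart_le hcontent hadd hC0 hC x.1 x.2) hK hL).1
  have hsplit : ∀ x : Nat.Primes × ℕ,
      (((termA' A B k x.1 x.2 + goodPart A B k x.1 x.2) / L : ℝ) : ℂ) *
        g (((x.2 : ℝ) + 1) * (Real.log x.1 / L)) =
      ((termA' A B k x.1 x.2 / L : ℝ) : ℂ) * g (((x.2 : ℝ) + 1) * (Real.log x.1 / L)) +
      ((goodPart A B k x.1 x.2 / L : ℝ) : ℂ) * g (((x.2 : ℝ) + 1) * (Real.log x.1 / L)) := by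
    intro x
    push_cast
    ring
  have hA : ∑' x : Nat.Primes × ℕ, ((termA' A B k x.1 x.2 / L : ℝ) : ℂ) *
        g (((x.2 : ℝ) + 1) * (Real.log x.1 / L)) =
      (∑' x : Nat.Primes × ℕ, ((termA' A B k x.1 x.2 / L : ℝ) : ℂ) *
        (g (((x.2 : ℝ) + (1 : ℕ)) * (Real.log x.1 / L)) - g 0)) +
      (∑' x : Nat.Primes × ℕ, ((termA' A B k x.1 x.2 / L : ℝ) : ℂ)) * g 0 := by
    rw [← tsum_mul_right, ← e1.tsum_add ((hcast sA).mul_right _)]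
    refine tsum_congr fun x => ?_
    push_cast
    ring
  have hG : ∑' x : Nat.Primes × ℕ, ((goodPart A B k x.1 x.2 / L : ℝ) : ℂ) *
        g (((x.2 : ℝ) + 1) * (Real.log x.1 / L)) =
      ∑' p : Nat.Primes, ((main1 A B k p / L : ℝ) : ℂ) * g (Real.log p / L) +
      ∑' p : Nat.Primes, ((goodPart A B k p 1 / L : ℝ) : ℂ) * g (2 * (Real.log p / L)) +
      ((∑' x : Nat.Primes × ℕ, ((goodPart A B k x.1 (x.2 + 2) / L : ℝ) : ℂ) *
        (g (((x.2 : ℝ) + (3 : ℕ)) * (Real.log x.1 / L)) - g 0)) +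
      (∑' x : Nat.Primes × ℕ, ((goodPart A B k x.1 (x.2 + 2) / L : ℝ) : ℂ)) * g 0) := by
    rw [tsum_prod_eq_add_add (summable_of_support_lt hL hg), ← tsum_mul_right,
      ← e3.tsum_add ((hcast sG).mul_right _)]
    congr 1
    · congr 1
      · refine tsum_congr fun p => ?_
        simp [goodPart_zero]
      · refine tsum_congr fun p => ?_
        norm_num
    · refine tsum_congr fun x => ?_
      have : ((x.2 + 2 : ℕ) : ℝ) + 1 = (x.2 : ℝ) + (3 : ℕ) := by push_cast; ring
      rw [this]
      ring
  have hsuppp : ∀ f : Nat.Primes → ℂ, Summable fun p : Nat.Primes =>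
      f p * g (2 * (Real.log p / L)) := fun f => by
    have h := (summable_of_support_lt (f := fun x => f x.1) hL hg).comp_injective
      (i := fun p : Nat.Primes => (p, 1)) fun x y h => (Prod.mk.inj h).1
    refine h.congr fun p => ?_
    norm_num
  have hone : ∑' p : Nat.Primes, ((goodPart A B k p 1 / L : ℝ) : ℂ) * g (2 * (Real.log p / L)) =
      ∑' p : Nat.Primes, ((main2 A B k p / L : ℝ) : ℂ) * g (2 * (Real.log p / L)) -
      ∑' p : Nat.Primes, ((main0 A B k p / L : ℝ) : ℂ) * g (2 * (Real.log p / L)) := by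
    rw [← (hsuppp _).tsum_sub (hsuppp _)]
    refine tsum_congr fun p => ?_
    rw [goodPart_one]
    push_cast
    ring
  have hgood : ∑' x : Nat.Primes × ℕ, ((goodPart A B k x.1 (x.2 + 2) / L : ℝ) : ℂ) =
      ∑' p : Nat.Primes, ((term0 A B k p / L : ℝ) : ℂ) -
      ∑' p : Nat.Primes, ((term1 A B k p / L : ℝ) : ℂ) -
      ∑' p : Nat.Primes, ((term2 A B k p / L : ℝ) : ℂ) +
      ∑' p : Nat.Primes, ((termTilde A B k p / L : ℝ) : ℂ) := by
    rw [← (hcast s0).tsum_sub (hcast s1), ← ((hcast s0).sub (hcast s1)).tsum_sub (hcast s2),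
      ← (((hcast s0).sub (hcast s1)).sub (hcast s2)).tsum_add (hcast sT), (hcast sG).tsum_prod]
    refine tsum_congr fun p => ?_
    have h := Complex.hasSum_ofReal.mpr ((hasSum_goodPart (k := k) hcontent hadd p).div_const L)
    rw [h.tsum_eq]
    push_cast
    ring
  rw [tsum_congr hsplit, (summable_of_support_lt hL hg).tsum_add (summable_of_support_lt hL hg),
    hA, hG, hone, hgood, (hcast sA).tsum_prod, SA', S0, S1, S2, STilde]
  ring

end Asymptotics

/-! ### Comparison of `S` with its main term, the expansion, and the vanishing of the bad terms -/

section Main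

variable {A B : ℤ[X]} {k : ℕ∞}

/-- The summand of `S(F)` for the prime `p` and the exponent `m + 1`. -/
def summandS (A B : ℤ[X]) (k : ℕ∞) (g : ℝ → ℂ) (N : ℕ) (p : Nat.Primes) (m : ℕ) : ℂ :=
  haveI : Fact (p : ℕ).Prime := ⟨p.2⟩
  (1 / ((family A B k N).card : ℂ)) *
    (∑ t ∈ family A B k N,
      (satakeAlpha (curve A B t) p ^ (m + 1) + satakeBeta (curve A B t) p ^ (m + 1)) /
        ((√(p : ℝ) ^ (m + 1) : ℝ) : ℂ)) *
    ((Real.log p / logR A B k N : ℝ) : ℂ) *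
    g ((m + 1) * (Real.log p / logR A B k N))

lemma S_eq (g : ℝ → ℂ) (N : ℕ) :
    S A B k g N = -2 * ∑' p : Nat.Primes, ∑' m : ℕ, summandS A B k g N p m := rfl

lemma rpow_neg_le_inv_log_pow {ε : ℝ} (hε : 0 < ε) {N : ℕ} (hN : 2 ≤ N) :
    (N : ℝ) ^ (-ε) ≤ (3 / ε) ^ 3 / Real.log N ^ 3 := by
  have hN0 : (0 : ℝ) < N := by exact_mod_cast (by omega : 0 < N)
  have hlog : 0 < Real.log N := Real.log_pos (by exact_mod_cast (by omega : 1 < N))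
  have h1 := Real.log_le_rpow_div hN0.le (by positivity : 0 < ε / 3)
  have h2 : Real.log N ^ 3 ≤ ((N : ℝ) ^ (ε / 3) / (ε / 3)) ^ 3 := by gcongr
  have e1 : ((N : ℝ) ^ (ε / 3) / (ε / 3)) ^ 3 = (3 / ε) ^ 3 * (N : ℝ) ^ ε := by
    have e2 : ((N : ℝ) ^ (ε / 3)) ^ 3 = (N : ℝ) ^ ε := by
      rw [← Real.rpow_natCast, ← Real.rpow_mul hN0.le]
      congr 1
      push_cast
      ring
    rw [div_pow, e2, div_pow, div_pow]
    field_simp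
  rw [e1] at h2
  rw [le_div_iff₀ (by positivity), Real.rpow_neg hN0.le, inv_mul_le_iff₀ (by positivity)]
  linarith

/-- The sum over the family, compared to the sum over the residue classes. -/
lemma norm_S_sub_le {g : ℝ → ℂ} {G σ X e : ℝ} {N : ℕ} (hL : 0 < logR A B k N)
    (hg : ∀ y, σ ≤ y → g y = 0) (hG0 : 0 ≤ G) (hG : ∀ x, ‖g x‖ ≤ G) (hσ : 0 < σ)
    (hX : Real.exp (σ * logR A B k N) ≤ X) (he : 0 ≤ e)
    (havg : ∀ (p : Nat.Primes) (m : ℕ), haveI : Fact (p : ℕ).Prime := ⟨p.2⟩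
      ‖(1 / ((family A B k N).card : ℂ)) * (∑ t ∈ family A B k N,
        (satakeAlpha (curve A B t) p ^ (m + 1) + satakeBeta (curve A B t) p ^ (m + 1)) /
          ((√(p : ℝ) ^ (m + 1) : ℝ) : ℂ)) -
      ((sieveH (sievePoly A B) k p / p * ∑ a : ZMod p, localSum A B p a (m + 1) : ℝ) : ℂ)‖ ≤
      p * (2 * e)) :
    ‖S A B k g N - (-2 * ∑' x : Nat.Primes × ℕ,
      (((termA' A B k x.1 x.2 + goodPart A B k x.1 x.2) / logR A B k N : ℝ) : ℂ) *
        g (((x.2 : ℝ) + 1) * (Real.log x.1 / logR A B k N)))‖ ≤ 16 * σ * G * X ^ 3 * e := by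
  set L := logR A B k N with hLdef
  have hX1 : 1 ≤ X := (Real.one_le_exp (by positivity)).trans hX
  set T : Nat.Primes × ℕ → ℂ := fun x => summandS A B k g N x.1 x.2 with hT
  set U : Nat.Primes × ℕ → ℂ := fun x =>
    (((termA' A B k x.1 x.2 + goodPart A B k x.1 x.2) / L : ℝ) : ℂ) *
      g (((x.2 : ℝ) + 1) * (Real.log x.1 / L)) with hU
  have hTs : Summable T := summable_of_support_lt hL hg
  have hUs : Summable U := summable_of_support_lt hL hg
  have hVzero : ∀ x, x ∉ primeBox (Real.exp (σ * L)) → T x - U x = 0 := by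
    intro x hx
    have h : ¬ ((x.2 : ℝ) + 1) * (Real.log x.1 / L) < σ := fun h =>
      hx (mem_primeBox (prime_lt_exp hL h))
    have hz := hg _ (not_lt.mp h)
    simp only [hT, hU, summandS]
    rw [← hLdef, hz, mul_zero, mul_zero, sub_zero]
  have hV : ∀ x, ‖T x - U x‖ ≤ 2 * X * e * σ * G := by
    rintro ⟨p, m⟩
    have : Fact (p : ℕ).Prime := ⟨p.2⟩
    by_cases h : ((m : ℝ) + 1) * (Real.log p / L) < σ
    · have hp1 : (1 : ℝ) ≤ (p : ℕ) := by exact_mod_cast p.2.one_lt.le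
      have hpX : ((p : ℕ) : ℝ) ≤ X := by
        calc ((p : ℕ) : ℝ) = ((p : ℕ) : ℝ) ^ 1 := (pow_one _).symm
          _ ≤ ((p : ℕ) : ℝ) ^ (m + 1) := pow_le_pow_right₀ hp1 (by omega)
          _ ≤ X := (prime_lt_exp hL h).le.trans hX
      have hl0 : 0 ≤ Real.log (p : ℕ) / L := div_nonneg (Real.log_natCast_nonneg _) hL.le
      have hlσ : Real.log (p : ℕ) / L ≤ σ := by
        have : 0 ≤ (m : ℝ) * (Real.log (p : ℕ) / L) := by positivity
        linarith
      have hUeq : U (p, m) =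
          ((sieveH (sievePoly A B) k p / p * ∑ a : ZMod p, localSum A B p a (m + 1) : ℝ) : ℂ) *
          ((Real.log p / L : ℝ) : ℂ) * g (((m : ℝ) + 1) * (Real.log p / L)) := by
        simp only [hU]
        rw [← HLog_mul_sum_localSum, HLog]
        push_cast
        ring
      have hTU : T (p, m) - U (p, m) = ((1 / ((family A B k N).card : ℂ)) *
          (∑ t ∈ family A B k N,
            (satakeAlpha (curve A B t) p ^ (m + 1) + satakeBeta (curve A B t) p ^ (m + 1)) /
              ((√(p : ℝ) ^ (m + 1) : ℝ) : ℂ)) -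
          ((sieveH (sievePoly A B) k p / p * ∑ a : ZMod p, localSum A B p a (m + 1) : ℝ) : ℂ)) *
          ((Real.log p / L : ℝ) : ℂ) * g (((m : ℝ) + 1) * (Real.log p / L)) := by
        rw [hUeq, sub_mul, sub_mul]
        rfl
      rw [hTU, norm_mul, norm_mul, Complex.norm_real, Real.norm_of_nonneg hl0]
      calc _ ≤ (p : ℕ) * (2 * e) * σ * G :=
            mul_le_mul (mul_le_mul (havg p m) hlσ hl0 (by positivity)) (hG _) (norm_nonneg _)
              (by positivity)
        _ ≤ X * (2 * e) * σ * G := by gcongr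
        _ = _ := by ring
    · have hz := hg _ (not_lt.mp h)
      have : T (p, m) - U (p, m) = 0 := by
        simp only [hT, hU, summandS]
        rw [← hLdef, hz, mul_zero, mul_zero, sub_zero]
      rw [this, norm_zero]
      positivity
  have hS : S A B k g N = -2 * ∑' x, T x := by rw [S_eq, hTs.tsum_prod]
  -- Only pairs with `p ^ (m + 1) < X` matter. There are at most `(2X)²` of them, each with error at
  -- most `2X e σ G`.
  rw [hS, ← mul_sub, ← hTs.tsum_sub hUs, tsum_eq_sum fun x hx => hVzero x hx, norm_mul]
  have hcard := card_primeBox_le (Real.one_le_exp (by positivity : 0 ≤ σ * L))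
  have hsum : ‖∑ x ∈ primeBox (Real.exp (σ * L)), (T x - U x)‖ ≤
      (2 * X) ^ 2 * (2 * X * e * σ * G) := by
    refine (norm_sum_le _ _).trans ?_
    refine (Finset.sum_le_card_nsmul _ _ _ fun x _ => hV x).trans ?_
    rw [nsmul_eq_mul]
    refine mul_le_mul_of_nonneg_right (hcard.trans ?_) (by positivity)
    gcongr
  have h2 : ‖(-2 : ℂ)‖ = 2 := by simp
  rw [h2]
  calc _ ≤ 2 * ((2 * X) ^ 2 * (2 * X * e * σ * G)) := by gcongr
    _ = _ := by ring

/-- The expansion of `S(F)` for test functions of small support. -/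
theorem exists_expansion (hk : 3 ≤ k)
    (hcontent : ∀ p : ℕ, p.Prime → (p : ℤ) ∣ (discPoly A B).content → p = 2 ∨ p = 3)
    (hfactors : ∀ f ∈ discFactors A B, ∀ g ∈ discFactors A B, f ≠ g →
      ∀ (t : ℤ) (p : ℕ), p.Prime → ¬ ((p : ℤ) ∣ f.eval t ∧ (p : ℤ) ∣ g.eval t))
    (hadd : ∀ t : ℤ, (discPoly A B).eval t ≠ 0 →
      AdditiveAt (curve A B t) 2 ∧ AdditiveAt (curve A B t) 3)
    (hmin : ∀ t : ℤ, (discPoly A B).eval t ≠ 0 → PowerFree k ((sievePoly A B).eval t) →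
      ∀ (p : ℕ) [Fact p.Prime], 5 ≤ p → MinimalAt (curve A B t) p)
    (hcusp : ∀ j : ℕ, k = j → ∀ (t : ℤ) (p : ℕ), p.Prime → 5 ≤ p →
      (p : ℤ) ^ j ∣ (sievePoly A B).eval t → (p : ℤ) ∣ A.eval t ∧ (p : ℤ) ∣ B.eval t)
    (hdeg : ∀ f ∈ discFactors A B, (f.natDegree : ℕ∞) < k)
    (hlocal : ∀ j : ℕ, k = j → ∀ p : ℕ, p.Prime →
      ∃ t : ℤ, ¬ (p : ℤ) ^ j ∣ (sievePoly A B).eval t) :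
    ∃ σ : ℝ, 0 < σ ∧ ∀ φ : 𝓢(ℝ, ℂ), (∀ x, φ (-x) = φ x) →
      tsupport (𝓕 (φ : ℝ → ℂ)) ⊆ Set.Ioo (-σ) σ →
      (fun N : ℕ => S A B k (𝓕 (φ : ℝ → ℂ)) N -
        (SA' A B k (𝓕 (φ : ℝ → ℂ)) N + S0 A B k (𝓕 (φ : ℝ → ℂ)) N +
          S1 A B k (𝓕 (φ : ℝ → ℂ)) N + S2 A B k (𝓕 (φ : ℝ → ℂ)) N +
          STilde A B k (𝓕 (φ : ℝ → ℂ)) N))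
        =O[Filter.atTop] fun N : ℕ => 1 / logR A B k N ^ 3 := by
  have hΔ := discPoly_ne_zero hcontent
  obtain ⟨δ, C, M₁, hδ, hC0, hM₁, hC, hdist⟩ :=
    exists_family_equidistribution A B k hk hfactors hdeg hlocal
  obtain ⟨c, M₂, hc, hlogR⟩ := exists_logR_bounds (k := k) hΔ hadd
  obtain ⟨M₃, hM₃⟩ := exists_forall_eval_ne_zero hΔ
  refine ⟨δ / (4 * c), by positivity, fun φ hφ hsupp => ?_⟩
  -- Since `log R ≤ c log N`, this gives `R ^ σ ≤ N ^ (δ/4) = X`. The error `X³ N ^ (-δ)` is then `N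
  -- ^ (-δ/4)`, smaller than any power of `1 / log N`.
  set σ := δ / (4 * c) with hσdef
  have hσ : 0 < σ := by positivity
  obtain ⟨G, K, hG0, hK0, hG, hK⟩ := exists_testFunction_bounds φ hφ
  set g := 𝓕 (φ : ℝ → ℂ) with hgdef
  have hg : ∀ y, σ ≤ y → g y = 0 := fun y hy => by
    refine image_eq_zero_of_notMem_tsupport fun hmem => ?_
    exact absurd (hsupp hmem).2 (not_lt.mpr hy)
  set R₁ := ((discPoly A B).natDegree * C) * K * (∑' x : Nat.Primes × ℕ,
      weight x.1 * Real.log x.1 ^ 2 * (((x.2 : ℝ) + (1 : ℕ)) ^ 2 * theta ^ x.2)) with hR₁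
  set R₃ := (2 * 31 ^ 3 * C) * K * (∑' x : Nat.Primes × ℕ,
      weight x.1 * Real.log x.1 ^ 2 * (((x.2 : ℝ) + (3 : ℕ)) ^ 2 * theta ^ x.2)) with hR₃
  set R₀ := 16 * σ * G * C * ((3 / (δ / 4)) ^ 3 * c ^ 3) with hR₀
  refine Asymptotics.IsBigO.of_bound (R₀ + 2 * R₁ + 2 * R₃) ?_
  filter_upwards [Filter.eventually_ge_atTop (M₁ + M₂ + M₃ + 2)] with N hN
  obtain ⟨hcard, hdistN⟩ := hdist N (by omega)
  obtain ⟨hL2, hLc⟩ := hlogR N (by omega) hcard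
  have hL : 0 < logR A B k N := (Real.log_pos (by norm_num)).trans_le hL2
  have hN0 : (0 : ℝ) < N := by exact_mod_cast (by omega : 0 < N)
  have hlogN : 0 < Real.log N := Real.log_pos (by exact_mod_cast (by omega : 1 < N))
  have hne : ∀ t ∈ family A B k N, (discPoly A B).eval t ≠ 0 := fun t ht => by
    refine hM₃ t ?_
    have := (Finset.mem_Icc.mp (mem_family ht).1).1
    omega
  set e := C * (N : ℝ) ^ (-δ) with he
  have he0 : 0 ≤ e := by positivity
  set X := (N : ℝ) ^ (δ / 4) with hXdef
  have hX : Real.exp (σ * logR A B k N) ≤ X := by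
    rw [hXdef, Real.rpow_def_of_pos hN0]
    refine Real.exp_le_exp.mpr ?_
    calc σ * logR A B k N ≤ σ * (c * Real.log N) := by gcongr
      _ = Real.log N * (δ / 4) := by rw [hσdef]; field_simp
  have h1 := norm_S_sub_le hL hg hG0 hG hσ hX he0 fun p m => by
    have : Fact (p : ℕ).Prime := ⟨p.2⟩
    exact norm_average_sub_le hΔ hadd hmin hcusp he0 hne p
      (fun a ha => hdistN p a p.2 ha) m
  have h2 := neg_two_mul_tsum_eq hcontent hadd hC0 hC hL hg hK
  have hE1 := (norm_tsum_mul_sub_le 1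
    (fun x => abs_termA'_le hcontent hadd hC0 hC x.1 x.2) hK hL).2
  have hE3 := (norm_tsum_mul_sub_le 3 (f := fun x => goodPart A B k x.1 (x.2 + 2))
    (fun x => abs_goodPart_le hcontent hadd hC0 hC x.1 x.2) hK hL).2
  rw [← hR₁] at hE1
  rw [← hR₃] at hE3
  rw [h2] at h1
  set Z := SA' A B k g N + S0 A B k g N + S1 A B k g N + S2 A B k g N + STilde A B k g N
  set E₁ := ∑' x : Nat.Primes × ℕ, ((termA' A B k x.1 x.2 / logR A B k N : ℝ) : ℂ) *
        (g (((x.2 : ℝ) + (1 : ℕ)) * (Real.log x.1 / logR A B k N)) - g 0)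
  set E₃ := ∑' x : Nat.Primes × ℕ, ((goodPart A B k x.1 (x.2 + 2) / logR A B k N : ℝ) : ℂ) *
        (g (((x.2 : ℝ) + (3 : ℕ)) * (Real.log x.1 / logR A B k N)) - g 0)
  have hXe : X ^ 3 * e = C * (N : ℝ) ^ (-(δ / 4)) := by
    have : X ^ 3 = (N : ℝ) ^ (3 * (δ / 4)) := by
      rw [hXdef, ← Real.rpow_natCast, ← Real.rpow_mul hN0.le]
      congr 1
      push_cast
      ring
    rw [this, he, mul_left_comm, ← Real.rpow_add hN0]
    congr 2
    ring
  have hpow : (N : ℝ) ^ (-(δ / 4)) ≤ (3 / (δ / 4)) ^ 3 * c ^ 3 / logR A B k N ^ 3 := by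
    refine (rpow_neg_le_inv_log_pow (by positivity : 0 < δ / 4) (by omega)).trans ?_
    rw [div_le_div_iff₀ (by positivity) (by positivity), mul_assoc, ← mul_pow c]
    gcongr
  have h1' : 16 * σ * G * X ^ 3 * e ≤ R₀ / logR A B k N ^ 3 := by
    calc 16 * σ * G * X ^ 3 * e = 16 * σ * G * (X ^ 3 * e) := by ring
      _ ≤ 16 * σ * G * (C * ((3 / (δ / 4)) ^ 3 * c ^ 3 / logR A B k N ^ 3)) := by
          rw [hXe]; gcongr
      _ = _ := by rw [hR₀]; ring
  have hfin : S A B k g N - Z = (S A B k g N - (Z - 2 * E₁ - 2 * E₃)) + (-2 * E₁ + -2 * E₃) := by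
    ring
  rw [hfin, Real.norm_of_nonneg (by positivity)]
  have h22 : ‖(-2 : ℂ)‖ = 2 := by simp
  calc _ ≤ ‖S A B k g N - (Z - 2 * E₁ - 2 * E₃)‖ + (‖-2 * E₁‖ + ‖-2 * E₃‖) :=
        (norm_add_le _ _).trans (add_le_add le_rfl (norm_add_le _ _))
    _ ≤ R₀ / logR A B k N ^ 3 + (2 * (R₁ / logR A B k N ^ 3) + 2 * (R₃ / logR A B k N ^ 3)) := by
        rw [norm_mul, norm_mul, h22]
        gcongr
        exact h1.trans h1'
    _ = _ := by ring

/-- The bad terms of the expansion vanish for a family without multiplicative reduction. -/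
theorem termA'_eq_zero (hk : 3 ≤ k)
    (hcontent : ∀ p : ℕ, p.Prime → (p : ℤ) ∣ (discPoly A B).content → p = 2 ∨ p = 3)
    (hfactors : ∀ f ∈ discFactors A B, ∀ g ∈ discFactors A B, f ≠ g →
      ∀ (t : ℤ) (p : ℕ), p.Prime → ¬ ((p : ℤ) ∣ f.eval t ∧ (p : ℤ) ∣ g.eval t))
    (hadd : ∀ t : ℤ, (discPoly A B).eval t ≠ 0 →
      AdditiveAt (curve A B t) 2 ∧ AdditiveAt (curve A B t) 3)
    (hmin : ∀ t : ℤ, (discPoly A B).eval t ≠ 0 → PowerFree k ((sievePoly A B).eval t) →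
      ∀ (p : ℕ) [Fact p.Prime], 5 ≤ p → MinimalAt (curve A B t) p)
    (hcusp : ∀ j : ℕ, k = j → ∀ (t : ℤ) (p : ℕ), p.Prime → 5 ≤ p →
      (p : ℤ) ^ j ∣ (sievePoly A B).eval t → (p : ℤ) ∣ A.eval t ∧ (p : ℤ) ∣ B.eval t)
    (hdeg : ∀ f ∈ discFactors A B, (f.natDegree : ℕ∞) < k)
    (hlocal : ∀ j : ℕ, k = j → ∀ p : ℕ, p.Prime →
      ∃ t : ℤ, ¬ (p : ℤ) ^ j ∣ (sievePoly A B).eval t)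
    (hmult : ∀ t : ℤ, (discPoly A B).eval t ≠ 0 → PowerFree k ((sievePoly A B).eval t) →
      ∀ (p : ℕ) [Fact p.Prime], ¬ MultiplicativeAt (curve A B t) p) (p : Nat.Primes) (m : ℕ) :
    termA' A B k p m = 0 := by
  classical
  have hΔ := discPoly_ne_zero hcontent
  have hp : Fact (p : ℕ).Prime := ⟨p.2⟩
  suffices h : ∀ a : ZMod p, aeval a (discPoly A B) = 0 → aMod A B p a = 0 by
    have : calA' A B (m + 1) p = 0 := Finset.sum_eq_zero fun a ha => by
      rw [h a (Finset.mem_filter.mp ha).2]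
      simp
    rw [termA', this, zero_mul, zero_div]
  intro a ha
  by_cases h5 : (p : ℕ) < 5
  · exact (aMod_eq_zero_of_lt_five hΔ hadd h5 a).2
  have h5' : 5 ≤ (p : ℕ) := not_lt.mp h5
  by_cases hA : aeval a A = 0
  · have hB : aeval a B = 0 := by
      obtain ⟨e, hAe, hBe⟩ := exists_node h5' A B a ha
      have he : e ^ 2 = 0 := (mul_eq_zero.mp (hAe.symm.trans hA)).resolve_left
        (neg_ne_zero.mpr (two_three_ne_zero h5').2)
      rw [hBe, pow_succ, he]
      simp
    exact aMod_of_cusp h5' A B a hA hB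
  -- A bad class with `A ≠ 0` is a node. It cannot meet the sieve condition at `p`, which would
  -- impose a cusp, so it has positive density in the family.
  exfalso
  obtain ⟨δ, C, M₁, hδ, hC0, hM₁, hC, hdist⟩ :=
    exists_family_equidistribution A B k hk hfactors hdeg hlocal
  obtain ⟨M₃, hM₃⟩ := exists_forall_eval_ne_zero hΔ
  have hclass : ∀ j : ℕ, k = j → ∀ t : ℤ, t ≡ a.val [ZMOD p] →
      ¬ ((p : ℕ) : ℤ) ^ j ∣ (sievePoly A B).eval t := by
    intro j hj t ht hd
    have hta : (t : ZMod p) = a := by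
      rw [← ZMod.intCast_eq_intCast_iff] at ht
      simpa using ht
    refine hA ?_
    rw [← hta, aeval_intCast_zmod]
    exact (ZMod.intCast_zmod_eq_zero_iff_dvd _ _).mpr (hcusp j hj t p p.2 h5' hd).1
  have hpos : 0 < sieveH (sievePoly A B) k p / (p : ℕ) :=
    div_pos (hC p p.2).1 (by exact_mod_cast p.2.pos)
  have htend : Filter.Tendsto (fun N : ℕ => C * (N : ℝ) ^ (-δ)) Filter.atTop (nhds 0) := by
    have := ((tendsto_rpow_neg_atTop hδ).comp tendsto_natCast_atTop_atTop).const_mul C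
    simpa using this
  obtain ⟨N, hsmall, hN⟩ := ((htend.eventually (gt_mem_nhds hpos)).and
    (Filter.eventually_ge_atTop (M₁ + M₃))).exists
  have hcount := (abs_le.mp ((hdist N (by omega)).2 p a.val p.2 hclass)).1
  have hne : ((family A B k N).filter fun t => t ≡ a.val [ZMOD p]).Nonempty := by
    rw [Finset.nonempty_iff_ne_empty]
    intro h0
    rw [h0, Finset.card_empty, Nat.cast_zero, zero_div] at hcount
    linarith
  -- Such a `t` has `p ∣ Δ(t)` and `p ∤ c₄` in an equation minimal at `p`, which is multiplicative
  -- reduction.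
  obtain ⟨t, ht⟩ := hne
  obtain ⟨htF, hta⟩ := Finset.mem_filter.mp ht
  obtain ⟨htI, htP⟩ := mem_family htF
  have ht0 := hM₃ t (by have := (Finset.mem_Icc.mp htI).1; omega)
  have hta' : (t : ZMod p) = a := by
    rw [← ZMod.intCast_eq_intCast_iff] at hta
    simpa using hta
  refine hmult t ht0 htP p ?_
  have h0 : (curve A B t).Δ ≠ 0 := by rwa [curve_Δ]
  refine (hasMultiplicativeReduction_minimal_iff _ (hmin t ht0 htP p h5') h0).mpr ⟨?_, ?_⟩
  · rw [dvd_eval_disc_iff, hta']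
    exact ha
  · rw [dvd_curve_c₄_iff h5', hta']
    exact hA

end Main

end

end ECFamily

theorem theorem4p2 (A B : ℤ[X]) (k : ℕ∞) (hk : 3 ≤ k)
    -- only the primes 2 and 3 may divide all the coefficients of the discriminant
    (hcontent : ∀ p : ℕ, p.Prime → (p : ℤ) ∣ (ECFamily.discPoly A B).content → p = 2 ∨ p = 3)
    -- no prime divides the values at `t` of two different factors of `D`
    (hfactors : ∀ f ∈ ECFamily.discFactors A B, ∀ g ∈ ECFamily.discFactors A B, f ≠ g →
      ∀ (t : ℤ) (p : ℕ), p.Prime → ¬ ((p : ℤ) ∣ f.eval t ∧ (p : ℤ) ∣ g.eval t))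
    -- every specialized curve has additive reduction at 2 and 3
    (hadd : ∀ t : ℤ, (ECFamily.discPoly A B).eval t ≠ 0 →
      ECFamily.AdditiveAt (ECFamily.curve A B t) 2 ∧ ECFamily.AdditiveAt (ECFamily.curve A B t) 3)
    -- if `D(t)` is `k`-th power free, then the equation of `E_t` is minimal at every `p ≥ 5`
    (hmin : ∀ t : ℤ, (ECFamily.discPoly A B).eval t ≠ 0 →
      ECFamily.PowerFree k ((ECFamily.sievePoly A B).eval t) →
      ∀ (p : ℕ) [Fact p.Prime], 5 ≤ p → ECFamily.MinimalAt (ECFamily.curve A B t) p)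
    -- the sieve at `p ≥ 5` only removes `t` for which the equation has a cusp modulo `p`
    (hcusp : ∀ j : ℕ, k = j → ∀ (t : ℤ) (p : ℕ), p.Prime → 5 ≤ p →
      (p : ℤ) ^ j ∣ (ECFamily.sievePoly A B).eval t → (p : ℤ) ∣ A.eval t ∧ (p : ℤ) ∣ B.eval t)
    -- the sieve is unconditional and has no local obstruction
    (hdeg : ∀ f ∈ ECFamily.discFactors A B, (f.natDegree : ℕ∞) < k)
    (hlocal : ∀ j : ℕ, k = j → ∀ p : ℕ, p.Prime →
      ∃ t : ℤ, ¬ (p : ℤ) ^ j ∣ (ECFamily.sievePoly A B).eval t) :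
    -- the series that occur in the expansion converge absolutely
    (Summable (fun x : Nat.Primes × ℕ => ECFamily.termA' A B k x.1 x.2) ∧
      Summable (ECFamily.term0 A B k) ∧ Summable (ECFamily.term1 A B k) ∧
      Summable (ECFamily.term2 A B k) ∧ Summable (ECFamily.termTilde A B k)) ∧
    -- the expansion, for test functions of sufficiently small support
    (∃ σ : ℝ, 0 < σ ∧ ∀ φ : 𝓢(ℝ, ℂ), (∀ x, φ (-x) = φ x) →
      tsupport (𝓕 (φ : ℝ → ℂ)) ⊆ Set.Ioo (-σ) σ →
      (fun N : ℕ => ECFamily.S A B k (𝓕 (φ : ℝ → ℂ)) N -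
        (ECFamily.SA' A B k (𝓕 (φ : ℝ → ℂ)) N + ECFamily.S0 A B k (𝓕 (φ : ℝ → ℂ)) N +
          ECFamily.S1 A B k (𝓕 (φ : ℝ → ℂ)) N + ECFamily.S2 A B k (𝓕 (φ : ℝ → ℂ)) N +
          ECFamily.STilde A B k (𝓕 (φ : ℝ → ℂ)) N))
        =O[Filter.atTop] fun N : ℕ => 1 / ECFamily.logR A B k N ^ 3) ∧
    -- if the family has no multiplicative reduction, then `S_{𝒜'}` vanishes
    ((∀ t : ℤ, (ECFamily.discPoly A B).eval t ≠ 0 →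
        ECFamily.PowerFree k ((ECFamily.sievePoly A B).eval t) →
        ∀ (p : ℕ) [Fact p.Prime], ¬ ECFamily.MultiplicativeAt (ECFamily.curve A B t) p) →
      ∀ (φ : 𝓢(ℝ, ℂ)) (N : ℕ), ECFamily.SA' A B k (𝓕 (φ : ℝ → ℂ)) N = 0) := by
  obtain ⟨_, _, _, _, hC0, _, hC, _⟩ :=
    ECFamily.exists_family_equidistribution A B k hk hfactors hdeg hlocal
  refine ⟨ECFamily.summable_terms hcontent hadd hC0 hC,
    ECFamily.exists_expansion hk hcontent hfactors hadd hmin hcusp hdeg hlocal,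
    fun hmult φ N => ?_⟩
  simp [ECFamily.SA', ECFamily.termA'_eq_zero hk hcontent hfactors hadd hmin hcusp hdeg hlocal
    hmult]
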